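/- **Setting.** Let $\mathcal X$ be a Polish space, $\mathcal Y$ a separable Hilbert space, and $\rho$ a Borel probability measure on $\mathcal X\times\mathcal Y$ whose marginal $\rho_{\mathcal X}$ on $\mathcal X$ has full support. Write $L^2=L^2(\mathcal X,\rho_{\mathcal X};\mathcal Y)$ and let $h^\dagger(x)=\int_{\mathcal Y}y\,\mathrm d\rho(y|x)$ be the regression operator. Let $K:\mathcal X\times\mathcal X\to\mathcal B(\mathcal Y)$ be an operator-valued kernel, i.e. $K(x,x')=K(x',x)^*$ and $\sum_{i,j=1}^n\langle K(x_i,x_j)y_j,y_i\rangle\ge 0$ for all $n$, $x_i\in\mathcal X$, $y_i\in\mathcal Y$. Assume that all elements of its reproducing kernel Hilbert space $\mathcal H_K$ are continuous functions $\mathcal X\to\mathcal Y$, and that $\sup_x\|K(x,x)\|\le\kappa^2$ with $\kappa>0$. Let $\iota_K:\mathcal H_K\to L^2$ be the embedding and let $L_K=\iota_K\iota_K^*$, that is, $(L_Kh)(x)=\int_{\mathcal X}K(x,t)h(t)\,\mathrm d\rho_{\mathcal X}(t)$. Powers of this bounded positive operator are taken in the functional calculus. Let $[\mathcal H_K]^1=\{L_K^{1/2}f: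 f\in(\ker L_K)^\perp\}\subset L^2$ with norm $\|L_K^{1/2}f\|_{[\mathcal H_K]^1}=\|f\|_{L^2}$. For $0<\beta<1$ let $$\|f\|_{\beta,2}=\Big(\int_0^\infty\big(t^{-\beta}K(f,t)\big)^2\frac{\mathrm dt}{t}\Big)^{1/2},\qquad K(f,t)=\inf_{f=f_1+f_2}\big\{\|f_1\|_{L^2}+t\,\|f_2\|_{[\mathcal H_K]^1}\big\},$$ be the norm of the real interpolation space $[L^2,[\mathcal H_K]^1]_{\beta,2}$. For an i.i.d. sample $z_t=(x_t,y_t)$, $t=1,\dots,T$, from $\rho$ and step sizes $\eta_t>0$ let $$h_1=0,\qquad h_{t+1}=h_t-\eta_tK(\cdot,x_t)\big(h_t(x_t)-y_t\big)\in\mathcal H_K .$$ For $0<\theta<1$ let $\delta=\delta(\theta)$ be the least constant such that, for all $T\ge2$ and $a>0$, with $\eta_t=at^{-\theta}$, $$\sum_{t=1}^{T-1}\frac{\eta_t^2}{1+\sum_{j=t+1}^T\eta_j}\le\delta\,\frac{a^2}{\min\{1,\frac a{1-\theta}\}}\cdot\begin{cases}(T+1)^{-\theta}\log(T+1),&\theta\le\frac12,\\(T+1)^{-(1-\theta)},&\theta>\frac12,\end{cases}$$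 and for $0<\theta,\theta'<1$ put $$\gamma_1=\frac{\theta}{4\kappa^2(1+2\kappa^2)(\delta+1)},\qquad \gamma_1'=\frac{\theta'}{4\kappa^2(1+2\kappa^2)(1+2\theta')} .$$ **Theorem.** Let $0<\beta<1$. Suppose that $\mathbb E_{(x,y)\sim\rho}\|y-h^\dagger(x)\|_{\mathcal Y}^2\le\sigma^2$ with $\sigma>0$, and that $h^\dagger=L_K^rg^\dagger$ with $r>\beta/2$ and $g^\dagger\in L^2$. (Read $\|L_K\|^{-1}=\infty$ if $L_K=0$.) 1. Let $0<\theta<1$. There is a constant $c_2>0$, independent of $T$ and $\eta_1$, such that for all $0<\eta_1<\min\{\|L_K\|^{-1},1-\theta,\gamma_1\}$ and all $T\ge1$ the scheme with step sizes $\eta_t=\eta_1t^{-\theta}$ satisfies $$\mathbb E_{z^T}\|h_{T+1}-h^\dagger\|_{\beta,2}^2\le c_2\,\eta_1^{-(2r-\beta)}\begin{cases}(T+1)^{\beta-\theta(1+\beta)}f_1(T),&\frac{\beta}{1+\beta}<\theta\le\frac{\min\{2r,1\}}{1+\min\{2r,1\}},\\(T+1)^{-\min\{2r-\beta,1-\beta\}(1-\theta)},&\frac{\min\{2r,1\}}{1+\min\{2r,1\}}<\theta<1,\end{cases}$$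 where $f_1(T)=\log(T+1)$ if $\theta=\frac12$ and $f_1(T)=1$ otherwise. 2. Let $0<\theta'<1$. There is a constant $c_2'>0$, independent of $T$ and $\eta$, such that for all $0<\eta<\min\{\|L_K\|^{-1},1,\gamma_1'\}$ and all $T\ge1$ the scheme with the constant step sizes $\eta_t=\eta T^{-\theta'}$, $t=1,\dots,T$, satisfies $$\mathbb E_{z^T}\|h_{T+1}-h^\dagger\|_{\beta,2}^2\le c_2'\,\eta^{-(2r-\beta)}\begin{cases}T^{\beta-\theta'(1+\beta)},&\frac{\beta}{1+\beta}<\theta'\le\frac{2r}{2r+1},\\T^{-(2r-\beta)(1-\theta')},&\frac{2r}{2r+1}<\theta'<1.\end{cases}$$ -/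

import Mathlib

open MeasureTheory Set
open scoped ENNReal InnerProductSpace

namespace OVK

/-! ### Powers of a positive bounded operator -/

/-- `IsRPow A r B`: the operator `B` is `A ^ r` in the sense of the continuous functional calculus,
i.e. `p(A)` is as close to `B` in operator norm as the real polynomial `p` is to `x ↦ x ^ r`
uniformly on `[0, ‖A‖]`, an interval which contains the spectrum of a positive operator `A`. -/
def IsRPow {𝕜 E : Type*} [RCLike 𝕜] [NormedAddCommGroup E] [InnerProductSpace 𝕜 E]
    (A : E →L[𝕜] E) (r : ℝ) (B : E →L[𝕜] E) : Prop :=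
  ∀ (p : Polynomial ℝ) (ε : ℝ), (∀ x ∈ Icc (0 : ℝ) ‖A‖, |p.eval x - x ^ r| ≤ ε) →
    ‖Polynomial.aeval A (p.map (algebraMap ℝ 𝕜)) - B‖ ≤ ε

/-- The power `A ^ r` of a positive bounded operator `A`, `0 ≤ r`: the unique operator `B` with
`IsRPow A r B` (existence and uniqueness are proved in `isRPow_iff`). -/
noncomputable def opRPow {𝕜 E : Type*} [RCLike 𝕜] [NormedAddCommGroup E] [InnerProductSpace 𝕜 E]
    (A : E →L[𝕜] E) (r : ℝ) : E →L[𝕜] E :=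
  Classical.epsilon (IsRPow A r)

theorem isUnit_linear {𝕜 E : Type*} [RCLike 𝕜] [NormedAddCommGroup E] [InnerProductSpace 𝕜 E]
    [CompleteSpace E] {A : E →L[𝕜] E} (hA : A.IsPositive) {l : ℝ} (hl : l ∉ Icc (0 : ℝ) ‖A‖) :
    IsUnit (A - algebraMap 𝕜 (E →L[𝕜] E) (l : 𝕜)) := by
  have key : ∀ x : E, RCLike.re ⟪(A - algebraMap 𝕜 (E →L[𝕜] E) (l : 𝕜)) x, x⟫_𝕜
      = RCLike.re ⟪A x, x⟫_𝕜 - l * ‖x‖ ^ 2 := by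
    intro x
    have : (A - algebraMap 𝕜 (E →L[𝕜] E) (l : 𝕜)) x = A x - (l : 𝕜) • x := by
      simp [Algebra.algebraMap_eq_smul_one]
    rw [this, inner_sub_left, inner_smul_left, map_sub]
    simp
  have h0 : ∀ x : E, 0 ≤ RCLike.re ⟪A x, x⟫_𝕜 := fun x => hA.re_inner_nonneg_left x
  have h1 : ∀ x : E, RCLike.re ⟪A x, x⟫_𝕜 ≤ ‖A‖ * ‖x‖ ^ 2 := fun x => by
    have := RCLike.re_le_norm ⟪A x, x⟫_𝕜
    have h2 := norm_inner_le_norm (𝕜 := 𝕜) (A x) x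
    have h3 := A.le_opNorm x
    nlinarith [norm_nonneg x]
  rcases lt_or_ge l 0 with h | h
  · refine ContinuousLinearMap.isUnit_of_forall_le_norm_inner_map _ (c := (-l).toNNReal)
      (Real.toNNReal_pos.2 (neg_pos.2 h)) fun x => ?_
    refine le_trans ?_ (RCLike.re_le_norm _)
    rw [key, Real.coe_toNNReal _ (by linarith)]
    nlinarith [h0 x]
  · have h' : ‖A‖ < l := by
      by_contra hc
      exact hl ⟨h, not_lt.1 hc⟩
    refine ContinuousLinearMap.isUnit_of_forall_le_norm_inner_map _ (c := (l - ‖A‖).toNNReal)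
      (Real.toNNReal_pos.2 (sub_pos.2 h')) fun x => ?_
    refine le_trans ?_ (RCLike.abs_re_le_norm _)
    rw [key, Real.coe_toNNReal _ (by linarith)]
    refine le_trans ?_ (neg_le_abs _)
    nlinarith [h1 x]

theorem isUnit_quadratic {𝕜 E : Type*} [RCLike 𝕜] [NormedAddCommGroup E] [InnerProductSpace 𝕜 E]
    [CompleteSpace E] {A : E →L[𝕜] E} (hA : A.IsPositive) {a b : ℝ} (hb : 0 < b) :
    IsUnit ((A - algebraMap 𝕜 (E →L[𝕜] E) (a : 𝕜)) * (A - algebraMap 𝕜 (E →L[𝕜] E) (a : 𝕜))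
      + algebraMap 𝕜 (E →L[𝕜] E) (b : 𝕜)) := by
  set D := A - algebraMap 𝕜 (E →L[𝕜] E) (a : 𝕜) with hD
  have hsa : IsSelfAdjoint D := by
    refine hA.isSelfAdjoint.sub ?_
    rw [Algebra.algebraMap_eq_smul_one]
    simp [isSelfAdjoint_iff, star_smul]
  have hadj : D.adjoint = D := hsa
  refine ContinuousLinearMap.isUnit_of_forall_le_norm_inner_map _ (c := b.toNNReal)
      (Real.toNNReal_pos.2 hb) fun x => ?_
  refine le_trans ?_ (RCLike.re_le_norm _)
  have : (D * D + algebraMap 𝕜 (E →L[𝕜] E) (b : 𝕜)) x = D (D x) + (b : 𝕜) • x := by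
    simp [Algebra.algebraMap_eq_smul_one]
  rw [this, inner_add_left, inner_smul_left, map_add]
  have h2 : ⟪D (D x), x⟫_𝕜 = ⟪D x, D x⟫_𝕜 := by
    conv_lhs => rw [← hadj, ContinuousLinearMap.adjoint_inner_left, hadj]
  rw [h2, inner_self_eq_norm_sq, Real.coe_toNNReal _ hb.le]
  simp
  nlinarith [sq_nonneg ‖D x‖]

theorem isUnit_aeval {𝕜 E : Type*} [RCLike 𝕜] [NormedAddCommGroup E] [InnerProductSpace 𝕜 E]
    [CompleteSpace E] {A : E →L[𝕜] E} (hA : A.IsPositive) (q : Polynomial ℝ)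
    (hq : ∀ x ∈ Icc (0 : ℝ) ‖A‖, q.eval x ≠ 0) :
    IsUnit (Polynomial.aeval A (q.map (algebraMap ℝ 𝕜))) := by
  induction hn : q.natDegree using Nat.strong_induction_on generalizing q with
  | _ n ih =>
  have hq0 : q ≠ 0 := by
    rintro rfl
    exact hq 0 ⟨le_rfl, norm_nonneg A⟩ (by simp)
  rcases Nat.eq_zero_or_pos n with h | h
  · obtain ⟨c, rfl⟩ : ∃ c, q = Polynomial.C c := ⟨_, Polynomial.eq_C_of_natDegree_eq_zero (hn.trans h)⟩
    have hc : c ≠ 0 := by simpa using hq0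
    rw [Polynomial.map_C, Polynomial.aeval_C]
    refine IsUnit.map _ (IsUnit.mk0 _ ?_)
    simpa using hc
  · obtain ⟨z, hz⟩ : ∃ z : ℂ, Polynomial.aeval z q = 0 := by
      refine IsAlgClosed.exists_aeval_eq_zero ℂ q ?_
      rw [Polynomial.degree_eq_natDegree hq0]
      intro h'
      have : q.natDegree = 0 := by exact_mod_cast h'
      omega
    by_cases him : z.im = 0
    · have hroot : q.IsRoot z.re := by
        have hz' : z = ((z.re : ℝ) : ℂ) := by apply Complex.ext <;> simp [him]
        rw [hz', ← Complex.coe_algebraMap, Polynomial.aeval_algebraMap_apply] at hz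
        simpa using hz
      have hl : z.re ∉ Icc (0 : ℝ) ‖A‖ := fun hmem => hq _ hmem hroot
      obtain ⟨q', rfl⟩ := Polynomial.dvd_iff_isRoot.2 hroot
      have hq'0 : q' ≠ 0 := right_ne_zero_of_mul hq0
      rw [Polynomial.natDegree_mul (Polynomial.X_sub_C_ne_zero _) hq'0,
        Polynomial.natDegree_X_sub_C] at hn
      have h1 := isUnit_linear hA hl
      have h2 := ih q'.natDegree (by omega) q' (fun x hx h0 => hq x hx (by simp [h0])) rfl
      rw [Polynomial.map_mul, map_mul]
      refine IsUnit.mul ?_ h2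
      simpa using h1
    · obtain ⟨q', rfl⟩ := q.quadratic_dvd_of_aeval_eq_zero_im_ne_zero hz him
      have hq'0 : q' ≠ 0 := right_ne_zero_of_mul hq0
      have hd0 := left_ne_zero_of_mul hq0
      have hdeg : (Polynomial.X ^ 2 - Polynomial.C (2 * z.re) * Polynomial.X
          + Polynomial.C (‖z‖ ^ 2)).natDegree = 2 := by
        compute_degree!
      rw [Polynomial.natDegree_mul hd0 hq'0, hdeg] at hn
      have h1 := isUnit_quadratic hA (a := z.re) (b := z.im ^ 2) (by positivity)
      have h2 := ih q'.natDegree (by omega) q' (fun x hx h0 => hq x hx (by simp [h0])) rfl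
      rw [Polynomial.map_mul, map_mul]
      refine IsUnit.mul ?_ h2
      have hfac : (Polynomial.X ^ 2 - Polynomial.C (2 * z.re) * Polynomial.X
          + Polynomial.C (‖z‖ ^ 2)) = (Polynomial.X - Polynomial.C z.re) *
            (Polynomial.X - Polynomial.C z.re) + Polynomial.C (z.im ^ 2) := by
        rw [Complex.sq_norm, Complex.normSq_apply]
        simp only [map_add, map_mul, map_pow]
        have : (Polynomial.C 2 : Polynomial ℝ) = 2 := rfl
        rw [this]
        ring
      rw [hfac]
      simpa using h1

theorem isSelfAdjoint_aeval {𝕜 E : Type*} [RCLike 𝕜] [NormedAddCommGroup E]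
    [InnerProductSpace 𝕜 E] [CompleteSpace E] {A : E →L[𝕜] E} (hA : IsSelfAdjoint A)
    (p : Polynomial ℝ) : IsSelfAdjoint (Polynomial.aeval A (p.map (algebraMap ℝ 𝕜))) := by
  induction p using Polynomial.induction_on' with
  | add p q hp hq => simpa using hp.add hq
  | monomial n a =>
    rw [Polynomial.map_monomial, Polynomial.aeval_monomial, ← Algebra.smul_def]
    refine IsSelfAdjoint.smul ?_ (hA.pow n)
    simp [isSelfAdjoint_iff]

/-- The norm bound of the polynomial functional calculus of a positive operator. -/
theorem norm_aeval_le {𝕜 E : Type*} [RCLike 𝕜] [NormedAddCommGroup E] [InnerProductSpace 𝕜 E]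
    [CompleteSpace E] {A : E →L[𝕜] E} (hA : A.IsPositive) (p : Polynomial ℝ) {ε : ℝ}
    (hp : ∀ x ∈ Icc (0 : ℝ) ‖A‖, |p.eval x| ≤ ε) :
    ‖Polynomial.aeval A (p.map (algebraMap ℝ 𝕜))‖ ≤ ε := by
  set T := Polynomial.aeval A (p.map (algebraMap ℝ 𝕜)) with hT
  have hε : 0 ≤ ε := (abs_nonneg _).trans (hp 0 ⟨le_rfl, norm_nonneg A⟩)
  by_contra! hlt
  have hadj : T.adjoint = T := isSelfAdjoint_aeval hA.isSelfAdjoint p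
  have hu : IsUnit (T * T - algebraMap 𝕜 (E →L[𝕜] E) ((‖T‖ ^ 2 : ℝ) : 𝕜)) := by
    have := isUnit_aeval hA (p * p - Polynomial.C (‖T‖ ^ 2)) (fun x hx => by
      have h1 := abs_le.1 (hp x hx)
      have : p.eval x ^ 2 < ‖T‖ ^ 2 := by
        rw [sq_lt_sq, abs_of_nonneg (norm_nonneg T)]
        exact (hp x hx).trans_lt hlt
      simp only [Polynomial.eval_sub, Polynomial.eval_mul, Polynomial.eval_C]
      nlinarith)
    simpa [hT] using this
  obtain ⟨u, hu⟩ := hu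
  set S : E →L[𝕜] E := ((u⁻¹ : (E →L[𝕜] E)ˣ) : E →L[𝕜] E) with hS
  have hSu : ∀ x, S (T (T x) - ((‖T‖ ^ 2 : ℝ) : 𝕜) • x) = x := fun x => by
    have h1 : S * (T * T - algebraMap 𝕜 (E →L[𝕜] E) ((‖T‖ ^ 2 : ℝ) : 𝕜)) = 1 := by
      rw [← hu, hS, Units.inv_mul]
    have h2 := congrArg (fun B : E →L[𝕜] E => B x) h1
    simpa [Algebra.algebraMap_eq_smul_one] using h2
  have key : ∀ x, ‖T (T x) - ((‖T‖ ^ 2 : ℝ) : 𝕜) • x‖ ^ 2 ≤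
      ‖T‖ ^ 2 * (‖T‖ ^ 2 * ‖x‖ ^ 2 - ‖T x‖ ^ 2) := fun x => by
    rw [@norm_sub_sq 𝕜, inner_smul_right, norm_smul]
    have h2 : ⟪T (T x), x⟫_𝕜 = ⟪T x, T x⟫_𝕜 := by
      conv_lhs => rw [← hadj, ContinuousLinearMap.adjoint_inner_left, hadj]
    rw [h2, RCLike.re_ofReal_mul, inner_self_eq_norm_sq]
    have h3 := T.le_opNorm (T x)
    have h4 : ‖T (T x)‖ ^ 2 ≤ ‖T‖ ^ 2 * ‖T x‖ ^ 2 := by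
      rw [← mul_pow]; exact pow_le_pow_left₀ (norm_nonneg _) h3 2
    have h5 : ‖((‖T‖ ^ 2 : ℝ) : 𝕜)‖ = ‖T‖ ^ 2 := by
      rw [RCLike.norm_ofReal, abs_of_nonneg (by positivity)]
    rw [h5]
    nlinarith
  have hTpos : 0 < ‖T‖ := hε.trans_lt hlt
  set m := ‖T‖ with hm
  set s := ‖S‖ with hs
  have hbd : ∀ x, ‖x‖ ^ 2 ≤ s ^ 2 * (m ^ 2 * (m ^ 2 * ‖x‖ ^ 2 - ‖T x‖ ^ 2)) := fun x => by
    have h1 : ‖x‖ ≤ s * ‖T (T x) - ((m ^ 2 : ℝ) : 𝕜) • x‖ := by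
      conv_lhs => rw [← hSu x]
      exact S.le_opNorm _
    have h2 : ‖x‖ ^ 2 ≤ s ^ 2 * ‖T (T x) - ((m ^ 2 : ℝ) : 𝕜) • x‖ ^ 2 := by
      rw [← mul_pow]; exact pow_le_pow_left₀ (norm_nonneg _) h1 2
    exact h2.trans (mul_le_mul_of_nonneg_left (key x) (sq_nonneg s))
  have hs0 : 0 < s := by
    rcases (norm_nonneg S).lt_or_eq with h | h
    · exact h
    · exfalso
      have hT0 : T = 0 := by
        ext x
        have h1 := hbd x
        rw [hs, ← h] at h1
        have h2 : ‖x‖ = 0 := by nlinarith [norm_nonneg x]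
        simp [norm_eq_zero.1 h2]
      rw [hm, hT0, norm_zero] at hTpos
      exact lt_irrefl _ hTpos
  have hle : m ≤ √(m ^ 2 - 1 / (s ^ 2 * m ^ 2)) := by
    refine T.opNorm_le_bound (Real.sqrt_nonneg _) fun x => ?_
    have h1 : ‖T x‖ ^ 2 ≤ (m ^ 2 - 1 / (s ^ 2 * m ^ 2)) * ‖x‖ ^ 2 := by
      have h2 := hbd x
      have h3 : ‖x‖ ^ 2 / (s ^ 2 * m ^ 2) ≤ m ^ 2 * ‖x‖ ^ 2 - ‖T x‖ ^ 2 := by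
        rw [div_le_iff₀ (by positivity)]
        linarith
      have h4 : (m ^ 2 - 1 / (s ^ 2 * m ^ 2)) * ‖x‖ ^ 2
          = m ^ 2 * ‖x‖ ^ 2 - ‖x‖ ^ 2 / (s ^ 2 * m ^ 2) := by ring
      linarith
    calc ‖T x‖ = √(‖T x‖ ^ 2) := (Real.sqrt_sq (norm_nonneg _)).symm
      _ ≤ √((m ^ 2 - 1 / (s ^ 2 * m ^ 2)) * ‖x‖ ^ 2) := Real.sqrt_le_sqrt h1
      _ = _ := by rw [Real.sqrt_mul' _ (sq_nonneg _), Real.sqrt_sq (norm_nonneg _)]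
  rw [Real.le_sqrt' hTpos] at hle
  have : 0 < 1 / (s ^ 2 * m ^ 2) := by positivity
  linarith

theorem IsRPow.unique {𝕜 E : Type*} [RCLike 𝕜] [NormedAddCommGroup E] [InnerProductSpace 𝕜 E]
    {A B B' : E →L[𝕜] E} {r : ℝ} (hr : 0 ≤ r) (hB : IsRPow A r B) (hB' : IsRPow A r B') :
    B = B' := by
  rw [← sub_eq_zero, ← norm_le_zero_iff]
  refine le_of_forall_pos_le_add fun ε hε => ?_
  obtain ⟨p, hp⟩ := exists_polynomial_near_of_continuousOn 0 ‖A‖ (fun x => x ^ r)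
    (Real.continuous_rpow_const hr).continuousOn (ε / 2) (half_pos hε)
  have h1 := hB p _ fun x hx => (hp x hx).le
  have h2 := hB' p _ fun x hx => (hp x hx).le
  rw [norm_sub_rev] at h1
  have h3 := norm_sub_le_norm_sub_add_norm_sub B
    (Polynomial.aeval A (p.map (algebraMap ℝ 𝕜))) B'
  linarith

theorem exists_isRPow {𝕜 E : Type*} [RCLike 𝕜] [NormedAddCommGroup E] [InnerProductSpace 𝕜 E]
    [CompleteSpace E] {A : E →L[𝕜] E} (hA : A.IsPositive) {r : ℝ} (hr : 0 ≤ r) :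
    ∃ B, IsRPow A r B := by
  have hex := fun n : ℕ => exists_polynomial_near_of_continuousOn 0 ‖A‖ (fun x => x ^ r)
    (Real.continuous_rpow_const hr).continuousOn (1 / ((n : ℝ) + 1)) Nat.one_div_pos_of_nat
  choose q hq using hex
  set F : ℕ → (E →L[𝕜] E) := fun n => Polynomial.aeval A ((q n).map (algebraMap ℝ 𝕜)) with hF
  have hcmp : ∀ (p : Polynomial ℝ) (ε : ℝ), (∀ x ∈ Icc (0 : ℝ) ‖A‖, |p.eval x - x ^ r| ≤ ε) →
      ∀ n, ‖Polynomial.aeval A (p.map (algebraMap ℝ 𝕜)) - F n‖ ≤ ε + 1 / ((n : ℝ) + 1) := by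
    intro p ε hp n
    rw [hF, ← map_sub, ← Polynomial.map_sub]
    refine norm_aeval_le hA _ fun x hx => ?_
    have h1 := abs_le.1 (hp x hx)
    have h2 := abs_lt.1 (hq n x hx)
    rw [Polynomial.eval_sub, abs_le]
    constructor <;> linarith [h1.1, h1.2, h2.1, h2.2]
  have hlim : Filter.Tendsto (fun n : ℕ => 1 / ((n : ℝ) + 1)) Filter.atTop (nhds 0) :=
    tendsto_one_div_add_atTop_nhds_zero_nat
  have hcau : CauchySeq F := by
    refine cauchySeq_of_le_tendsto_0 (fun n : ℕ => 2 * (1 / ((n : ℝ) + 1))) ?_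
      (by simpa using hlim.const_mul 2)
    intro n m N hn hm
    rw [dist_eq_norm]
    have h1 := hcmp (q n) _ (fun x hx => (hq n x hx).le) m
    have h2 := Nat.one_div_le_one_div (α := ℝ) hn
    have h3 := Nat.one_div_le_one_div (α := ℝ) hm
    exact h1.trans (by linarith)
  obtain ⟨B, hB⟩ := cauchySeq_tendsto_of_complete hcau
  refine ⟨B, fun p ε hp => ?_⟩
  have h1 : Filter.Tendsto (fun n => ‖Polynomial.aeval A (p.map (algebraMap ℝ 𝕜)) - F n‖)
      Filter.atTop (nhds ‖Polynomial.aeval A (p.map (algebraMap ℝ 𝕜)) - B‖) :=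
    (hB.const_sub _).norm
  have h2 : Filter.Tendsto (fun n : ℕ => ε + 1 / ((n : ℝ) + 1)) Filter.atTop (nhds ε) := by
    simpa using hlim.const_add ε
  exact le_of_tendsto_of_tendsto' h1 h2 (hcmp p ε hp)

/-- The power of a positive operator: `opRPow A r` is the unique operator with `IsRPow A r`. -/
theorem isRPow_iff {𝕜 E : Type*} [RCLike 𝕜] [NormedAddCommGroup E] [InnerProductSpace 𝕜 E]
    [CompleteSpace E] {A : E →L[𝕜] E} (hA : A.IsPositive) {r : ℝ} (hr : 0 ≤ r)
    (B : E →L[𝕜] E) : IsRPow A r B ↔ B = opRPow A r := by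
  have h := Classical.epsilon_spec (exists_isRPow hA hr)
  refine ⟨fun hB => hB.unique hr h, ?_⟩
  rintro rfl
  exact h

/-! ### Real interpolation -/

/-- The norm of `[H_K]^s = {A ^ (s/2) g : g ∈ (ker A)ᗮ}`, `‖A ^ (s/2) g‖ := ‖g‖`, where `A = L_K`;
it is `∞` at the vectors outside this space. -/
noncomputable def powNorm {𝕜 E : Type*} [RCLike 𝕜] [NormedAddCommGroup E] [InnerProductSpace 𝕜 E]
    (A : E →L[𝕜] E) (s : ℝ) (f : E) : ℝ≥0∞ :=
  ⨅ (g : E) (_ : g ∈ (LinearMap.ker (A : E →ₗ[𝕜] E))ᗮ) (_ : opRPow A (s / 2) g = f), ‖g‖ₑ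

/-- The `K`-functional `K(f, t, G₁, G₂) = inf {‖f₁‖_{G₁} + t ‖f₂‖_{G₂} : f = f₁ + f₂}` of two
spaces `G₁, G₂ ⊆ E`, each given by its norm, extended by `∞` outside the space. -/
noncomputable def kFunctional {E : Type*} [AddCommGroup E] (n₁ n₂ : E → ℝ≥0∞) (t : ℝ) (f : E) :
    ℝ≥0∞ :=
  ⨅ (f₁ : E) (f₂ : E) (_ : f = f₁ + f₂), n₁ f₁ + ENNReal.ofReal t * n₂ f₂

/-- The real interpolation norm `‖f‖_{β,2} = (∫₀^∞ (t^{-β} K(f,t,G₁,G₂))² t⁻¹ dt)^{1/2}`. -/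
noncomputable def interpNorm {E : Type*} [AddCommGroup E] (n₁ n₂ : E → ℝ≥0∞) (β : ℝ) (f : E) :
    ℝ≥0∞ :=
  (∫⁻ t in Ioi (0 : ℝ), (ENNReal.ofReal (t ^ (-β)) * kFunctional n₁ n₂ t f) ^ 2
      * ENNReal.ofReal t⁻¹) ^ (1 / 2 : ℝ)

/-! ### The kernel, its reproducing kernel Hilbert space and the integral operator

An operator-valued kernel is a positive semidefinite `K : Matrix X X (Y →L[𝕜] Y)`, and its
reproducing kernel Hilbert space `H_K` is `RKHS.OfKernel K`. -/

/-- Positive semidefiniteness of `K` spelled out. -/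
theorem posSemidef_iff {𝕜 X Y : Type*} [RCLike 𝕜] [NormedAddCommGroup Y] [InnerProductSpace 𝕜 Y]
    [CompleteSpace Y] (K : Matrix X X (Y →L[𝕜] Y)) :
    K.PosSemidef ↔ (∀ x x', K x x' = (K x' x).adjoint) ∧
      ∀ (n : ℕ) (x : Fin n → X) (y : Fin n → Y),
        0 ≤ RCLike.re (∑ i, ∑ j, ⟪K (x i) (x j) (y j), y i⟫_𝕜) := by
  constructor
  · intro h
    have : Fact K.PosSemidef := ⟨h⟩
    refine ⟨fun x x' => (h.isHermitian.apply x x').symm, fun n x y => ?_⟩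
    have key : ∀ i j, ⟪K (x i) (x j) (y j), y i⟫_𝕜 =
        ⟪RKHS.kerFun (RKHS.OfKernel K) (x j) (y j), RKHS.kerFun (RKHS.OfKernel K) (x i) (y i)⟫_𝕜 :=
      fun i j => by
        rw [← RKHS.kernel_inner, RKHS.OfKernel.kernel_ofKernel]
    simp_rw [key]
    rw [Finset.sum_comm]
    simp_rw [← inner_sum, ← sum_inner]
    exact inner_self_nonneg
  · rintro ⟨hH, hP⟩
    have hH' : K.IsHermitian := by
      ext1 x x'
      exact (hH x x').symm
    have hiff := (RKHS.posSemidef_tfae (K := K)).out 0 2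
    refine hiff.2 ⟨hH', fun v => ?_⟩
    let e := v.support.equivFin
    have h := hP v.support.card (fun i => (e.symm i : X)) (fun i => v (e.symm i))
    simp only [Finsupp.sum]
    rw [Finset.sum_comm]
    have h2 : ∀ F : X → 𝕜, ∑ i, F (e.symm i : X) = ∑ x ∈ v.support, F x := fun F => by
      rw [e.symm.sum_comp (fun x : v.support => F x), Finset.sum_coe_sort]
    convert h using 2
    rw [← h2]
    refine Finset.sum_congr rfl fun i _ => ?_
    rw [← h2]

/-- The operator-valued kernel `K` is Mercer (the elements of its reproducing kernel Hilbert space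
are continuous functions `X → Y`) and `sup_x ‖K(x,x)‖ ≤ κ²`. -/
structure IsBoundedMercer {𝕜 X Y : Type*} [RCLike 𝕜] [TopologicalSpace X]
    [NormedAddCommGroup Y] [InnerProductSpace 𝕜 Y] [CompleteSpace Y]
    (K : Matrix X X (Y →L[𝕜] Y)) [Fact K.PosSemidef] (κ : ℝ) : Prop where
  continuous : ∀ h : RKHS.OfKernel K, Continuous (h : X → Y)
  bound : ∀ x, ‖K x x‖ ≤ κ ^ 2

theorem IsBoundedMercer.norm_apply_le {𝕜 X Y : Type*} [RCLike 𝕜] [TopologicalSpace X]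
    [NormedAddCommGroup Y] [InnerProductSpace 𝕜 Y] [CompleteSpace Y]
    {K : Matrix X X (Y →L[𝕜] Y)} [Fact K.PosSemidef] {κ : ℝ} (hK : IsBoundedMercer K κ)
    (h : RKHS.OfKernel K) (x : X) : ‖h x‖ ≤ |κ| * ‖h‖ := by
  have h1 := RKHS.norm_apply_le h x
  rw [RKHS.OfKernel.kernel_ofKernel] at h1
  have h2 : √‖K x x‖ ≤ |κ| := by
    rw [← Real.sqrt_sq_eq_abs]
    exact Real.sqrt_le_sqrt (hK.bound x)
  calc ‖h x‖ ≤ ‖h‖ * √‖K x x‖ := h1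
    _ ≤ ‖h‖ * |κ| := by gcongr
    _ = _ := mul_comm _ _

theorem IsBoundedMercer.memLp {𝕜 X Y : Type*} [RCLike 𝕜]
    [TopologicalSpace X] [MeasurableSpace X] [BorelSpace X]
    [NormedAddCommGroup Y] [InnerProductSpace 𝕜 Y] [CompleteSpace Y] [SecondCountableTopology Y]
    {K : Matrix X X (Y →L[𝕜] Y)} [Fact K.PosSemidef] {κ : ℝ} (hK : IsBoundedMercer K κ)
    (μ : Measure X) [IsProbabilityMeasure μ] (h : RKHS.OfKernel K) : MemLp (h : X → Y) 2 μ :=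
  MemLp.of_bound (hK.continuous h).aestronglyMeasurable (|κ| * ‖h‖)
    (Filter.Eventually.of_forall (hK.norm_apply_le h))

/-- The canonical embedding `ι_K : H_K → L²(X, μ; Y)`. -/
noncomputable def embed {𝕜 X Y : Type*} [RCLike 𝕜]
    [TopologicalSpace X] [MeasurableSpace X] [BorelSpace X]
    [NormedAddCommGroup Y] [InnerProductSpace 𝕜 Y] [CompleteSpace Y] [SecondCountableTopology Y]
    {K : Matrix X X (Y →L[𝕜] Y)} [Fact K.PosSemidef] {κ : ℝ} (hK : IsBoundedMercer K κ)
    (μ : Measure X) [IsProbabilityMeasure μ] : RKHS.OfKernel K →L[𝕜] Lp Y 2 μ :=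
  LinearMap.mkContinuous
    { toFun := fun h => (hK.memLp μ h).toLp h
      map_add' := fun g h => by
        rw [← MemLp.toLp_add]
        exact MemLp.toLp_congr _ _ (by rw [RKHS.coe_add])
      map_smul' := fun c h => by
        rw [RingHom.id_apply, ← MemLp.toLp_const_smul]
        exact MemLp.toLp_congr _ _ (by rw [RKHS.coe_smul]) }
    |κ| (fun h => by
      have h1 : ∀ᵐ x ∂μ, ‖((hK.memLp μ h).toLp h : Lp Y 2 μ) x‖ ≤ |κ| * ‖h‖ := by
        filter_upwards [(hK.memLp μ h).coeFn_toLp] with x hx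
        rw [hx]
        exact hK.norm_apply_le h x
      have h2 := Lp.norm_le_of_ae_bound (by positivity) h1
      simpa [measureUnivNNReal] using h2)

theorem embed_ae_eq {𝕜 X Y : Type*} [RCLike 𝕜]
    [TopologicalSpace X] [MeasurableSpace X] [BorelSpace X]
    [NormedAddCommGroup Y] [InnerProductSpace 𝕜 Y] [CompleteSpace Y] [SecondCountableTopology Y]
    {K : Matrix X X (Y →L[𝕜] Y)} [Fact K.PosSemidef] {κ : ℝ} (hK : IsBoundedMercer K κ)
    (μ : Measure X) [IsProbabilityMeasure μ] (h : RKHS.OfKernel K) : embed hK μ h =ᵐ[μ] h :=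
  (hK.memLp μ h).coeFn_toLp

/-- The integral operator `L_K = ι_K ι_K^*` on `L²(X, μ; Y)` (see `integralOp_ae_eq`). -/
noncomputable def integralOp {𝕜 X Y : Type*} [RCLike 𝕜]
    [TopologicalSpace X] [MeasurableSpace X] [BorelSpace X]
    [NormedAddCommGroup Y] [InnerProductSpace 𝕜 Y] [CompleteSpace Y] [SecondCountableTopology Y]
    {K : Matrix X X (Y →L[𝕜] Y)} [Fact K.PosSemidef] {κ : ℝ} (hK : IsBoundedMercer K κ)
    (μ : Measure X) [IsProbabilityMeasure μ] : Lp Y 2 μ →L[𝕜] Lp Y 2 μ :=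
  embed hK μ ∘L (embed hK μ).adjoint

theorem isPositive_integralOp {𝕜 X Y : Type*} [RCLike 𝕜]
    [TopologicalSpace X] [MeasurableSpace X] [BorelSpace X]
    [NormedAddCommGroup Y] [InnerProductSpace 𝕜 Y] [CompleteSpace Y] [SecondCountableTopology Y]
    {K : Matrix X X (Y →L[𝕜] Y)} [Fact K.PosSemidef] {κ : ℝ} (hK : IsBoundedMercer K κ)
    (μ : Measure X) [IsProbabilityMeasure μ] : (integralOp hK μ).IsPositive :=
  ContinuousLinearMap.isPositive_self_comp_adjoint _

theorem measurable_of_inner {𝕜 X Y : Type*} [RCLike 𝕜] [MeasurableSpace X]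
    [NormedAddCommGroup Y] [InnerProductSpace 𝕜 Y] [SecondCountableTopology Y]
    [MeasurableSpace Y] [BorelSpace Y] {f : X → Y}
    (hf : ∀ w : Y, Measurable fun t => ⟪w, f t⟫_𝕜) : Measurable f := by
  have hball : ∀ (y : Y) (r : ℝ), 0 ≤ r → MeasurableSet (f ⁻¹' Metric.closedBall y r) := by
    intro y r hr
    have : f ⁻¹' Metric.closedBall y r =
        ⋂ n : ℕ, {t | ‖⟪TopologicalSpace.denseSeq Y n, f t⟫_𝕜 - ⟪TopologicalSpace.denseSeq Y n, y⟫_𝕜‖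
          ≤ r * ‖TopologicalSpace.denseSeq Y n‖} := by
      ext t
      simp only [mem_preimage, Metric.mem_closedBall, dist_eq_norm, mem_iInter, mem_ofPred_eq,
        ← inner_sub_right]
      constructor
      · intro h n
        calc _ ≤ ‖TopologicalSpace.denseSeq Y n‖ * ‖f t - y‖ := norm_inner_le_norm _ _
          _ ≤ ‖TopologicalSpace.denseSeq Y n‖ * r := by gcongr
          _ = _ := mul_comm _ _
      · intro h
        have hall : ∀ w : Y, ‖⟪w, f t - y⟫_𝕜‖ ≤ r * ‖w‖ := by
          have hc : IsClosed {w : Y | ‖⟪w, f t - y⟫_𝕜‖ ≤ r * ‖w‖} :=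
            isClosed_le (by fun_prop) (by fun_prop)
          intro w
          exact (TopologicalSpace.denseRange_denseSeq Y).induction_on
            (p := fun w => ‖⟪w, f t - y⟫_𝕜‖ ≤ r * ‖w‖) w hc h
        have h1 := hall (f t - y)
        rw [inner_self_eq_norm_sq_to_K] at h1
        rcases (norm_nonneg (f t - y)).eq_or_lt with h0 | h0
        · rw [← h0]; exact hr
        · simp at h1
          nlinarith
    rw [this]
    exact MeasurableSet.iInter fun n => measurableSet_le ((hf _).sub_const _).norm measurable_const
  refine measurable_of_isOpen fun U hU => ?_
  have hex : ∀ y : U, ∃ r > 0, Metric.closedBall (y : Y) r ⊆ U := fun y =>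
    Metric.nhds_basis_closedBall.mem_iff.1 (hU.mem_nhds y.2)
  choose r hr hsub using hex
  obtain ⟨T, hT, hTU⟩ := TopologicalSpace.isOpen_iUnion_countable
    (fun y : U => Metric.ball (y : Y) (r y)) (fun _ => Metric.isOpen_ball)
  have hU' : U = ⋃ y ∈ T, Metric.closedBall (y : Y) (r y) := by
    apply subset_antisymm
    · intro y hy
      have : y ∈ ⋃ y : U, Metric.ball (y : Y) (r y) :=
        mem_iUnion.2 ⟨⟨y, hy⟩, Metric.mem_ball_self (hr _)⟩
      rw [← hTU] at this
      exact iUnion₂_mono (fun i _ => Metric.ball_subset_closedBall) this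
    · exact iUnion₂_subset fun y _ => hsub y
  rw [hU', preimage_iUnion₂]
  exact MeasurableSet.biUnion hT fun y _ => hball _ _ (hr y).le

/-- `L_K` is the integral operator with kernel `K`. -/
theorem integralOp_ae_eq {𝕜 X Y : Type*} [RCLike 𝕜]
    [TopologicalSpace X] [MeasurableSpace X] [BorelSpace X]
    [NormedAddCommGroup Y] [InnerProductSpace 𝕜 Y] [NormedSpace ℝ Y] [CompleteSpace Y]
    [SecondCountableTopology Y]
    {K : Matrix X X (Y →L[𝕜] Y)} [Fact K.PosSemidef] {κ : ℝ} (hK : IsBoundedMercer K κ)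
    (μ : Measure X) [IsProbabilityMeasure μ] (h : Lp Y 2 μ) :
    integralOp hK μ h =ᵐ[μ] fun x => ∫ t, K x t (h t) ∂μ := by
  borelize Y
  have hker : ∀ x t (v w : Y), ⟪w, K x t v⟫_𝕜 = ⟪RKHS.kerFun (RKHS.OfKernel K) x w t, v⟫_𝕜 := by
    intro x t v w
    rw [RKHS.kerFun_apply, RKHS.OfKernel.kernel_ofKernel,
      ← (Fact.out : K.PosSemidef).isHermitian.apply x t]
    exact ContinuousLinearMap.adjoint_inner_right _ _ _
  have hmeas : ∀ x, AEStronglyMeasurable (fun t => K x t (h t)) μ := by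
    intro x
    obtain ⟨h', hh', hae⟩ := Lp.aestronglyMeasurable h
    refine ⟨fun t => K x t (h' t), ?_, hae.mono fun t ht => by simp only [ht]⟩
    refine (measurable_of_inner (𝕜 := 𝕜) fun w => ?_).stronglyMeasurable
    simp_rw [hker]
    exact ((hK.continuous _).stronglyMeasurable.inner hh').measurable
  have hKb : ∀ x t, ‖K x t‖ ≤ κ ^ 2 := by
    intro x t
    have h1 := RKHS.norm_kernel_sq_le (RKHS.OfKernel K) x t
    rw [RKHS.OfKernel.kernel_ofKernel] at h1
    have h2 := hK.bound x
    have h3 := hK.bound t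
    refine abs_le_of_sq_le_sq' ?_ (sq_nonneg κ) |>.2
    calc ‖K x t‖ ^ 2 ≤ ‖K x x‖ * ‖K t t‖ := h1
      _ ≤ κ ^ 2 * κ ^ 2 := mul_le_mul h2 h3 (norm_nonneg _) (sq_nonneg _)
      _ = _ := by ring
  have hint : ∀ x, Integrable (fun t => K x t (h t)) μ := by
    intro x
    refine Integrable.mono' (((Lp.memLp h).integrable one_le_two).norm.const_mul (κ ^ 2))
      (hmeas x) (Filter.Eventually.of_forall fun t => ?_)
    exact (K x t).le_of_opNorm_le (hKb x t) _
  filter_upwards [embed_ae_eq hK μ ((embed hK μ).adjoint h)] with x hx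
  have : integralOp hK μ h x = (embed hK μ).adjoint h x := hx
  rw [this]
  refine ext_inner_left 𝕜 fun w => ?_
  rw [← integral_inner (hint x), ← RKHS.kerFun_inner, ContinuousLinearMap.adjoint_inner_right,
    L2.inner_def]
  refine integral_congr_ae ?_
  filter_upwards [embed_ae_eq hK μ (RKHS.kerFun (RKHS.OfKernel K) x w)] with t ht
  rw [hker, ht]

/-! ### The learning problem -/

/-- The regression operator `h†(x) = ∫ y dρ(y|x)`. -/
noncomputable def regression (𝕜 : Type*) {X Y : Type*} [RCLike 𝕜] [MeasurableSpace X]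
    [NormedAddCommGroup Y] [InnerProductSpace 𝕜 Y] [CompleteSpace Y] [SecondCountableTopology Y]
    [MeasurableSpace Y] [BorelSpace Y] (ρ : Measure (X × Y)) [IsFiniteMeasure ρ] (x : X) : Y :=
  letI : NormedSpace ℝ Y := NormedSpace.restrictScalars ℝ 𝕜 Y
  ∫ y, y ∂(ρ.condKernel x)

/-- `sgd K η T z` is the iterate `h_{T+1}` of the stochastic approximation scheme `h₁ = 0`,
`h_{t+1} = h_t - η_t K(·, x_t)(h_t(x_t) - y_t)` run on the sample `z = ((x₁,y₁), …, (x_T,y_T))`.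
Here `RKHS.kerFun _ x y` is `K(·, x) y`. -/
noncomputable def sgd {𝕜 X Y : Type*} [RCLike 𝕜]
    [NormedAddCommGroup Y] [InnerProductSpace 𝕜 Y] [CompleteSpace Y]
    (K : Matrix X X (Y →L[𝕜] Y)) [Fact K.PosSemidef] (η : ℕ → ℝ) :
    (T : ℕ) → (Fin T → X × Y) → RKHS.OfKernel K
  | 0, _ => 0
  | T + 1, z =>
    let h := sgd K η T (Fin.init z)
    let x := (z (Fin.last T)).1
    let y := (z (Fin.last T)).2
    h - ((η (T + 1) : ℝ) : 𝕜) • RKHS.kerFun (RKHS.OfKernel K) x (h x - y)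

/-- The misspecification error `E ‖h_{T+1} - h†‖²_{β,2}`: the norm is that of the real
interpolation space `[L²(X, ρ_X; Y), [H_K]^1]_{β,2}`, and the expectation is over an i.i.d. sample of
size `T` from `ρ`. -/
noncomputable def misspecError {𝕜 X Y : Type*} [RCLike 𝕜]
    [TopologicalSpace X] [MeasurableSpace X] [BorelSpace X]
    [NormedAddCommGroup Y] [InnerProductSpace 𝕜 Y] [CompleteSpace Y] [SecondCountableTopology Y]
    [MeasurableSpace Y]
    {K : Matrix X X (Y →L[𝕜] Y)} [Fact K.PosSemidef] {κ : ℝ} (hK : IsBoundedMercer K κ)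
    (ρ : Measure (X × Y)) [IsProbabilityMeasure ρ] (hdag : Lp Y 2 ρ.fst) (β : ℝ) (η : ℕ → ℝ)
    (T : ℕ) : ℝ≥0∞ :=
  ∫⁻ z : Fin T → X × Y,
    (interpNorm (fun f : Lp Y 2 ρ.fst => ‖f‖ₑ) (powNorm (integralOp hK ρ.fst) 1) β
      (embed hK ρ.fst (sgd K η T z) - hdag)) ^ 2 ∂(Measure.pi fun _ => ρ)

/-! ### The constants in the step size conditions -/

/-- `δ` is admissible for `θ`: for all `T ≥ 2` and `a > 0`, the step sizes `η_t = a t^{-θ}` satisfy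
`∑_{t=1}^{T-1} η_t² / (1 + ∑_{j=t+1}^T η_j) ≤ δ a² / min{1, a/(1-θ)} · R(T)`, where
`R(T) = (T+1)^{-θ} log(T+1)` if `θ ≤ 1/2`, and `R(T) = (T+1)^{-(1-θ)}` if `θ > 1/2`. -/
def IsAdmissible (θ δ : ℝ) : Prop :=
  ∀ T : ℕ, 2 ≤ T → ∀ a : ℝ, 0 < a →
    ∑ t ∈ Finset.Icc 1 (T - 1), (a * (t : ℝ) ^ (-θ)) ^ 2 /
        (1 + ∑ j ∈ Finset.Icc (t + 1) T, a * (j : ℝ) ^ (-θ)) ≤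
      δ * (a ^ 2 / min 1 (a / (1 - θ))) *
        (if θ ≤ 1 / 2 then ((T : ℝ) + 1) ^ (-θ) * Real.log (T + 1)
          else ((T : ℝ) + 1) ^ (-(1 - θ)))

/-- The constant `δ`: the least admissible one, so that the bound `γ₁` below is the largest
possible. -/
noncomputable def deltaConst (θ : ℝ) : ℝ := sInf {δ : ℝ | IsAdmissible θ δ}

/-- The bound `γ₁` on the step size parameter in the case of decaying step sizes. -/
noncomputable def gammaDecay (κ θ : ℝ) : ℝ :=
  θ / (4 * κ ^ 2 * (1 + 2 * κ ^ 2) * (deltaConst θ + 1))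

/-- The bound `γ₁'` on the step size parameter in the case of constant step sizes. -/
noncomputable def gammaConst (κ θ : ℝ) : ℝ :=
  θ / (4 * κ ^ 2 * (1 + 2 * κ ^ 2) * (1 + 2 * θ))

end OVK

/-! Write `ι` for the embedding, `A = ι ι^*` for the integral operator and `h† = A^r g`. The polar
decomposition `ι = A^{1/2} U`, `U ι^* = A^{1/2}` (`exists_polar`) extracts a factor `A^{β/2}` from
the error: with `D = A^{(1-β)/2} U` and `q = A^{r-β/2} g` one has `ι h - h† = A^{β/2} (D h - q)`. On
the range of `A^{β/2}` the interpolation norm is controlled by the Hilbert norm of the preimage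
(`interpNorm_opRPow_sq_le`). This follows by inserting the Tikhonov splitting into the
`K`-functional and integrating against a spectral measure. It therefore suffices to bound `E ‖D
h_{T+1} - q‖²` in `L²`.

Conditionally on the past, the gradient has mean `ι^* (ι h - h†)`, and `D ι^* (ι h - h†) = A (D h -
q)`. Thus `u = D h - q` evolves on average by `u ↦ (1 - η_t A) u`, and unrolling the recursion
(`lintegral_sgd_le`) bounds the error by a bias `‖∏ (1 - η_j A) q‖²` plus a variance `∑ η_t²
‖∏_{j>t} (1 - η_j A) D‖²`, the latter weighted by the noise level and by a uniform bound `M` for the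
mean square `L²` error of the earlier iterates.

That bound `M` comes from the same inequality with `D = ι` and `q = h†`, by strong induction on time
(`lintegral_residual_sq_le`). The step size conditions involving `γ₁` and `γ₁'` are what makes the
variance at most `(M + σ²)/4`, so the induction closes.

Functional calculus turns the operator norms into suprema of `x^s exp(-x S)` over the spectrum, and
`exists_misspecError_le` reduces everything to two scalar sums: `(∑ η_j)^{-(2r-β)}` for the bias and
`∑ η_t² / (1 + ∑_{j>t} η_j)^{1-β}` for the variance. The variance sum is estimated by splitting at
`t = T/2` for decaying steps, and directly for constant ones. The regimes of the theorem record
which of the two powers of `T` dominates. -/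

namespace OVK

/-! ### Continuous functional calculus of a positive operator -/

section FunctionalCalculus

variable {𝕜 E : Type*} [RCLike 𝕜] [NormedAddCommGroup E] [InnerProductSpace 𝕜 E]

/-- The value `p(A)` of a real polynomial `p` at the operator `A`. -/
noncomputable def polyAt (A : E →L[𝕜] E) (p : Polynomial ℝ) : E →L[𝕜] E :=
  Polynomial.aeval A (p.map (algebraMap ℝ 𝕜))

theorem polyAt_add (A : E →L[𝕜] E) (p q : Polynomial ℝ) :
    polyAt A (p + q) = polyAt A p + polyAt A q := by simp [polyAt]

theorem polyAt_sub (A : E →L[𝕜] E) (p q : Polynomial ℝ) :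
    polyAt A (p - q) = polyAt A p - polyAt A q := by simp [polyAt]

theorem polyAt_mul (A : E →L[𝕜] E) (p q : Polynomial ℝ) :
    polyAt A (p * q) = polyAt A p * polyAt A q := by simp [polyAt]

theorem polyAt_one (A : E →L[𝕜] E) : polyAt A 1 = 1 := by simp [polyAt]

theorem polyAt_X (A : E →L[𝕜] E) : polyAt A Polynomial.X = A := by simp [polyAt]

theorem polyAt_C (A : E →L[𝕜] E) (c : ℝ) :
    polyAt A (Polynomial.C c) = (c : 𝕜) • (1 : E →L[𝕜] E) := by
  simp [polyAt, Algebra.algebraMap_eq_smul_one]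

/-- The operator `B` is `φ(A)` in the sense of the continuous functional calculus. -/
def IsFC (A : E →L[𝕜] E) (φ : ℝ → ℝ) (B : E →L[𝕜] E) : Prop :=
  ∀ (p : Polynomial ℝ) (ε : ℝ), (∀ x ∈ Icc (0 : ℝ) ‖A‖, |p.eval x - φ x| ≤ ε) →
    ‖polyAt A p - B‖ ≤ ε

/-- The operator `φ(A)`, for `A` positive and `φ` continuous on `[0, ‖A‖]`. -/
noncomputable def fc (A : E →L[𝕜] E) (φ : ℝ → ℝ) : E →L[𝕜] E := Classical.epsilon (IsFC A φ)

theorem opRPow_eq_fc (A : E →L[𝕜] E) (r : ℝ) : opRPow A r = fc A (fun x => x ^ r) := rfl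

theorem fc_congr {A : E →L[𝕜] E} {φ ψ : ℝ → ℝ} (h : EqOn φ ψ (Icc 0 ‖A‖)) : fc A φ = fc A ψ := by
  have : IsFC A φ = IsFC A ψ := by
    ext B
    refine forall₂_congr fun p ε => imp_congr_left ?_
    exact forall₂_congr fun x hx => by rw [h hx]
  rw [fc, fc, this]

theorem exists_polynomial_approx {φ : ℝ → ℝ} {b : ℝ} (hφ : ContinuousOn φ (Icc 0 b)) {ε : ℝ}
    (hε : 0 < ε) : ∃ p : Polynomial ℝ, ∀ x ∈ Icc (0 : ℝ) b, |p.eval x - φ x| ≤ ε := by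
  obtain ⟨p, hp⟩ := exists_polynomial_near_of_continuousOn 0 b φ hφ ε hε
  exact ⟨p, fun x hx => (hp x hx).le⟩

variable [CompleteSpace E]

/-- By `norm_aeval_le`, the distance of two polynomials in `A` is at most their sup distance on `[0,
‖A‖]`. Uniform approximants of `φ` therefore yield a Cauchy sequence, whose limit satisfies the
estimate for every polynomial at once. -/
theorem exists_isFC {A : E →L[𝕜] E} (hA : A.IsPositive) {φ : ℝ → ℝ}
    (hφ : ContinuousOn φ (Icc 0 ‖A‖)) : ∃ B, IsFC A φ B := by
  have hex := fun n : ℕ => exists_polynomial_approx hφ (ε := 1 / ((n : ℝ) + 1))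
    Nat.one_div_pos_of_nat
  choose q hq using hex
  have hcmp : ∀ (p : Polynomial ℝ) (ε : ℝ), (∀ x ∈ Icc (0 : ℝ) ‖A‖, |p.eval x - φ x| ≤ ε) →
      ∀ n, ‖polyAt A p - polyAt A (q n)‖ ≤ ε + 1 / ((n : ℝ) + 1) := by
    intro p ε hp n
    rw [← polyAt_sub]
    refine norm_aeval_le hA _ fun x hx => ?_
    have h1 := abs_le.1 (hp x hx)
    have h2 := abs_le.1 (hq n x hx)
    rw [Polynomial.eval_sub, abs_le]
    constructor <;> linarith [h1.1, h1.2, h2.1, h2.2]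
  have hlim : Filter.Tendsto (fun n : ℕ => 1 / ((n : ℝ) + 1)) Filter.atTop (nhds 0) :=
    tendsto_one_div_add_atTop_nhds_zero_nat
  have hcau : CauchySeq fun n => polyAt A (q n) := by
    refine cauchySeq_of_le_tendsto_0 (fun n : ℕ => 2 * (1 / ((n : ℝ) + 1))) ?_
      (by simpa using hlim.const_mul 2)
    intro n m N hn hm
    rw [dist_eq_norm]
    have h1 := hcmp (q n) _ (hq n) m
    have h2 := Nat.one_div_le_one_div (α := ℝ) hn
    have h3 := Nat.one_div_le_one_div (α := ℝ) hm
    exact h1.trans (by linarith)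
  obtain ⟨B, hB⟩ := cauchySeq_tendsto_of_complete hcau
  refine ⟨B, fun p ε hp => ?_⟩
  have h1 : Filter.Tendsto (fun n => ‖polyAt A p - polyAt A (q n)‖)
      Filter.atTop (nhds ‖polyAt A p - B‖) := (hB.const_sub _).norm
  have h2 : Filter.Tendsto (fun n : ℕ => ε + 1 / ((n : ℝ) + 1)) Filter.atTop (nhds ε) := by
    simpa using hlim.const_add ε
  exact le_of_tendsto_of_tendsto' h1 h2 (hcmp p ε hp)

theorem isFC_fc {A : E →L[𝕜] E} (hA : A.IsPositive) {φ : ℝ → ℝ}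
    (hφ : ContinuousOn φ (Icc 0 ‖A‖)) : IsFC A φ (fc A φ) :=
  Classical.epsilon_spec (exists_isFC hA hφ)

/-- This is how the algebraic rules are proved: one polynomial must be close to `φ` and, evaluated
at `A`, close to the candidate `B`. -/
theorem eq_fc_of_approx {A : E →L[𝕜] E} (hA : A.IsPositive) {φ : ℝ → ℝ}
    (hφ : ContinuousOn φ (Icc 0 ‖A‖)) {B : E →L[𝕜] E}
    (h : ∀ ε > 0, ∃ p : Polynomial ℝ, (∀ x ∈ Icc (0 : ℝ) ‖A‖, |p.eval x - φ x| ≤ ε) ∧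
      ‖polyAt A p - B‖ ≤ ε) : fc A φ = B := by
  rw [← sub_eq_zero, ← norm_le_zero_iff]
  refine le_of_forall_pos_le_add fun ε hε => ?_
  obtain ⟨p, hp, hB⟩ := h (ε / 2) (half_pos hε)
  have h1 := isFC_fc hA hφ p _ hp
  rw [norm_sub_rev] at h1
  have := norm_sub_le_norm_sub_add_norm_sub (fc A φ) (polyAt A p) B
  linarith

theorem fc_eval {A : E →L[𝕜] E} (hA : A.IsPositive) (p : Polynomial ℝ) :
    fc A (fun x => p.eval x) = polyAt A p :=
  eq_fc_of_approx hA p.continuous.continuousOn fun ε hε =>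
    ⟨p, fun x _ => by simpa using hε.le, by simpa using hε.le⟩

theorem norm_fc_le {A : E →L[𝕜] E} (hA : A.IsPositive) {φ : ℝ → ℝ}
    (hφ : ContinuousOn φ (Icc 0 ‖A‖)) {c : ℝ} (hc : ∀ x ∈ Icc (0 : ℝ) ‖A‖, |φ x| ≤ c) :
    ‖fc A φ‖ ≤ c := by
  refine le_of_forall_pos_le_add fun ε hε => ?_
  obtain ⟨p, hp⟩ := exists_polynomial_approx hφ (half_pos hε)
  have h1 := isFC_fc hA hφ p _ hp
  have h2 : ‖polyAt A p‖ ≤ c + ε / 2 := norm_aeval_le hA _ fun x hx => by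
    have := abs_sub_abs_le_abs_sub (p.eval x) (φ x)
    linarith [hp x hx, hc x hx]
  rw [norm_sub_rev] at h1
  have h3 := norm_le_norm_add_norm_sub' (fc A φ) (polyAt A p)
  linarith

theorem fc_add {A : E →L[𝕜] E} (hA : A.IsPositive) {φ ψ : ℝ → ℝ}
    (hφ : ContinuousOn φ (Icc 0 ‖A‖)) (hψ : ContinuousOn ψ (Icc 0 ‖A‖)) :
    fc A (fun x => φ x + ψ x) = fc A φ + fc A ψ := by
  refine eq_fc_of_approx hA (φ := fun x => φ x + ψ x) (hφ.add hψ) fun ε hε => ?_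
  obtain ⟨p, hp⟩ := exists_polynomial_approx hφ (half_pos hε)
  obtain ⟨q, hq⟩ := exists_polynomial_approx hψ (half_pos hε)
  refine ⟨p + q, fun x hx => ?_, ?_⟩
  · rw [Polynomial.eval_add, add_sub_add_comm]
    linarith [abs_add_le (p.eval x - φ x) (q.eval x - ψ x), hp x hx, hq x hx]
  · rw [polyAt_add, add_sub_add_comm]
    linarith [norm_add_le (polyAt A p - fc A φ) (polyAt A q - fc A ψ), isFC_fc hA hφ p _ hp,
      isFC_fc hA hψ q _ hq]

theorem fc_mul {A : E →L[𝕜] E} (hA : A.IsPositive) {φ ψ : ℝ → ℝ}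
    (hφ : ContinuousOn φ (Icc 0 ‖A‖)) (hψ : ContinuousOn ψ (Icc 0 ‖A‖)) :
    fc A (fun x => φ x * ψ x) = fc A φ * fc A ψ := by
  obtain ⟨m₁, hm₁⟩ := isCompact_Icc.exists_bound_of_continuousOn hφ
  obtain ⟨m₂, hm₂⟩ := isCompact_Icc.exists_bound_of_continuousOn hψ
  set M := max m₁ m₂ with hM
  have h1 : ∀ x ∈ Icc (0 : ℝ) ‖A‖, |φ x| ≤ M := fun x hx => (hm₁ x hx).trans (le_max_left _ _)
  have h2 : ∀ x ∈ Icc (0 : ℝ) ‖A‖, |ψ x| ≤ M := fun x hx => (hm₂ x hx).trans (le_max_right _ _)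
  have hM0 : 0 ≤ M := (abs_nonneg _).trans (h1 0 ⟨le_rfl, norm_nonneg A⟩)
  refine eq_fc_of_approx hA (φ := fun x => φ x * ψ x) (hφ.mul hψ) fun ε hε => ?_
  -- The accuracy `d` is chosen so that both errors in `p q - φ ψ = p (q - ψ) + (p - φ) ψ`, at most
  -- `(M + d) d` and `d M`, add up to at most `ε`. The same splitting serves for numbers and for
  -- operators.
  set d := min 1 (ε / (2 * M + 1)) with hd
  have hd0 : 0 < d := lt_min one_pos (by positivity)
  have hd1 : d ≤ 1 := min_le_left _ _
  have hd2 : (M + d) * d + d * M ≤ ε := by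
    have : d * (2 * M + 1) ≤ ε := (le_div_iff₀ (by positivity)).1 (min_le_right _ _)
    nlinarith
  obtain ⟨p, hp⟩ := exists_polynomial_approx hφ hd0
  obtain ⟨q, hq⟩ := exists_polynomial_approx hψ hd0
  refine ⟨p * q, fun x hx => ?_, ?_⟩
  · have e1 : p.eval x * q.eval x - φ x * ψ x
        = p.eval x * (q.eval x - ψ x) + (p.eval x - φ x) * ψ x := by ring
    have e2 : |p.eval x| ≤ M + d := by
      have := abs_sub_abs_le_abs_sub (p.eval x) (φ x)
      linarith [hp x hx, h1 x hx]
    rw [Polynomial.eval_mul, e1]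
    refine (abs_add_le _ _).trans (le_trans ?_ hd2)
    rw [abs_mul, abs_mul]
    gcongr
    exacts [hq x hx, hp x hx, h2 x hx]
  · have e1 : polyAt A p * polyAt A q - fc A φ * fc A ψ
        = polyAt A p * (polyAt A q - fc A ψ) + (polyAt A p - fc A φ) * fc A ψ := by
      rw [mul_sub, sub_mul]; abel
    have e3 := isFC_fc hA hφ p _ hp
    have e2 : ‖polyAt A p‖ ≤ M + d := norm_aeval_le hA _ fun x hx => by
      have := abs_sub_abs_le_abs_sub (p.eval x) (φ x)
      linarith [hp x hx, h1 x hx]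
    rw [polyAt_mul, e1]
    refine (norm_add_le _ _).trans (le_trans ?_ hd2)
    refine add_le_add ((norm_mul_le _ _).trans ?_) ((norm_mul_le _ _).trans ?_)
    · gcongr
      exact isFC_fc hA hψ q _ hq
    · gcongr
      exact norm_fc_le hA hψ h2

theorem adjoint_fc {A : E →L[𝕜] E} (hA : A.IsPositive) {φ : ℝ → ℝ}
    (hφ : ContinuousOn φ (Icc 0 ‖A‖)) : (fc A φ).adjoint = fc A φ := by
  refine (eq_fc_of_approx hA hφ fun ε hε => ?_).symm
  obtain ⟨p, hp⟩ := exists_polynomial_approx hφ hε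
  refine ⟨p, hp, ?_⟩
  have h1 : (polyAt A p).adjoint = polyAt A p := isSelfAdjoint_aeval hA.isSelfAdjoint p
  rw [← h1, ← map_sub, LinearIsometryEquiv.norm_map]
  exact isFC_fc hA hφ p _ hp

theorem fc_smul {A : E →L[𝕜] E} (hA : A.IsPositive) {φ : ℝ → ℝ}
    (hφ : ContinuousOn φ (Icc 0 ‖A‖)) (c : ℝ) :
    fc A (fun x => c * φ x) = (c : 𝕜) • fc A φ := by
  have h := fc_mul hA (φ := fun _ => c) continuousOn_const hφ
  have h2 := fc_eval hA (Polynomial.C c)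
  simp only [Polynomial.eval_C] at h2
  rw [h, h2, polyAt_C, smul_mul_assoc, one_mul]

/-- On the kernel of `A`, a polynomial in `A` acts as multiplication by its value at `0`;
approximation passes this on to `φ`. -/
theorem fc_apply_eq_zero {A : E →L[𝕜] E} (hA : A.IsPositive) {φ : ℝ → ℝ}
    (hφ : ContinuousOn φ (Icc 0 ‖A‖)) (h0 : φ 0 = 0) {k : E} (hk : A k = 0) : fc A φ k = 0 := by
  have h1 : ∀ p : Polynomial ℝ, polyAt A p k = ((p.eval 0 : ℝ) : 𝕜) • k := by
    intro p
    induction p using Polynomial.induction_on with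
    | C a => simp [polyAt_C]
    | add p q hp hq => simp [polyAt_add, hp, hq, add_smul]
    | monomial n a _ => simp [polyAt, pow_succ, hk]
  rw [← norm_le_zero_iff]
  refine le_of_forall_pos_le_add fun ε hε => ?_
  obtain ⟨p, hp⟩ := exists_polynomial_approx hφ (ε := ε / (2 * (‖k‖ + 1))) (by positivity)
  have h2 := isFC_fc hA hφ p _ hp
  have h3 := hp 0 ⟨le_rfl, norm_nonneg A⟩
  rw [h0, sub_zero] at h3
  have h4 : ‖polyAt A p k‖ ≤ ε / (2 * (‖k‖ + 1)) * ‖k‖ := by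
    rw [h1, norm_smul, RCLike.norm_ofReal]
    gcongr
  have h5 : ‖(polyAt A p - fc A φ) k‖ ≤ ε / (2 * (‖k‖ + 1)) * ‖k‖ :=
    ContinuousLinearMap.le_of_opNorm_le _ h2 _
  have h6 : ‖fc A φ k‖ ≤ ‖polyAt A p k‖ + ‖(polyAt A p - fc A φ) k‖ := by
    have := norm_sub_le (polyAt A p k) ((polyAt A p - fc A φ) k)
    simpa using this
  have h7 : ε / (2 * (‖k‖ + 1)) * ‖k‖ ≤ ε / 2 := by
    rw [div_mul_eq_mul_div, div_le_div_iff₀ (by positivity) two_pos]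
    nlinarith
  linarith

/-- `φ(A)` is self-adjoint and kills `ker A`. Needed because `powNorm` admits only representatives
`g` orthogonal to the kernel. -/
theorem fc_mem_orthogonal_ker {A : E →L[𝕜] E} (hA : A.IsPositive) {φ : ℝ → ℝ}
    (hφ : ContinuousOn φ (Icc 0 ‖A‖)) (h0 : φ 0 = 0) (w : E) :
    fc A φ w ∈ (LinearMap.ker (A : E →ₗ[𝕜] E))ᗮ := by
  rw [Submodule.mem_orthogonal]
  intro k hk
  rw [← adjoint_fc hA hφ, ContinuousLinearMap.adjoint_inner_right,
    fc_apply_eq_zero hA hφ h0 hk, inner_zero_left]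

theorem fc_comp_apply {A : E →L[𝕜] E} (hA : A.IsPositive) {φ ψ χ : ℝ → ℝ}
    (hφ : ContinuousOn φ (Icc 0 ‖A‖)) (hψ : ContinuousOn ψ (Icc 0 ‖A‖))
    (h : ∀ x ∈ Icc (0 : ℝ) ‖A‖, χ x = φ x * ψ x) (w : E) : fc A φ (fc A ψ w) = fc A χ w := by
  rw [fc_congr (ψ := fun x => φ x * ψ x) h, fc_mul hA hφ hψ]
  rfl

theorem inner_fc_sq {A : E →L[𝕜] E} (hA : A.IsPositive) {φ : ℝ → ℝ}
    (hφ : ContinuousOn φ (Icc 0 ‖A‖)) (w : E) :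
    RCLike.re ⟪fc A (fun x => φ x ^ 2) w, w⟫_𝕜 = ‖fc A φ w‖ ^ 2 := by
  rw [← fc_comp_apply hA hφ hφ (fun x _ => sq _), ← adjoint_fc hA hφ,
    ContinuousLinearMap.adjoint_inner_left, adjoint_fc hA hφ, inner_self_eq_norm_sq]

/-- The spectral measure of the positive operator `A` at the vector `w`. -/
theorem exists_spectralMeasure {A : E →L[𝕜] E} (hA : A.IsPositive) (w : E) :
    ∃ μ : Measure (Icc (0 : ℝ) ‖A‖), IsFiniteMeasure μ ∧ ∀ φ : ℝ → ℝ, ContinuousOn φ (Icc 0 ‖A‖) →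
      ‖fc A φ w‖ ^ 2 = ∫ x, φ x ^ 2 ∂μ := by
  have hext : ∀ f : CompactlySupportedContinuousMap (Icc (0 : ℝ) ‖A‖) ℝ,
      ContinuousOn (IccExtend (norm_nonneg A) f) (Icc 0 ‖A‖) :=
    fun f => (f.continuous.Icc_extend' ).continuousOn
  let Λ₀ : CompactlySupportedContinuousMap (Icc (0 : ℝ) ‖A‖) ℝ →ₗ[ℝ] ℝ :=
    { toFun := fun f => RCLike.re ⟪fc A (IccExtend (norm_nonneg A) f) w, w⟫_𝕜
      map_add' := fun f g => by
        have : fc A (IccExtend (norm_nonneg A) ⇑(f + g)) =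
            fc A (IccExtend (norm_nonneg A) f) + fc A (IccExtend (norm_nonneg A) g) := by
          rw [← fc_add hA (hext f) (hext g)]; rfl
        rw [this, add_apply, inner_add_left, map_add]
      map_smul' := fun c f => by
        have : fc A (IccExtend (norm_nonneg A) ⇑(c • f)) =
            (c : 𝕜) • fc A (IccExtend (norm_nonneg A) f) := by
          rw [← fc_smul hA (hext f)]; rfl
        rw [this, smul_apply, inner_smul_left]
        simp }
  -- The functional `f ↦ re ⟪f(A) w, w⟫` is positive because `f = (√f)²` turns its value into
  -- `‖√f(A) w‖²`. Riesz–Markov then supplies the measure.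
  let Λ := PositiveLinearMap.mk₀ Λ₀ fun f hf => by
    have hs : ContinuousOn (fun x => √(IccExtend (norm_nonneg A) f x)) (Icc 0 ‖A‖) :=
      Real.continuous_sqrt.comp_continuousOn (hext f)
    have : fc A (IccExtend (norm_nonneg A) f) =
        fc A (fun x => √(IccExtend (norm_nonneg A) f x) ^ 2) := by
      refine fc_congr fun x _ => ?_
      exact (Real.sq_sqrt (hf (projIcc 0 ‖A‖ (norm_nonneg A) x))).symm
    change 0 ≤ RCLike.re ⟪fc A (IccExtend (norm_nonneg A) f) w, w⟫_𝕜
    rw [this, inner_fc_sq hA hs]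
    positivity
  refine ⟨RealRMK.rieszMeasure Λ, inferInstance, fun φ hφ => ?_⟩
  let f : CompactlySupportedContinuousMap (Icc (0 : ℝ) ‖A‖) ℝ :=
    ⟨⟨fun x => φ x ^ 2, hφ.domRestrict.pow 2⟩, HasCompactSupport.of_compactSpace _⟩
  have h := RealRMK.integral_rieszMeasure Λ f
  have h2 : Λ f = RCLike.re ⟪fc A (IccExtend (norm_nonneg A) f) w, w⟫_𝕜 := rfl
  have h3 : fc A (IccExtend (norm_nonneg A) f) = fc A (fun x => φ x ^ 2) :=
    fc_congr fun x hx => by rw [IccExtend_of_mem _ _ hx]; rfl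
  rw [← inner_fc_sq hA hφ, ← h3, ← h2, ← h]
  rfl

end FunctionalCalculus

/-! ### Interpolation spaces and powers of the operator -/

theorem lintegral_Ioc_rpow {p c : ℝ} (hp : -1 < p) (hc : 0 ≤ c) :
    ∫⁻ t in Ioc 0 c, ENNReal.ofReal (t ^ p) = ENNReal.ofReal (c ^ (p + 1) / (p + 1)) := by
  have h := integral_rpow (a := 0) (b := c) (Or.inl hp)
  rw [Real.zero_rpow (by linarith), sub_zero] at h
  rw [← h, intervalIntegral.integral_of_le hc, ofReal_integral_eq_lintegral_ofReal]
  · exact (intervalIntegrable_iff_integrableOn_Ioc_of_le hc).1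
      (intervalIntegral.intervalIntegrable_rpow' hp)
  · filter_upwards [ae_restrict_mem measurableSet_Ioc] with t ht
    exact Real.rpow_nonneg ht.1.le _

theorem lintegral_Ioi_rpow {p c : ℝ} (hp : p < -1) (hc : 0 < c) :
    ∫⁻ t in Ioi c, ENNReal.ofReal (t ^ p) = ENNReal.ofReal (-c ^ (p + 1) / (p + 1)) := by
  rw [← integral_Ioi_rpow_of_lt hp hc, ofReal_integral_eq_lintegral_ofReal]
  · exact integrableOn_Ioi_rpow_of_lt hp hc
  · filter_upwards [ae_restrict_mem measurableSet_Ioi] with t ht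
    exact Real.rpow_nonneg (hc.trans ht).le _

/-- Split at `t = √x` and bound `x + t²` from below by `x` on the left and by `t²` on the right. All
powers of `x` cancel, which makes the bound uniform over the spectrum. -/
theorem lintegral_rpow_div_le {β x : ℝ} (hβ0 : 0 < β) (hβ1 : β < 1) (hx : 0 ≤ x) :
    ∫⁻ t in Ioi (0 : ℝ), ENNReal.ofReal (t ^ (1 - 2 * β) * (x ^ β / (x + t ^ 2))) ≤
      ENNReal.ofReal (1 / (2 - 2 * β) + 1 / (2 * β)) := by
  rcases hx.eq_or_lt with rfl | hx
  · simp [Real.zero_rpow hβ0.ne']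
  have hs : 0 < √x := Real.sqrt_pos.2 hx
  have hsx : √x = x ^ (1 / 2 : ℝ) := Real.sqrt_eq_rpow x
  rw [← Ioc_union_Ioi_eq_Ioi hs.le, ENNReal.ofReal_add (by
    have : 0 < 2 - 2 * β := by linarith
    positivity) (by positivity)]
  refine (lintegral_union_le _ _ _).trans (add_le_add ?_ ?_)
  · calc _ ≤ ∫⁻ t in Ioc 0 √x, ENNReal.ofReal (x ^ (β - 1)) * ENNReal.ofReal (t ^ (1 - 2 * β)) := by
          refine setLIntegral_mono' measurableSet_Ioc fun t ht => ?_
          rw [← ENNReal.ofReal_mul (by positivity), mul_comm (x ^ (β - 1))]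
          refine ENNReal.ofReal_le_ofReal (mul_le_mul_of_nonneg_left ?_
            (Real.rpow_nonneg ht.1.le _))
          rw [Real.rpow_sub_one hx.ne']
          gcongr
          nlinarith
      _ = ENNReal.ofReal (1 / (2 - 2 * β)) := by
          rw [lintegral_const_mul' _ _ ENNReal.ofReal_ne_top,
            lintegral_Ioc_rpow (by linarith) hs.le, ← ENNReal.ofReal_mul (by positivity), hsx,
            ← Real.rpow_mul hx.le, ← mul_div_assoc, ← Real.rpow_add hx]
          congr 1
          rw [show β - 1 + 1 / 2 * (1 - 2 * β + 1) = 0 by ring, Real.rpow_zero]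
          ring_nf
      _ ≤ _ := le_rfl
  · calc _ ≤ ∫⁻ t in Ioi √x, ENNReal.ofReal (x ^ β) * ENNReal.ofReal (t ^ (-1 - 2 * β)) := by
          refine setLIntegral_mono' measurableSet_Ioi fun t ht => ?_
          have ht0 : 0 < t := hs.trans ht
          rw [← ENNReal.ofReal_mul (by positivity)]
          refine ENNReal.ofReal_le_ofReal ?_
          have h1 : t ^ (1 - 2 * β) = t ^ (-1 - 2 * β) * t ^ 2 := by
            rw [← Real.rpow_natCast, ← Real.rpow_add ht0]
            congr 1
            push_cast
            ring
          rw [h1]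
          have h2 : x ^ β / (x + t ^ 2) ≤ x ^ β / t ^ 2 := by
            gcongr
            linarith
          calc _ ≤ t ^ (-1 - 2 * β) * t ^ 2 * (x ^ β / t ^ 2) := by gcongr
            _ = _ := by field_simp
      _ = ENNReal.ofReal (1 / (2 * β)) := by
          rw [lintegral_const_mul' _ _ ENNReal.ofReal_ne_top,
            lintegral_Ioi_rpow (by linarith) hs, ← ENNReal.ofReal_mul (by positivity), hsx,
            ← Real.rpow_mul hx.le, ← mul_div_assoc, mul_neg, ← Real.rpow_add hx]
          congr 1
          rw [show β + 1 / 2 * (-1 - 2 * β + 1) = 0 by ring, Real.rpow_zero,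
            show -1 - 2 * β + 1 = -(2 * β) by ring, neg_div_neg_eq]
      _ ≤ _ := le_rfl

section

variable {𝕜 E : Type*} [RCLike 𝕜] [NormedAddCommGroup E] [InnerProductSpace 𝕜 E]

theorem continuousOn_rpow_Icc {r b : ℝ} (hr : 0 ≤ r) :
    ContinuousOn (fun x : ℝ => x ^ r) (Icc 0 b) := (Real.continuous_rpow_const hr).continuousOn

theorem kFunctional_le (A : E →L[𝕜] E) {t : ℝ} {f f₁ g : E}
    (hg : g ∈ (LinearMap.ker (A : E →ₗ[𝕜] E))ᗮ) (hf : f = f₁ + opRPow A (1 / 2) g) :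
    kFunctional (fun f : E => ‖f‖ₑ) (powNorm A 1) t f ≤ ‖f₁‖ₑ + ENNReal.ofReal t * ‖g‖ₑ := by
  refine iInf_le_of_le f₁ (iInf_le_of_le _ (iInf_le_of_le hf ?_))
  gcongr
  exact iInf_le_of_le g (iInf_le_of_le hg (iInf_le_of_le rfl le_rfl))

variable [CompleteSpace E]

/-- For `f = A^{β/2} w`, the test decomposition takes `f₂ = A^{1/2} g` with the Tikhonov solution `g
= A^{1/2} (A + t²)⁻¹ f`, so `f₁ = t² (A + t²)⁻¹ f`. Here `φ₁(A) w = f₁` and `φ₂(A) w = g`. In the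
spectral measure, `‖f₁‖² + t² ‖g‖²` collapses to the integral of `t² x^β / (x + t²)`; the factor `2`
comes from `(a + b)² ≤ 2 (a² + b²)`. -/
theorem kFunctional_sq_le {A : E →L[𝕜] E} (hA : A.IsPositive) {β t : ℝ} (hβ0 : 0 < β) (ht : 0 < t)
    (w : E) (μ : Measure (Icc (0 : ℝ) ‖A‖)) [IsFiniteMeasure μ]
    (hμ : ∀ φ : ℝ → ℝ, ContinuousOn φ (Icc 0 ‖A‖) → ‖fc A φ w‖ ^ 2 = ∫ x, φ x ^ 2 ∂μ) :
    kFunctional (fun f : E => ‖f‖ₑ) (powNorm A 1) t (opRPow A (β / 2) w) ^ 2 ≤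
      2 * ∫⁻ x : Icc (0 : ℝ) ‖A‖, ENNReal.ofReal (t ^ 2 * ((x : ℝ) ^ β / (x + t ^ 2))) ∂μ := by
  have hpos : ∀ x ∈ Icc (0 : ℝ) ‖A‖, 0 < x + t ^ 2 := fun x hx => by
    have := hx.1
    positivity
  have hc0 : ContinuousOn (fun x : ℝ => x ^ (β / 2)) (Icc 0 ‖A‖) :=
    continuousOn_rpow_Icc (by positivity)
  have hch : ContinuousOn (fun x : ℝ => x ^ (1 / 2 : ℝ)) (Icc 0 ‖A‖) :=
    continuousOn_rpow_Icc (by positivity)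
  set φ₁ : ℝ → ℝ := fun x => t ^ 2 * x ^ (β / 2) / (x + t ^ 2) with hφ₁
  set φ₂ : ℝ → ℝ := fun x => x ^ (1 / 2 : ℝ) * x ^ (β / 2) / (x + t ^ 2) with hφ₂
  have hden : ContinuousOn (fun x : ℝ => x + t ^ 2) (Icc 0 ‖A‖) := by fun_prop
  have hc₁ : ContinuousOn φ₁ (Icc 0 ‖A‖) :=
    (continuousOn_const.mul hc0).div hden fun x hx => (hpos x hx).ne'
  have hc₂ : ContinuousOn φ₂ (Icc 0 ‖A‖) := (hch.mul hc0).div hden fun x hx => (hpos x hx).ne'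
  have hhalf : ∀ x : ℝ, 0 ≤ x → x ^ (1 / 2 : ℝ) * x ^ (1 / 2 : ℝ) = x := fun x hx => by
    rw [← Real.sqrt_eq_rpow, Real.mul_self_sqrt hx]
  have hdec : opRPow A (β / 2) w = fc A φ₁ w + opRPow A (1 / 2) (fc A φ₂ w) := by
    rw [opRPow_eq_fc, opRPow_eq_fc, fc_comp_apply hA hch hc₂ (fun x _ => rfl), ← add_apply,
      ← fc_add hA hc₁ (ψ := fun x => x ^ (1 / 2 : ℝ) * φ₂ x) (hch.mul hc₂)]
    congr 1
    refine fc_congr fun x hx => ?_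
    have := hpos x hx
    simp only [hφ₁, hφ₂]
    rw [← mul_div_assoc, ← mul_assoc, hhalf x hx.1]
    field_simp
    ring
  have hker : fc A φ₂ w ∈ (LinearMap.ker (A : E →ₗ[𝕜] E))ᗮ :=
    fc_mem_orthogonal_ker hA hc₂ (by simp [hφ₂]) w
  have h1 := kFunctional_le A (t := t) hker hdec
  have h2 : ‖fc A φ₁ w‖ₑ + ENNReal.ofReal t * ‖fc A φ₂ w‖ₑ =
      ENNReal.ofReal (‖fc A φ₁ w‖ + t * ‖fc A φ₂ w‖) := by
    rw [ENNReal.ofReal_add (norm_nonneg _) (by positivity), ENNReal.ofReal_mul ht.le,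
      ofReal_norm, ofReal_norm]
  have hint : ∀ φ : ℝ → ℝ, ContinuousOn φ (Icc 0 ‖A‖) →
      Integrable (fun x : Icc (0 : ℝ) ‖A‖ => φ x ^ 2) μ := fun φ hφ => by
    have : Continuous fun x : Icc (0 : ℝ) ‖A‖ => φ x ^ 2 := hφ.domRestrict.pow 2
    exact this.integrable_of_hasCompactSupport (HasCompactSupport.of_compactSpace _)
  have h3 : ‖fc A φ₁ w‖ ^ 2 + t ^ 2 * ‖fc A φ₂ w‖ ^ 2 =
      ∫ x : Icc (0 : ℝ) ‖A‖, t ^ 2 * ((x : ℝ) ^ β / (x + t ^ 2)) ∂μ := by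
    rw [hμ _ hc₁, hμ _ hc₂, ← integral_const_mul, ← integral_add (hint _ hc₁)
      ((hint _ hc₂).const_mul _)]
    refine integral_congr_ae (Filter.Eventually.of_forall fun x => ?_)
    have := hpos x x.2
    have hβ' : (x : ℝ) ^ β = ((x : ℝ) ^ (β / 2)) ^ 2 := by
      rw [← Real.rpow_natCast, ← Real.rpow_mul x.2.1]
      congr 1
      push_cast
      ring
    have h4 : ((x : ℝ) ^ (1 / 2 : ℝ)) ^ 2 = x := by rw [sq, hhalf x x.2.1]
    simp only [hφ₁, hφ₂, hβ']
    rw [div_pow, div_pow, mul_pow _ _ 2, mul_pow _ _ 2, h4]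
    field_simp
    ring
  have hnn : ∀ x : Icc (0 : ℝ) ‖A‖, 0 ≤ t ^ 2 * ((x : ℝ) ^ β / (x + t ^ 2)) := fun x => by
    have := hpos x x.2
    have := Real.rpow_nonneg x.2.1 β
    positivity
  calc _ ≤ ENNReal.ofReal (‖fc A φ₁ w‖ + t * ‖fc A φ₂ w‖) ^ 2 := by
        rw [← h2]
        gcongr
    _ = ENNReal.ofReal ((‖fc A φ₁ w‖ + t * ‖fc A φ₂ w‖) ^ 2) := by
        rw [ENNReal.ofReal_pow (by positivity)]
    _ ≤ ENNReal.ofReal (2 * (‖fc A φ₁ w‖ ^ 2 + t ^ 2 * ‖fc A φ₂ w‖ ^ 2)) := by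
        refine ENNReal.ofReal_le_ofReal ?_
        nlinarith [sq_nonneg (‖fc A φ₁ w‖ - t * ‖fc A φ₂ w‖)]
    _ = _ := by
        rw [h3, ENNReal.ofReal_mul zero_le_two, ofReal_integral_eq_lintegral_ofReal _
          (Filter.Eventually.of_forall hnn)]
        · simp
        · have : Continuous fun x : Icc (0 : ℝ) ‖A‖ => t ^ 2 * ((x : ℝ) ^ β / (x + t ^ 2)) :=
            continuous_const.mul (((continuousOn_rpow_Icc hβ0.le).div hden
              fun x hx => (hpos x hx).ne').domRestrict)
          exact this.integrable_of_hasCompactSupport (HasCompactSupport.of_compactSpace _)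

/-- The range of `A ^ (β/2)` embeds into the real interpolation space `[E, [H]^1]_{β,2}`. -/
theorem interpNorm_opRPow_sq_le {A : E →L[𝕜] E} (hA : A.IsPositive) {β : ℝ} (hβ0 : 0 < β)
    (hβ1 : β < 1) (w : E) :
    interpNorm (fun f : E => ‖f‖ₑ) (powNorm A 1) β (opRPow A (β / 2) w) ^ 2 ≤
      ENNReal.ofReal (1 / (1 - β) + 1 / β) * ‖w‖ₑ ^ 2 := by
  obtain ⟨μ, hfin, hμ⟩ := exists_spectralMeasure hA w
  have hmass : μ univ = ‖w‖ₑ ^ 2 := by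
    have h1 := hμ (fun _ => 1) continuousOn_const
    have h2 := fc_eval hA 1
    simp only [Polynomial.eval_one] at h2
    rw [h2, polyAt_one] at h1
    simp only [one_apply_eq_self, one_pow, integral_const, smul_eq_mul, mul_one] at h1
    rw [← ofReal_norm, ← ENNReal.ofReal_pow (norm_nonneg _), h1, ofReal_measureReal]
  rw [interpNorm, ← ENNReal.rpow_natCast, ← ENNReal.rpow_mul]
  norm_num only [Nat.cast_ofNat, ENNReal.rpow_one]
  -- Tonelli moves the `t`-integral inside, where it is bounded independently of `x`; what remains
  -- is the mass `‖w‖²` of the spectral measure.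
  calc _ ≤ ∫⁻ t in Ioi (0 : ℝ), ∫⁻ x : Icc (0 : ℝ) ‖A‖,
          2 * ENNReal.ofReal (t ^ (1 - 2 * β) * ((x : ℝ) ^ β / (x + t ^ 2))) ∂μ := by
        refine setLIntegral_mono' measurableSet_Ioi fun t ht => ?_
        have ht : 0 < t := ht
        rw [mul_pow, mul_right_comm]
        calc _ ≤ ENNReal.ofReal (t ^ (-β)) ^ 2 * ENNReal.ofReal t⁻¹ * (2 * ∫⁻ x : Icc (0 : ℝ) ‖A‖,
              ENNReal.ofReal (t ^ 2 * ((x : ℝ) ^ β / (x + t ^ 2))) ∂μ) := by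
              gcongr
              exact kFunctional_sq_le hA hβ0 ht w μ hμ
          _ = _ := by
              rw [← lintegral_const_mul' _ _ (by simp), ← lintegral_const_mul' _ _
                (ENNReal.mul_ne_top (by simp) (by simp))]
              refine lintegral_congr fun x => ?_
              rw [mul_left_comm, ← ENNReal.ofReal_pow (by positivity),
                ← ENNReal.ofReal_mul (by positivity), ← ENNReal.ofReal_mul (by positivity)]
              congr 2
              have : t ^ (1 - 2 * β) = (t ^ (-β)) ^ 2 * t⁻¹ * t ^ 2 := by
                rw [← Real.rpow_natCast (t ^ (-β)), ← Real.rpow_mul ht.le, mul_assoc,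
                  show t⁻¹ * t ^ 2 = t ^ (1 : ℝ) by rw [Real.rpow_one]; field_simp,
                  ← Real.rpow_add ht]
                congr 1
                push_cast
                ring
              rw [this]
              ring
    _ = ∫⁻ x : Icc (0 : ℝ) ‖A‖, (∫⁻ t in Ioi (0 : ℝ),
          2 * ENNReal.ofReal (t ^ (1 - 2 * β) * ((x : ℝ) ^ β / (x + t ^ 2)))) ∂μ := by
        refine lintegral_lintegral_swap (Measurable.aemeasurable ?_)
        simp only [Function.uncurry_def]
        fun_prop
    _ ≤ ∫⁻ x : Icc (0 : ℝ) ‖A‖, ENNReal.ofReal (1 / (1 - β) + 1 / β) ∂μ := by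
        refine lintegral_mono fun x => ?_
        rw [lintegral_const_mul' _ _ (by simp)]
        calc _ ≤ 2 * ENNReal.ofReal (1 / (2 - 2 * β) + 1 / (2 * β)) := by
              gcongr
              exact lintegral_rpow_div_le hβ0 hβ1 x.2.1
          _ = _ := by
              rw [show (2 : ℝ≥0∞) = ENNReal.ofReal 2 by simp, ← ENNReal.ofReal_mul zero_le_two]
              congr 1
              have : 1 - β ≠ 0 := by linarith
              rw [show 2 - 2 * β = 2 * (1 - β) by ring]
              field_simp
    _ = _ := by rw [lintegral_const, hmass]

/-! ### Polar decomposition -/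

theorem opRPow_half_apply_apply {A : E →L[𝕜] E} (hA : A.IsPositive) (x : E) :
    opRPow A (1 / 2) (opRPow A (1 / 2) x) = A x := by
  have hc : ContinuousOn (fun x : ℝ => x ^ (1 / 2 : ℝ)) (Icc 0 ‖A‖) :=
    continuousOn_rpow_Icc (by positivity)
  have h3 := fc_eval hA Polynomial.X
  rw [polyAt_X] at h3
  conv_rhs => rw [← h3]
  rw [opRPow_eq_fc]
  refine fc_comp_apply hA hc hc (fun x hx => ?_) x
  rw [Polynomial.eval_X, ← Real.sqrt_eq_rpow, Real.mul_self_sqrt hx.1]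

/-- Both squared norms equal `⟪ι ι^* x, x⟫`. Hence `A^{1/2} x ↦ ι^* x` is a well-defined isometry on
the range of `A^{1/2}`. -/
theorem norm_adjoint_apply_eq {F : Type*} [NormedAddCommGroup F] [InnerProductSpace 𝕜 F]
    [CompleteSpace F] (ι : F →L[𝕜] E) (x : E) :
    ‖ι.adjoint x‖ = ‖opRPow (ι ∘L ι.adjoint) (1 / 2) x‖ := by
  have hA : (ι ∘L ι.adjoint).IsPositive := ContinuousLinearMap.isPositive_self_comp_adjoint _
  set S := opRPow (ι ∘L ι.adjoint) (1 / 2) with hS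
  have hSadj : S.adjoint = S := adjoint_fc hA (continuousOn_rpow_Icc (by positivity))
  have h1 : ⟪S x, S x⟫_𝕜 = ⟪ι.adjoint x, ι.adjoint x⟫_𝕜 := by
    have h2 := ContinuousLinearMap.adjoint_inner_left S (S x) x
    rw [hSadj, hS, opRPow_half_apply_apply hA] at h2
    rw [ContinuousLinearMap.adjoint_inner_left]
    exact h2
  rw [@norm_eq_sqrt_re_inner 𝕜, @norm_eq_sqrt_re_inner 𝕜 _ _ _ _ (S x), h1]

/-- The polar decomposition `ι = (ι ι^*)^{1/2} U`. -/
theorem exists_polar {F : Type*} [NormedAddCommGroup F] [InnerProductSpace 𝕜 F]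
    [CompleteSpace F] (ι : F →L[𝕜] E) :
    ∃ U : F →L[𝕜] E, ‖U‖ ≤ 1 ∧ opRPow (ι ∘L ι.adjoint) (1 / 2) ∘L U = ι ∧
      U ∘L ι.adjoint = opRPow (ι ∘L ι.adjoint) (1 / 2) := by
  have hA : (ι ∘L ι.adjoint).IsPositive := ContinuousLinearMap.isPositive_self_comp_adjoint _
  set S := opRPow (ι ∘L ι.adjoint) (1 / 2) with hS
  have hSadj : S.adjoint = S := adjoint_fc hA (continuousOn_rpow_Icc (by positivity))
  -- The isometry `S x ↦ ι^* x` extends to `V` on the closure `R` of the range of `S`, and `U` is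
  -- the adjoint of `V` followed by the inclusion of `R`.
  set R : Submodule 𝕜 E := (LinearMap.range (S : E →ₗ[𝕜] E)).topologicalClosure with hR
  have hRc : IsClosed (R : Set E) := Submodule.isClosed_topologicalClosure _
  have : CompleteSpace R := hRc.completeSpace_coe
  have hmem : ∀ x, S x ∈ R := fun x =>
    Submodule.le_topologicalClosure _ (LinearMap.mem_range_self (S : E →ₗ[𝕜] E) x)
  let e : E →ₗ[𝕜] R := (S : E →ₗ[𝕜] E).codRestrict R hmem
  have hdense : DenseRange e := by
    intro y
    rw [closure_subtype]
    have h2 : ((↑) '' range e : Set E) = LinearMap.range (S : E →ₗ[𝕜] E) := by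
      ext z
      constructor
      · rintro ⟨_, ⟨x, rfl⟩, rfl⟩
        exact ⟨x, rfl⟩
      · rintro ⟨x, rfl⟩
        exact ⟨e x, ⟨x, rfl⟩, rfl⟩
    rw [h2]
    exact y.2
  have hbd : ∀ x, ‖(ι.adjoint : E →ₗ[𝕜] F) x‖ ≤ 1 * ‖e x‖ := fun x => by
    rw [one_mul]
    exact (norm_adjoint_apply_eq ι x).le
  set V : R →L[𝕜] F := (ι.adjoint : E →ₗ[𝕜] F).extendOfNorm e with hV
  have hVe : ∀ x, V (e x) = ι.adjoint x := fun x => LinearMap.extendOfNorm_eq hdense ⟨1, hbd⟩ x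
  have hVn : ‖V‖ ≤ 1 := LinearMap.opNorm_extendOfNorm_le hdense zero_le_one hbd
  have hadj : ∀ (x : E) (u : F), ⟪S x, (V.adjoint u : E)⟫_𝕜 = ⟪ι.adjoint x, u⟫_𝕜 := fun x u => by
    rw [← hVe]
    exact ContinuousLinearMap.adjoint_inner_right V (e x) u
  have h1 : S ∘L (R.subtypeL ∘L V.adjoint) = ι := by
    ext u
    refine ext_inner_left 𝕜 fun x => ?_
    have h2 := hadj x u
    rw [ContinuousLinearMap.adjoint_inner_left] at h2
    have h3 := ContinuousLinearMap.adjoint_inner_left S (V.adjoint u : E) x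
    rw [hSadj] at h3
    exact h3.symm.trans h2
  refine ⟨R.subtypeL ∘L V.adjoint, ?_, h1, ?_⟩
  · refine ContinuousLinearMap.opNorm_le_bound _ zero_le_one fun u => ?_
    have := V.adjoint.le_opNorm u
    rw [LinearIsometryEquiv.norm_map] at this
    exact this.trans (mul_le_mul_of_nonneg_right hVn (norm_nonneg _))
  · ext x
    have h3 : V.adjoint (ι.adjoint x) = e x := by
      refine ext_inner_left 𝕜 fun y => ?_
      refine hdense.induction_on (p := fun y : R =>
        ⟪y, V.adjoint (ι.adjoint x)⟫_𝕜 = ⟪y, e x⟫_𝕜) y ?_ fun b => ?_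
      · exact isClosed_eq (by fun_prop) (by fun_prop)
      · have h4 := hadj b (ι.adjoint x)
        have h5 : ⟪S b, S x⟫_𝕜 = ⟪ι.adjoint b, ι.adjoint x⟫_𝕜 := by
          have h6 : S (S x) = ι (ι.adjoint x) := by
            rw [hS, opRPow_half_apply_apply hA]
            rfl
          have h7 := ContinuousLinearMap.adjoint_inner_left S (S x) b
          rw [hSadj, h6] at h7
          rw [h7, ContinuousLinearMap.adjoint_inner_left]
        exact h4.trans h5.symm
    exact congrArg Subtype.val h3

end

/-! ### Sums of step sizes -/

/-- For `x ≥ 1`, `x` and `x + 1` agree up to a factor `2`. This converts powers of `T` into the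
powers of `T + 1` used in the statement. -/
theorem rpow_le_two_rpow_abs_mul {x : ℝ} (hx : 1 ≤ x) (e : ℝ) : x ^ e ≤ 2 ^ |e| * (x + 1) ^ e := by
  have hx0 : 0 < x := by linarith
  rcases le_total 0 e with h | h
  · calc x ^ e ≤ (x + 1) ^ e := Real.rpow_le_rpow hx0.le (by linarith) h
      _ ≤ _ := le_mul_of_one_le_left (by positivity)
        (Real.one_le_rpow one_le_two (abs_nonneg e))
  · calc x ^ e ≤ ((x + 1) / 2) ^ e := Real.rpow_le_rpow_of_nonpos (by positivity) (by linarith) h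
      _ = _ := by
        rw [abs_of_nonpos h, Real.div_rpow (by positivity) zero_le_two,
          Real.rpow_neg zero_le_two, div_eq_inv_mul]

theorem half_le_log_add_one {x : ℝ} (hx : 1 ≤ x) : 1 / 2 ≤ Real.log (x + 1) := by
  have h1 : Real.log 2 ≤ Real.log (x + 1) := Real.log_le_log two_pos (by linarith)
  linarith [Real.log_two_gt_d9]

/-- Bernoulli's inequality for the exponent `1 - p ∈ (0, 1]`, applied to `1 - 1/(T+1)`, bounds each
new term by the increment of `T^{1-p}/(1-p)`. -/
theorem sum_rpow_neg_le_of_lt_one {p : ℝ} (hp0 : 0 ≤ p) (hp1 : p < 1) (T : ℕ) :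
    ∑ k ∈ Finset.Icc 1 T, (k : ℝ) ^ (-p) ≤ (T : ℝ) ^ (1 - p) / (1 - p) := by
  have hq : 0 < 1 - p := by linarith
  induction T with
  | zero => simp [Real.zero_rpow hq.ne']
  | succ T ih =>
    rw [Finset.sum_Icc_succ_top (by omega)]
    have hT : (0 : ℝ) < (T : ℝ) + 1 := by positivity
    have h1 := rpow_one_add_le_one_add_mul_self (s := -1 / ((T : ℝ) + 1))
      (by rw [le_div_iff₀ hT]; linarith [(T.cast_nonneg : (0 : ℝ) ≤ T)]) hq.le (by linarith)
    have h2 : 1 + -1 / ((T : ℝ) + 1) = T / (T + 1) := by field_simp; ring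
    rw [h2, Real.div_rpow T.cast_nonneg hT.le, div_le_iff₀ (by positivity)] at h1
    have h3 : ((T : ℝ) + 1) ^ (1 - p) = ((T : ℝ) + 1) ^ (-p) * (T + 1) := by
      rw [← Real.rpow_add_one hT.ne']; ring_nf
    have h4 : (T : ℝ) ^ (1 - p) ≤ ((T : ℝ) + 1) ^ (1 - p) - (1 - p) * ((T : ℝ) + 1) ^ (-p) := by
      refine h1.trans (le_of_eq ?_)
      rw [h3]
      field_simp
      ring
    push_cast
    calc _ ≤ (T : ℝ) ^ (1 - p) / (1 - p) + ((T : ℝ) + 1) ^ (-p) := by gcongr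
      _ ≤ _ := by
        rw [← sub_nonneg]
        have : ((T : ℝ) + 1) ^ (1 - p) / (1 - p) - ((T : ℝ) ^ (1 - p) / (1 - p)
          + ((T : ℝ) + 1) ^ (-p)) = (((T : ℝ) + 1) ^ (1 - p) - (1 - p) * ((T : ℝ) + 1) ^ (-p)
            - (T : ℝ) ^ (1 - p)) / (1 - p) := by field_simp; ring
        rw [this]
        exact div_nonneg (by linarith) hq.le

theorem sum_rpow_neg_one_le (T : ℕ) :
    ∑ k ∈ Finset.Icc 1 T, (k : ℝ) ^ (-(1 : ℝ)) ≤ 1 + Real.log T := by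
  have h := harmonic_le_one_add_log T
  rw [harmonic_eq_sum_Icc] at h
  push_cast at h
  simpa [Real.rpow_neg_one] using h

theorem sum_rpow_neg_one_le_log {T : ℕ} (hT : 1 ≤ T) :
    ∑ k ∈ Finset.Icc 1 T, (k : ℝ) ^ (-(1 : ℝ)) ≤ 3 * Real.log ((T : ℝ) + 1) := by
  have hT' : (1 : ℝ) ≤ T := by exact_mod_cast hT
  have h1 : Real.log T ≤ Real.log ((T : ℝ) + 1) := Real.log_le_log (by linarith) (by linarith)
  linarith [sum_rpow_neg_one_le T, half_le_log_add_one hT']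

theorem exists_sum_rpow_neg_le {p : ℝ} (hp : 1 < p) :
    ∃ C : ℝ, 0 ≤ C ∧ ∀ T : ℕ, ∑ k ∈ Finset.Icc 1 T, (k : ℝ) ^ (-p) ≤ C := by
  have hs : Summable fun k : ℕ => (k : ℝ) ^ (-p) := Real.summable_nat_rpow.2 (by linarith)
  refine ⟨∑' k : ℕ, (k : ℝ) ^ (-p), tsum_nonneg fun k => by positivity, fun T => ?_⟩
  exact hs.sum_le_tsum _ fun k _ => by positivity

theorem mul_rpow_le_sum_rpow_neg {θ : ℝ} (hθ : 0 ≤ θ) {t T : ℕ} (ht : t ≤ T) :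
    ((T : ℝ) - t) * (T : ℝ) ^ (-θ) ≤ ∑ j ∈ Finset.Icc (t + 1) T, (j : ℝ) ^ (-θ) := by
  have h := Finset.card_nsmul_le_sum (Finset.Icc (t + 1) T) (fun j : ℕ => (j : ℝ) ^ (-θ))
    ((T : ℝ) ^ (-θ)) (fun j hj => by
      have hj' := Finset.mem_Icc.1 hj
      have h0 : (0 : ℝ) < j := by exact_mod_cast (by omega : 0 < j)
      exact Real.rpow_le_rpow_of_nonpos h0 (by exact_mod_cast hj'.2) (by linarith))
  rw [Nat.card_Icc, nsmul_eq_mul, show T + 1 - (t + 1) = T - t by omega, Nat.cast_sub ht] at h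
  exact h

theorem sum_Icc_reflect (f : ℝ → ℝ) (T : ℕ) :
    ∑ t ∈ Finset.Icc 1 (T - 1), f ((T : ℝ) - t) = ∑ k ∈ Finset.Icc 1 (T - 1), f k := by
  refine Finset.sum_nbij' (fun t => T - t) (fun t => T - t) ?_ ?_ ?_ ?_ ?_ <;>
    intro t ht <;> have h := Finset.mem_Icc.1 ht
  · exact Finset.mem_Icc.2 (by omega)
  · exact Finset.mem_Icc.2 (by omega)
  · omega
  · omega
  · rw [Nat.cast_sub (by omega)]

/-- The tail has `T - t` terms, each at least `T^{-θ}`, so it is at least `(T - t) T^{-θ}`. For `t ≤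
T/2` the factor `T - t` is at least `T/2` and the sum of `t^{-2θ}` is left; for `t ≥ T/2` the factor
`t^{-2θ}` is at most `(T/2)^{-2θ}` and reflecting `t ↦ T - t` leaves the sum of `k^{-s}`. The
summand `t = T`, whose tail is empty, is excluded. -/
theorem sum_div_tail_rpow_le {θ s : ℝ} (hθ : 0 < θ) (hs : 0 < s) (T : ℕ) :
    ∑ t ∈ Finset.Icc 1 (T - 1), (t : ℝ) ^ (-(2 * θ)) /
        (∑ j ∈ Finset.Icc (t + 1) T, (j : ℝ) ^ (-θ)) ^ s ≤
      2 ^ s * (T : ℝ) ^ (-(s * (1 - θ))) * ∑ k ∈ Finset.Icc 1 T, (k : ℝ) ^ (-(2 * θ)) +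
        2 ^ (2 * θ) * (T : ℝ) ^ (θ * s - 2 * θ) * ∑ k ∈ Finset.Icc 1 T, (k : ℝ) ^ (-s) := by
  rcases Nat.eq_zero_or_pos T with rfl | hT
  · simp
  have hT0 : (0 : ℝ) < T := by exact_mod_cast hT
  have hterm : ∀ t ∈ Finset.Icc 1 (T - 1), (t : ℝ) ^ (-(2 * θ)) /
        (∑ j ∈ Finset.Icc (t + 1) T, (j : ℝ) ^ (-θ)) ^ s ≤
      2 ^ s * (T : ℝ) ^ (-(s * (1 - θ))) * (t : ℝ) ^ (-(2 * θ)) +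
        2 ^ (2 * θ) * (T : ℝ) ^ (θ * s - 2 * θ) * ((T : ℝ) - t) ^ (-s) := by
    intro t ht
    have ht' := Finset.mem_Icc.1 ht
    have ht0 : (0 : ℝ) < t := by exact_mod_cast (by omega : 0 < t)
    have htT : (0 : ℝ) < (T : ℝ) - t := sub_pos.2 (by exact_mod_cast (by omega : t < T))
    have h1 := mul_rpow_le_sum_rpow_neg hθ.le (by omega : t ≤ T)
    have h2 : (t : ℝ) ^ (-(2 * θ)) / (∑ j ∈ Finset.Icc (t + 1) T, (j : ℝ) ^ (-θ)) ^ s ≤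
        (T : ℝ) ^ (θ * s) * ((t : ℝ) ^ (-(2 * θ)) * ((T : ℝ) - t) ^ (-s)) := by
      calc _ ≤ (t : ℝ) ^ (-(2 * θ)) / (((T : ℝ) - t) * (T : ℝ) ^ (-θ)) ^ s := by gcongr
        _ = _ := by
          rw [Real.mul_rpow htT.le (by positivity), ← Real.rpow_mul hT0.le, Real.rpow_neg htT.le,
            show -θ * s = -(θ * s) by ring, Real.rpow_neg hT0.le]
          field_simp
    refine h2.trans ?_
    have e1 : (2 : ℝ) ^ s * (T : ℝ) ^ (-(s * (1 - θ))) =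
        (T : ℝ) ^ (θ * s) * ((T : ℝ) / 2) ^ (-s) := by
      rw [Real.div_rpow hT0.le zero_le_two, Real.rpow_neg zero_le_two, div_inv_eq_mul,
        ← mul_assoc, ← Real.rpow_add hT0, mul_comm]
      ring_nf
    have e2 : (2 : ℝ) ^ (2 * θ) * (T : ℝ) ^ (θ * s - 2 * θ) =
        (T : ℝ) ^ (θ * s) * ((T : ℝ) / 2) ^ (-(2 * θ)) := by
      rw [Real.div_rpow hT0.le zero_le_two, Real.rpow_neg zero_le_two, div_inv_eq_mul,
        ← mul_assoc, ← Real.rpow_add hT0, mul_comm]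
      ring_nf
    rw [e1, e2, mul_assoc, mul_assoc, ← mul_add]
    refine mul_le_mul_of_nonneg_left ?_ (by positivity)
    rcases le_total ((T : ℝ) / 2) t with h | h
    · refine le_add_of_nonneg_of_le (by positivity) ?_
      gcongr ?_ * _
      exact Real.rpow_le_rpow_of_nonpos (by positivity) h (by linarith)
    · refine le_add_of_le_of_nonneg ?_ (by positivity)
      rw [mul_comm]
      gcongr ?_ * _
      exact Real.rpow_le_rpow_of_nonpos (by positivity) (by linarith) (by linarith)
  refine (Finset.sum_le_sum hterm).trans ?_
  rw [Finset.sum_add_distrib, ← Finset.mul_sum, ← Finset.mul_sum,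
    sum_Icc_reflect (fun x => x ^ (-s))]
  have hsub : Finset.Icc 1 (T - 1) ⊆ Finset.Icc 1 T := Finset.Icc_subset_Icc le_rfl (by omega)
  gcongr

theorem rpow_neg_mul_log_le {x e : ℝ} (hx : 0 < x) (he : 0 < e) :
    x ^ (-e) * Real.log x ≤ 1 / e := by
  calc _ ≤ x ^ (-e) * (x ^ e / e) := by gcongr; exact Real.log_le_rpow_div hx.le he
    _ = _ := by
      rw [← mul_div_assoc, ← Real.rpow_add hx, neg_add_cancel, Real.rpow_zero]

/-! ### Admissibility of the constant `δ` -/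

/-- The case `s = 1` of the split sum. The second half always contributes `T^{-θ}` times a
logarithm; the behaviour of `∑ k^{-2θ}` changes at `θ = 1/2`, which produces the two rates. -/
theorem exists_sum_div_tail_le {θ : ℝ} (hθ0 : 0 < θ) (hθ1 : θ < 1) :
    ∃ C : ℝ, 0 ≤ C ∧ ∀ T : ℕ, 1 ≤ T → ∑ t ∈ Finset.Icc 1 (T - 1), (t : ℝ) ^ (-(2 * θ)) /
        (∑ j ∈ Finset.Icc (t + 1) T, (j : ℝ) ^ (-θ)) ≤
      C * (if θ ≤ 1 / 2 then ((T : ℝ) + 1) ^ (-θ) * Real.log (T + 1)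
          else ((T : ℝ) + 1) ^ (-(1 - θ))) := by
  have key : ∀ T : ℕ, ∑ t ∈ Finset.Icc 1 (T - 1), (t : ℝ) ^ (-(2 * θ)) /
        (∑ j ∈ Finset.Icc (t + 1) T, (j : ℝ) ^ (-θ)) ≤
      2 * (T : ℝ) ^ (-(1 - θ)) * ∑ k ∈ Finset.Icc 1 T, (k : ℝ) ^ (-(2 * θ)) +
        4 * (T : ℝ) ^ (-θ) * ∑ k ∈ Finset.Icc 1 T, (k : ℝ) ^ (-(1 : ℝ)) := fun T => by
    have h := sum_div_tail_rpow_le hθ0 one_pos T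
    simp only [Real.rpow_one, one_mul, mul_one] at h
    rw [show θ - 2 * θ = -θ by ring] at h
    refine h.trans ?_
    have h4 : (2 : ℝ) ^ (2 * θ) ≤ 4 := by
      calc (2 : ℝ) ^ (2 * θ) ≤ 2 ^ (2 : ℝ) :=
            Real.rpow_le_rpow_of_exponent_le one_le_two (by linarith)
        _ = 4 := by norm_num
    have : 0 ≤ ∑ k ∈ Finset.Icc 1 T, (k : ℝ) ^ (-(1 : ℝ)) :=
      Finset.sum_nonneg fun k _ => by positivity
    gcongr
  rcases lt_trichotomy θ (1 / 2) with h | h | h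
  · have hq : 0 < 1 - 2 * θ := by linarith
    refine ⟨2 ^ |-θ| * (4 / (1 - 2 * θ) + 12), by positivity, fun T hT => ?_⟩
    have hT' : (1 : ℝ) ≤ T := by exact_mod_cast hT
    rw [if_pos h.le]
    have hl := half_le_log_add_one hT'
    calc _ ≤ 2 * (T : ℝ) ^ (-(1 - θ)) * ((T : ℝ) ^ (1 - 2 * θ) / (1 - 2 * θ)) +
          4 * (T : ℝ) ^ (-θ) * (3 * Real.log ((T : ℝ) + 1)) := by
          refine (key T).trans ?_
          gcongr
          · exact sum_rpow_neg_le_of_lt_one (by linarith) (by linarith) T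
          · exact sum_rpow_neg_one_le_log hT
      _ = (T : ℝ) ^ (-θ) * (2 / (1 - 2 * θ) + 12 * Real.log ((T : ℝ) + 1)) := by
          have : (T : ℝ) ^ (-(1 - θ)) * (T : ℝ) ^ (1 - 2 * θ) = (T : ℝ) ^ (-θ) := by
            rw [← Real.rpow_add (by linarith)]; ring_nf
          rw [← this]
          ring
      _ ≤ (2 ^ |-θ| * ((T : ℝ) + 1) ^ (-θ)) *
          (4 / (1 - 2 * θ) * Real.log ((T : ℝ) + 1) + 12 * Real.log ((T : ℝ) + 1)) := by
          gcongr
          · exact rpow_le_two_rpow_abs_mul hT' _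
          · rw [div_mul_eq_mul_div]
            gcongr
            linarith
      _ = _ := by ring
  · refine ⟨2 ^ |-θ| * 18, by positivity, fun T hT => ?_⟩
    have hT' : (1 : ℝ) ≤ T := by exact_mod_cast hT
    have hl := half_le_log_add_one hT'
    rw [if_pos h.le]
    have h1 : 1 - θ = θ := by linarith
    have h2 : 2 * θ = 1 := by linarith
    have hk := key T
    rw [h1, h2] at hk
    rw [h2]
    calc _ ≤ 2 * (T : ℝ) ^ (-θ) * (3 * Real.log ((T : ℝ) + 1)) +
          4 * (T : ℝ) ^ (-θ) * (3 * Real.log ((T : ℝ) + 1)) := by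
          refine hk.trans ?_
          gcongr <;> exact sum_rpow_neg_one_le_log hT
      _ = (T : ℝ) ^ (-θ) * (18 * Real.log ((T : ℝ) + 1)) := by ring
      _ ≤ (2 ^ |-θ| * ((T : ℝ) + 1) ^ (-θ)) * (18 * Real.log ((T : ℝ) + 1)) := by
          gcongr
          exact rpow_le_two_rpow_abs_mul hT' _
      _ = _ := by ring
  · obtain ⟨C, hC0, hC⟩ := exists_sum_rpow_neg_le (p := 2 * θ) (by linarith)
    have hq : 0 < 2 * θ - 1 := by linarith
    refine ⟨2 ^ |-(1 - θ)| * (2 * C + 4 * (1 + 1 / (2 * θ - 1))), by positivity, fun T hT => ?_⟩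
    have hT' : (1 : ℝ) ≤ T := by exact_mod_cast hT
    rw [if_neg (not_le.2 h)]
    -- For `θ > 1/2` the logarithm is absorbed by the spare power `T^{-(2θ-1)}`.
    have h1 : (T : ℝ) ^ (-θ) * (1 + Real.log T) ≤ (T : ℝ) ^ (-(1 - θ)) * (1 + 1 / (2 * θ - 1)) := by
      have e1 : (T : ℝ) ^ (-θ) = (T : ℝ) ^ (-(1 - θ)) * (T : ℝ) ^ (-(2 * θ - 1)) := by
        rw [← Real.rpow_add (by linarith)]; ring_nf
      rw [e1, mul_assoc]
      gcongr
      rw [mul_add, mul_one]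
      gcongr
      · exact Real.rpow_le_one_of_one_le_of_nonpos hT' (by linarith)
      · exact rpow_neg_mul_log_le (by linarith) hq
    calc _ ≤ 2 * (T : ℝ) ^ (-(1 - θ)) * C + 4 * ((T : ℝ) ^ (-θ) * (1 + Real.log T)) := by
          refine (key T).trans ?_
          rw [← mul_assoc 4]
          gcongr
          · exact hC T
          · exact sum_rpow_neg_one_le T
      _ ≤ 2 * (T : ℝ) ^ (-(1 - θ)) * C +
          4 * ((T : ℝ) ^ (-(1 - θ)) * (1 + 1 / (2 * θ - 1))) := by gcongr
      _ = (T : ℝ) ^ (-(1 - θ)) * (2 * C + 4 * (1 + 1 / (2 * θ - 1))) := by ring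
      _ ≤ (2 ^ |-(1 - θ)| * ((T : ℝ) + 1) ^ (-(1 - θ))) * (2 * C + 4 * (1 + 1 / (2 * θ - 1))) := by
          gcongr
          exact rpow_le_two_rpow_abs_mul hT' _
      _ = _ := by ring

theorem rate_pos {θ : ℝ} {T : ℕ} (hT : 1 ≤ T) :
    0 < (if θ ≤ 1 / 2 then ((T : ℝ) + 1) ^ (-θ) * Real.log (T + 1)
          else ((T : ℝ) + 1) ^ (-(1 - θ))) := by
  have := half_le_log_add_one (x := T) (by exact_mod_cast hT)
  split_ifs <;> positivity

/-- Dropping the `1` from the denominators leaves one factor `a`, and `a (1 - θ) ≤ a² / min{1,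
a/(1-θ)}`. Without such a `δ` the infimum `deltaConst` would carry no information. -/
theorem exists_isAdmissible {θ : ℝ} (hθ0 : 0 < θ) (hθ1 : θ < 1) : ∃ δ, IsAdmissible θ δ := by
  obtain ⟨C, hC0, hC⟩ := exists_sum_div_tail_le hθ0 hθ1
  have hq : 0 < 1 - θ := by linarith
  refine ⟨C / (1 - θ), fun T hT a ha => ?_⟩
  have hR := rate_pos (θ := θ) (T := T) (by omega)
  have h1 : ∀ t ∈ Finset.Icc 1 (T - 1), (a * (t : ℝ) ^ (-θ)) ^ 2 /
        (1 + ∑ j ∈ Finset.Icc (t + 1) T, a * (j : ℝ) ^ (-θ)) ≤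
      a * ((t : ℝ) ^ (-(2 * θ)) / (∑ j ∈ Finset.Icc (t + 1) T, (j : ℝ) ^ (-θ))) := by
    intro t ht
    have ht' := Finset.mem_Icc.1 ht
    have ht0 : (0 : ℝ) < t := by exact_mod_cast (by omega : 0 < t)
    have hS : 0 < ∑ j ∈ Finset.Icc (t + 1) T, (j : ℝ) ^ (-θ) := by
      refine Finset.sum_pos (fun j hj => ?_) ⟨T, Finset.mem_Icc.2 (by omega)⟩
      have : (0 : ℝ) < j := by exact_mod_cast (by have := Finset.mem_Icc.1 hj; omega : 0 < j)
      positivity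
    rw [← Finset.mul_sum]
    calc _ ≤ (a * (t : ℝ) ^ (-θ)) ^ 2 / (a * ∑ j ∈ Finset.Icc (t + 1) T, (j : ℝ) ^ (-θ)) := by
          gcongr
          linarith
      _ = _ := by
          have : (t : ℝ) ^ (-(2 * θ)) = ((t : ℝ) ^ (-θ)) ^ 2 := by
            rw [← Real.rpow_natCast, ← Real.rpow_mul ht0.le]; push_cast; ring_nf
          rw [this]
          field_simp
  refine (Finset.sum_le_sum h1).trans ?_
  rw [← Finset.mul_sum]
  have h2 : a * (1 - θ) ≤ a ^ 2 / min 1 (a / (1 - θ)) := by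
    have hmin : 0 < min 1 (a / (1 - θ)) := lt_min one_pos (by positivity)
    rw [le_div_iff₀ hmin]
    calc _ ≤ a * (1 - θ) * (a / (1 - θ)) := by gcongr; exact min_le_right _ _
      _ = _ := by field_simp
  have hCq : 0 ≤ C / (1 - θ) := by positivity
  calc _ ≤ a * (C * (if θ ≤ 1 / 2 then ((T : ℝ) + 1) ^ (-θ) * Real.log (T + 1)
          else ((T : ℝ) + 1) ^ (-(1 - θ)))) := by
        gcongr
        exact hC T (by omega)
    _ = C / (1 - θ) * (a * (1 - θ)) * (if θ ≤ 1 / 2 then ((T : ℝ) + 1) ^ (-θ) * Real.log (T + 1)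
          else ((T : ℝ) + 1) ^ (-(1 - θ))) := by field_simp
    _ ≤ _ := by gcongr

theorem IsAdmissible.nonneg {θ δ : ℝ} (hθ1 : θ < 1) (h : IsAdmissible θ δ) : 0 ≤ δ := by
  have h1 := h 2 le_rfl 1 one_pos
  have hq : 0 < 1 - θ := by linarith
  have h2 : 0 < (1 : ℝ) ^ 2 / min 1 (1 / (1 - θ)) *
      (if θ ≤ 1 / 2 then (((2 : ℕ) : ℝ) + 1) ^ (-θ) * Real.log ((2 : ℕ) + 1)
          else (((2 : ℕ) : ℝ) + 1) ^ (-(1 - θ))) := by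
    have hmin : 0 < min 1 (1 / (1 - θ)) := lt_min one_pos (by positivity)
    exact mul_pos (by positivity) (rate_pos (by norm_num))
  have h3 := le_trans (Finset.sum_nonneg fun t _ => div_nonneg (sq_nonneg _)
    (add_nonneg zero_le_one (Finset.sum_nonneg fun j _ => by positivity))) h1
  rw [mul_assoc] at h3
  exact nonneg_of_mul_nonneg_left h3 h2

theorem deltaConst_nonneg {θ : ℝ} (hθ1 : θ < 1) : 0 ≤ deltaConst θ :=
  Real.sInf_nonneg fun _ hδ => IsAdmissible.nonneg hθ1 hδ

/-- Each constraint is a lower bound on `δ`, since `δ` is multiplied by a positive number; the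
infimum of a nonempty set of admissible constants inherits all of them. -/
theorem isAdmissible_deltaConst {θ : ℝ} (hθ0 : 0 < θ) (hθ1 : θ < 1) :
    IsAdmissible θ (deltaConst θ) := by
  intro T hT a ha
  have hq : 0 < 1 - θ := by linarith
  have hmin : 0 < min 1 (a / (1 - θ)) := lt_min one_pos (by positivity)
  have hR := rate_pos (θ := θ) (T := T) (by omega)
  have hc := mul_pos (div_pos (pow_pos ha 2) hmin) hR
  rw [mul_assoc, ← div_le_iff₀ hc]
  refine le_csInf (exists_isAdmissible hθ0 hθ1) fun δ hδ => ?_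
  rw [div_le_iff₀ hc, ← mul_assoc]
  exact hδ T hT a ha

/-! ### Stability of the step sizes -/

theorem sum_Icc_eq_sum_add_last {T : ℕ} (hT : 1 ≤ T) (f : ℕ → ℝ) :
    ∑ t ∈ Finset.Icc 1 T, f t = ∑ t ∈ Finset.Icc 1 (T - 1), f t + f T := by
  obtain ⟨T, rfl⟩ : ∃ n, T = n + 1 := ⟨T - 1, by omega⟩
  rw [Finset.sum_Icc_succ_top (by omega), Nat.add_sub_cancel]

/-- The terms before the last are at most `δ a / θ`: `a < 1 - θ` resolves the minimum in the
definition of `δ`, and the rate is at most `1/θ`. The last term has an empty tail and is at most `a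
/ θ`, whence the `δ + 1` in `gammaDecay`. -/
theorem sum_decay_le_of_lt_gammaDecay {κ θ a : ℝ} (hκ : 0 < κ) (hθ0 : 0 < θ) (hθ1 : θ < 1)
    (ha0 : 0 < a) (ha1 : a < 1 - θ) (ha : a < gammaDecay κ θ) (T : ℕ) :
    ∑ t ∈ Finset.Icc 1 T, (a * (t : ℝ) ^ (-θ)) ^ 2 /
        (1 + ∑ j ∈ Finset.Icc (t + 1) T, a * (j : ℝ) ^ (-θ)) ≤
      1 / (4 * κ ^ 2 * (1 + 2 * κ ^ 2)) := by
  rcases Nat.eq_zero_or_pos T with rfl | hT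
  · simp; positivity
  have hT' : (1 : ℝ) ≤ T := by exact_mod_cast hT
  have hδ := deltaConst_nonneg hθ1
  set δ := deltaConst θ with hδdef
  have hbound : a * (δ + 1) / θ ≤ 1 / (4 * κ ^ 2 * (1 + 2 * κ ^ 2)) := by
    rw [gammaDecay, lt_div_iff₀ (by positivity)] at ha
    rw [div_le_div_iff₀ hθ0 (by positivity)]
    nlinarith
  refine le_trans ?_ hbound
  rw [sum_Icc_eq_sum_add_last hT]
  have hlast : (a * (T : ℝ) ^ (-θ)) ^ 2 /
      (1 + ∑ j ∈ Finset.Icc (T + 1) T, a * (j : ℝ) ^ (-θ)) ≤ a / θ := by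
    rw [Finset.Icc_eq_empty (by omega), Finset.sum_empty, add_zero, div_one]
    have h1 : a * (T : ℝ) ^ (-θ) ≤ a :=
      mul_le_of_le_one_right ha0.le (Real.rpow_le_one_of_one_le_of_nonpos hT' (by linarith))
    have h2 : 0 ≤ a * (T : ℝ) ^ (-θ) := by positivity
    have h3 : a ≤ a / θ := by rw [le_div_iff₀ hθ0]; nlinarith
    nlinarith
  have hfirst : ∑ t ∈ Finset.Icc 1 (T - 1), (a * (t : ℝ) ^ (-θ)) ^ 2 /
        (1 + ∑ j ∈ Finset.Icc (t + 1) T, a * (j : ℝ) ^ (-θ)) ≤ δ * a / θ := by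
    rcases Nat.lt_or_ge T 2 with h | h
    · rw [Finset.Icc_eq_empty (by omega), Finset.sum_empty]
      positivity
    · refine (isAdmissible_deltaConst hθ0 hθ1 T h a ha0).trans ?_
      have hq : 0 < 1 - θ := by linarith
      rw [min_eq_right ((div_le_one hq).2 ha1.le)]
      have e1 : a ^ 2 / (a / (1 - θ)) = a * (1 - θ) := by field_simp
      have hR : (if θ ≤ 1 / 2 then ((T : ℝ) + 1) ^ (-θ) * Real.log (T + 1)
          else ((T : ℝ) + 1) ^ (-(1 - θ))) ≤ 1 / θ := by
        split_ifs
        · exact rpow_neg_mul_log_le (by linarith) hθ0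
        · refine (Real.rpow_le_one_of_one_le_of_nonpos (by linarith) (by linarith)).trans ?_
          rw [le_div_iff₀ hθ0]
          linarith
      rw [e1]
      calc _ ≤ δ * (a * (1 - θ)) * (1 / θ) := by gcongr
        _ ≤ δ * (a * 1) * (1 / θ) := by gcongr; linarith
        _ = _ := by ring
  calc _ ≤ δ * a / θ + a / θ := add_le_add hfirst hlast
    _ = _ := by ring

/-- The last term is exactly `b²`. Elsewhere the tail is `(T - t) b`, and discarding the `1` gives
`b^{2-s} (T - t)^{-s}`. -/
theorem sum_const_div_le {b s : ℝ} (hb0 : 0 < b) (hs : 0 ≤ s) (T : ℕ) :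
    ∑ t ∈ Finset.Icc 1 T, b ^ 2 / (1 + ∑ _j ∈ Finset.Icc (t + 1) T, b) ^ s ≤
      b ^ 2 + b ^ (2 - s) * ∑ k ∈ Finset.Icc 1 T, (k : ℝ) ^ (-s) := by
  have hH : 0 ≤ ∑ k ∈ Finset.Icc 1 T, (k : ℝ) ^ (-s) := Finset.sum_nonneg fun k _ => by positivity
  rcases Nat.eq_zero_or_pos T with rfl | hT
  · simp; positivity
  rw [sum_Icc_eq_sum_add_last hT, add_comm]
  refine add_le_add ?_ ?_
  · rw [Finset.Icc_eq_empty (by omega), Finset.sum_empty, add_zero, Real.one_rpow, div_one]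
  · have h1 : ∀ t ∈ Finset.Icc 1 (T - 1), b ^ 2 / (1 + ∑ _j ∈ Finset.Icc (t + 1) T, b) ^ s ≤
        b ^ (2 - s) * ((T : ℝ) - t) ^ (-s) := by
      intro t ht
      have ht' := Finset.mem_Icc.1 ht
      have htT : (0 : ℝ) < (T : ℝ) - t := sub_pos.2 (by exact_mod_cast (by omega : t < T))
      have e1 : ∑ _j ∈ Finset.Icc (t + 1) T, b = ((T : ℝ) - t) * b := by
        rw [Finset.sum_const, Nat.card_Icc, nsmul_eq_mul, show T + 1 - (t + 1) = T - t by omega,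
          Nat.cast_sub (by omega)]
      rw [e1]
      calc _ ≤ b ^ 2 / (((T : ℝ) - t) * b) ^ s := by gcongr; linarith
        _ = _ := by
          rw [Real.mul_rpow htT.le hb0.le, Real.rpow_neg htT.le, Real.rpow_sub hb0,
            Real.rpow_two]
          field_simp
    refine (Finset.sum_le_sum h1).trans ?_
    rw [← Finset.mul_sum, sum_Icc_reflect (fun x => x ^ (-s))]
    have hsub : Finset.Icc 1 (T - 1) ⊆ Finset.Icc 1 T := Finset.Icc_subset_Icc le_rfl (by omega)
    gcongr

/-- The step size is tied to the horizon `T`, but stability is needed at every earlier time `T'`.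
The harmonic sum costs `1 + log T`, which `T^{-θ}` reduces to `1 + 1/θ`. With `b² ≤ a` for the last
term the total is `a (1 + 2θ) / θ`, the quantity in `gammaConst`. -/
theorem sum_const_le_of_lt_gammaConst {κ θ a : ℝ} (hκ : 0 < κ) (hθ0 : 0 < θ)
    (ha0 : 0 < a) (ha1 : a < 1) (ha : a < gammaConst κ θ) {T T' : ℕ} (hT : 1 ≤ T)
    (hT' : T' ≤ T) :
    ∑ t ∈ Finset.Icc 1 T', (a * (T : ℝ) ^ (-θ)) ^ 2 /
        (1 + ∑ _j ∈ Finset.Icc (t + 1) T', a * (T : ℝ) ^ (-θ)) ≤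
      1 / (4 * κ ^ 2 * (1 + 2 * κ ^ 2)) := by
  have hT1 : (1 : ℝ) ≤ T := by exact_mod_cast hT
  set b := a * (T : ℝ) ^ (-θ) with hb
  have hb0 : 0 < b := by positivity
  have hp1 : (T : ℝ) ^ (-θ) ≤ 1 := Real.rpow_le_one_of_one_le_of_nonpos hT1 (by linarith)
  have hba : b ≤ a := mul_le_of_le_one_right ha0.le hp1
  have h1 := sum_const_div_le hb0 zero_le_one T'
  simp only [Real.rpow_one] at h1
  rw [show (2 : ℝ) - 1 = 1 by norm_num, Real.rpow_one] at h1
  refine h1.trans ?_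
  have h2 : ∑ k ∈ Finset.Icc 1 T', (k : ℝ) ^ (-(1 : ℝ)) ≤ 1 + Real.log T := by
    refine le_trans ?_ (sum_rpow_neg_one_le T)
    exact Finset.sum_le_sum_of_subset_of_nonneg (Finset.Icc_subset_Icc le_rfl hT')
      fun k _ _ => by positivity
  have h3 := rpow_neg_mul_log_le (x := T) (by linarith) hθ0
  have h4 : b * ∑ k ∈ Finset.Icc 1 T', (k : ℝ) ^ (-(1 : ℝ)) ≤ a * (1 + 1 / θ) := by
    calc _ ≤ b * (1 + Real.log T) := by gcongr
      _ = a * ((T : ℝ) ^ (-θ) + (T : ℝ) ^ (-θ) * Real.log T) := by rw [hb]; ring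
      _ ≤ _ := by gcongr
  have h5 : b ^ 2 ≤ a := by nlinarith
  calc _ ≤ a + a * (1 + 1 / θ) := add_le_add h5 h4
    _ = a * (1 + 2 * θ) / θ := by field_simp; ring
    _ ≤ _ := by
      rw [gammaConst, lt_div_iff₀ (by positivity)] at ha
      rw [div_le_div_iff₀ hθ0 (by positivity)]
      nlinarith

/-! ### Variance rates -/

/-- The split sum with `s = 1 - β`: its second half and the last term give `T^{β-θ(1+β)}`, its first
half `T^{-(1-β)(1-θ)} ∑ k^{-2θ}`. The two exponents coincide at `θ = 1/2`, where a logarithm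
appears. -/
theorem exists_sum_decay_rpow_le {β θ : ℝ} (hβ0 : 0 < β) (hβ1 : β < 1) (hθ0 : 0 < θ)
    (hθ1 : θ < 1) :
    ∃ C : ℝ, 0 ≤ C ∧ ∀ a : ℝ, 0 < a → a ≤ 1 → ∀ T : ℕ, 1 ≤ T →
      ∑ t ∈ Finset.Icc 1 T, (a * (t : ℝ) ^ (-θ)) ^ 2 /
        (1 + ∑ j ∈ Finset.Icc (t + 1) T, a * (j : ℝ) ^ (-θ)) ^ (1 - β) ≤
      C * (if θ ≤ 1 / 2 then ((T : ℝ) + 1) ^ (β - θ * (1 + β)) *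
          (if θ = 1 / 2 then Real.log ((T : ℝ) + 1) else 1)
        else ((T : ℝ) + 1) ^ (-((1 - β) * (1 - θ)))) := by
  have hs : 0 < 1 - β := by linarith
  have key : ∀ a : ℝ, 0 < a → a ≤ 1 → ∀ T : ℕ, 1 ≤ T →
      ∑ t ∈ Finset.Icc 1 T, (a * (t : ℝ) ^ (-θ)) ^ 2 /
        (1 + ∑ j ∈ Finset.Icc (t + 1) T, a * (j : ℝ) ^ (-θ)) ^ (1 - β) ≤
      2 * (T : ℝ) ^ (-((1 - β) * (1 - θ))) * ∑ k ∈ Finset.Icc 1 T, (k : ℝ) ^ (-(2 * θ)) +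
        (4 / β + 1) * (T : ℝ) ^ (β - θ * (1 + β)) := by
    intro a ha0 ha1 T hT
    have hT1 : (1 : ℝ) ≤ T := by exact_mod_cast hT
    have hT0 : (0 : ℝ) < T := by linarith
    have hlast : (a * (T : ℝ) ^ (-θ)) ^ 2 /
        (1 + ∑ j ∈ Finset.Icc (T + 1) T, a * (j : ℝ) ^ (-θ)) ^ (1 - β) ≤
          (T : ℝ) ^ (β - θ * (1 + β)) := by
      rw [Finset.Icc_eq_empty (by omega), Finset.sum_empty, add_zero, Real.one_rpow, div_one]
      calc (a * (T : ℝ) ^ (-θ)) ^ 2 ≤ (1 * (T : ℝ) ^ (-θ)) ^ 2 := by gcongr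
        _ = (T : ℝ) ^ (-(2 * θ)) := by
          rw [one_mul, ← Real.rpow_natCast, ← Real.rpow_mul hT0.le]; push_cast; ring_nf
        _ ≤ _ := Real.rpow_le_rpow_of_exponent_le hT1 (by nlinarith)
    have h1 : ∀ t ∈ Finset.Icc 1 (T - 1), (a * (t : ℝ) ^ (-θ)) ^ 2 /
          (1 + ∑ j ∈ Finset.Icc (t + 1) T, a * (j : ℝ) ^ (-θ)) ^ (1 - β) ≤
        (t : ℝ) ^ (-(2 * θ)) / (∑ j ∈ Finset.Icc (t + 1) T, (j : ℝ) ^ (-θ)) ^ (1 - β) := by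
      intro t ht
      have ht' := Finset.mem_Icc.1 ht
      have ht0 : (0 : ℝ) < t := by exact_mod_cast (by omega : 0 < t)
      have hS : 0 < ∑ j ∈ Finset.Icc (t + 1) T, (j : ℝ) ^ (-θ) := by
        refine Finset.sum_pos (fun j hj => ?_) ⟨T, Finset.mem_Icc.2 (by omega)⟩
        have : (0 : ℝ) < j := by exact_mod_cast (by have := Finset.mem_Icc.1 hj; omega : 0 < j)
        positivity
      rw [← Finset.mul_sum]
      have e1 : (t : ℝ) ^ (-(2 * θ)) = ((t : ℝ) ^ (-θ)) ^ 2 := by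
        rw [← Real.rpow_natCast, ← Real.rpow_mul ht0.le]; push_cast; ring_nf
      -- As `a ≤ 1`, the numerator's `a²` cancels against the `a^{1-β}` of the denominator, making
      -- the constant independent of `a`.
      have e2 : a ^ 2 ≤ a ^ (1 - β) := by
        rw [← Real.rpow_natCast]
        exact Real.rpow_le_rpow_of_exponent_ge ha0 ha1 (by push_cast; linarith)
      calc _ ≤ (a * (t : ℝ) ^ (-θ)) ^ 2 /
            (a * ∑ j ∈ Finset.Icc (t + 1) T, (j : ℝ) ^ (-θ)) ^ (1 - β) := by
            gcongr
            linarith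
        _ = a ^ 2 * (t : ℝ) ^ (-(2 * θ)) / (a ^ (1 - β) *
            (∑ j ∈ Finset.Icc (t + 1) T, (j : ℝ) ^ (-θ)) ^ (1 - β)) := by
            rw [Real.mul_rpow ha0.le hS.le, e1, mul_pow]
        _ ≤ a ^ (1 - β) * (t : ℝ) ^ (-(2 * θ)) / (a ^ (1 - β) *
            (∑ j ∈ Finset.Icc (t + 1) T, (j : ℝ) ^ (-θ)) ^ (1 - β)) := by gcongr
        _ = _ := by
            rw [mul_div_mul_left]
            positivity
    rw [sum_Icc_eq_sum_add_last hT]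
    have h2 := (Finset.sum_le_sum h1).trans (sum_div_tail_rpow_le hθ0 hs T)
    have h3 : (2 : ℝ) ^ (1 - β) ≤ 2 := by
      calc (2 : ℝ) ^ (1 - β) ≤ 2 ^ (1 : ℝ) :=
            Real.rpow_le_rpow_of_exponent_le one_le_two (by linarith)
        _ = 2 := by norm_num
    have h4 : (2 : ℝ) ^ (2 * θ) ≤ 4 := by
      calc (2 : ℝ) ^ (2 * θ) ≤ 2 ^ (2 : ℝ) :=
            Real.rpow_le_rpow_of_exponent_le one_le_two (by linarith)
        _ = 4 := by norm_num
    have h5 := sum_rpow_neg_le_of_lt_one hs.le (by linarith) T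
    rw [sub_sub_cancel] at h5
    have hH : 0 ≤ ∑ k ∈ Finset.Icc 1 T, (k : ℝ) ^ (-(2 * θ)) :=
      Finset.sum_nonneg fun k _ => by positivity
    calc _ ≤ (2 ^ (1 - β) * (T : ℝ) ^ (-((1 - β) * (1 - θ))) *
              ∑ k ∈ Finset.Icc 1 T, (k : ℝ) ^ (-(2 * θ)) +
            2 ^ (2 * θ) * (T : ℝ) ^ (θ * (1 - β) - 2 * θ) *
              ∑ k ∈ Finset.Icc 1 T, (k : ℝ) ^ (-(1 - β))) + (T : ℝ) ^ (β - θ * (1 + β)) :=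
          add_le_add h2 hlast
      _ ≤ (2 * (T : ℝ) ^ (-((1 - β) * (1 - θ))) * ∑ k ∈ Finset.Icc 1 T, (k : ℝ) ^ (-(2 * θ)) +
            4 * (T : ℝ) ^ (θ * (1 - β) - 2 * θ) * ((T : ℝ) ^ β / β)) +
              (T : ℝ) ^ (β - θ * (1 + β)) := by gcongr
      _ = _ := by
          have : (T : ℝ) ^ (θ * (1 - β) - 2 * θ) * (T : ℝ) ^ β = (T : ℝ) ^ (β - θ * (1 + β)) := by
            rw [← Real.rpow_add hT0]; ring_nf
          rw [← this]
          ring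
  rcases lt_trichotomy θ (1 / 2) with h | h | h
  · have hq : 0 < 1 - 2 * θ := by linarith
    refine ⟨2 ^ |β - θ * (1 + β)| * (2 / (1 - 2 * θ) + (4 / β + 1)), by positivity,
      fun a ha0 ha1 T hT => ?_⟩
    have hT1 : (1 : ℝ) ≤ T := by exact_mod_cast hT
    rw [if_pos h.le, if_neg h.ne, mul_one]
    calc _ ≤ 2 * (T : ℝ) ^ (-((1 - β) * (1 - θ))) * ((T : ℝ) ^ (1 - 2 * θ) / (1 - 2 * θ)) +
          (4 / β + 1) * (T : ℝ) ^ (β - θ * (1 + β)) := by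
          refine (key a ha0 ha1 T hT).trans ?_
          gcongr
          exact sum_rpow_neg_le_of_lt_one (by linarith) (by linarith) T
      _ = (2 / (1 - 2 * θ) + (4 / β + 1)) * (T : ℝ) ^ (β - θ * (1 + β)) := by
          have : (T : ℝ) ^ (-((1 - β) * (1 - θ))) * (T : ℝ) ^ (1 - 2 * θ) =
              (T : ℝ) ^ (β - θ * (1 + β)) := by
            rw [← Real.rpow_add (by linarith)]; ring_nf
          rw [← this]
          ring
      _ ≤ (2 / (1 - 2 * θ) + (4 / β + 1)) * (2 ^ |β - θ * (1 + β)| *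
          ((T : ℝ) + 1) ^ (β - θ * (1 + β))) := by
          gcongr
          exact rpow_le_two_rpow_abs_mul hT1 _
      _ = _ := by ring
  · refine ⟨2 ^ |β - θ * (1 + β)| * (6 + 2 * (4 / β + 1)), by positivity,
      fun a ha0 ha1 T hT => ?_⟩
    have hT1 : (1 : ℝ) ≤ T := by exact_mod_cast hT
    have hl := half_le_log_add_one hT1
    rw [if_pos h.le, if_pos h]
    have hk := key a ha0 ha1 T hT
    rw [show -((1 - β) * (1 - θ)) = β - θ * (1 + β) by rw [h]; ring,
      show 2 * θ = 1 by linarith] at hk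
    calc _ ≤ 2 * (T : ℝ) ^ (β - θ * (1 + β)) * (3 * Real.log ((T : ℝ) + 1)) +
          (4 / β + 1) * (T : ℝ) ^ (β - θ * (1 + β)) * (2 * Real.log ((T : ℝ) + 1)) := by
          refine hk.trans (add_le_add ?_ ?_)
          · gcongr
            exact sum_rpow_neg_one_le_log hT
          · exact le_mul_of_one_le_right (by positivity) (by linarith)
      _ = (T : ℝ) ^ (β - θ * (1 + β)) * ((6 + 2 * (4 / β + 1)) * Real.log ((T : ℝ) + 1)) := by ring
      _ ≤ (2 ^ |β - θ * (1 + β)| * ((T : ℝ) + 1) ^ (β - θ * (1 + β))) *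
          ((6 + 2 * (4 / β + 1)) * Real.log ((T : ℝ) + 1)) := by
          gcongr
          exact rpow_le_two_rpow_abs_mul hT1 _
      _ = _ := by ring
  · obtain ⟨C, hC0, hC⟩ := exists_sum_rpow_neg_le (p := 2 * θ) (by linarith)
    refine ⟨2 ^ |-((1 - β) * (1 - θ))| * (2 * C + (4 / β + 1)), by positivity,
      fun a ha0 ha1 T hT => ?_⟩
    have hT1 : (1 : ℝ) ≤ T := by exact_mod_cast hT
    rw [if_neg (not_le.2 h)]
    calc _ ≤ 2 * (T : ℝ) ^ (-((1 - β) * (1 - θ))) * C +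
          (4 / β + 1) * (T : ℝ) ^ (-((1 - β) * (1 - θ))) := by
          refine (key a ha0 ha1 T hT).trans ?_
          gcongr
          · exact hC T
          · nlinarith
      _ = (T : ℝ) ^ (-((1 - β) * (1 - θ))) * (2 * C + (4 / β + 1)) := by ring
      _ ≤ (2 ^ |-((1 - β) * (1 - θ))| * ((T : ℝ) + 1) ^ (-((1 - β) * (1 - θ)))) *
          (2 * C + (4 / β + 1)) := by
          gcongr
          exact rpow_le_two_rpow_abs_mul hT1 _
      _ = _ := by ring

theorem sum_const_rpow_le {β θ a : ℝ} (hβ0 : 0 < β) (hβ1 : β < 1) (hθ0 : 0 < θ) (ha0 : 0 < a)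
    (ha1 : a ≤ 1) {T : ℕ} (hT : 1 ≤ T) :
    ∑ t ∈ Finset.Icc 1 T, (a * (T : ℝ) ^ (-θ)) ^ 2 /
        (1 + ∑ _j ∈ Finset.Icc (t + 1) T, a * (T : ℝ) ^ (-θ)) ^ (1 - β) ≤
      (1 + 1 / β) * (T : ℝ) ^ (β - θ * (1 + β)) := by
  have hT1 : (1 : ℝ) ≤ T := by exact_mod_cast hT
  have hT0 : (0 : ℝ) < T := by linarith
  have hb0 : 0 < a * (T : ℝ) ^ (-θ) := by positivity
  have hb1 : a * (T : ℝ) ^ (-θ) ≤ (T : ℝ) ^ (-θ) := mul_le_of_le_one_left (by positivity) ha1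
  have h5 := sum_rpow_neg_le_of_lt_one (p := 1 - β) (by linarith) (by linarith) T
  rw [sub_sub_cancel] at h5
  have h6 : (a * (T : ℝ) ^ (-θ)) ^ 2 ≤ (T : ℝ) ^ (β - θ * (1 + β)) := by
    calc (a * (T : ℝ) ^ (-θ)) ^ 2 ≤ ((T : ℝ) ^ (-θ)) ^ 2 := by gcongr
      _ = (T : ℝ) ^ (-(2 * θ)) := by
        rw [← Real.rpow_natCast, ← Real.rpow_mul hT0.le]; push_cast; ring_nf
      _ ≤ _ := Real.rpow_le_rpow_of_exponent_le hT1 (by nlinarith)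
  have h7 : (a * (T : ℝ) ^ (-θ)) ^ (2 - (1 - β)) * ∑ k ∈ Finset.Icc 1 T, (k : ℝ) ^ (-(1 - β)) ≤
      1 / β * (T : ℝ) ^ (β - θ * (1 + β)) := by
    calc _ ≤ ((T : ℝ) ^ (-θ)) ^ (2 - (1 - β)) * ((T : ℝ) ^ β / β) := by
          gcongr
          linarith
      _ = _ := by
          rw [← Real.rpow_mul hT0.le, ← mul_div_assoc, ← Real.rpow_add hT0]
          ring_nf
  refine (sum_const_div_le hb0 (by linarith) T).trans ((add_le_add h6 h7).trans (le_of_eq ?_))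
  ring

/-! ### Scalar spectral bounds -/

/-- The polynomial `∏_{j=t+1}^T (1 - η_j x)`. -/
noncomputable def decayPoly (η : ℕ → ℝ) (t T : ℕ) : Polynomial ℝ :=
  ∏ j ∈ Finset.Icc (t + 1) T, (1 - Polynomial.C (η j) * Polynomial.X)

theorem abs_decayPoly_eval_le {η : ℕ → ℝ} {t T : ℕ} {x : ℝ}
    (hx : ∀ j ∈ Finset.Icc (t + 1) T, η j * x ≤ 1) :
    |(decayPoly η t T).eval x| ≤ Real.exp (-(x * ∑ j ∈ Finset.Icc (t + 1) T, η j)) := by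
  rw [decayPoly, Polynomial.eval_prod, Finset.abs_prod, Finset.mul_sum, ← Finset.sum_neg_distrib,
    Real.exp_sum]
  refine Finset.prod_le_prod (fun j _ => abs_nonneg _) fun j hj => ?_
  have h1 := hx j hj
  simp only [Polynomial.eval_sub, Polynomial.eval_one, Polynomial.eval_mul, Polynomial.eval_C,
    Polynomial.eval_X]
  rw [abs_of_nonneg (by linarith)]
  have := Real.add_one_le_exp (-(x * η j))
  linarith

/-- For `s = 1` the bound is `x e^{-2xS} ≤ b` plus `x S e^{-2xS} ≤ 1/2`. The general case is its
`s`-th power, since `e^{-2xS} ≤ 1` only grows when raised to `s ≤ 1`. -/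
theorem rpow_mul_exp_sq_le {x b S s : ℝ} (hx0 : 0 ≤ x) (hxb : x ≤ b) (hS : 0 ≤ S) (hs0 : 0 ≤ s)
    (hs1 : s ≤ 1) :
    (x ^ (s / 2) * Real.exp (-(x * S))) ^ 2 ≤ ((1 + 2 * b) / 2) ^ s / (1 + S) ^ s := by
  have e1 : (x ^ (s / 2)) ^ 2 = x ^ s := by
    rw [← Real.rpow_natCast, ← Real.rpow_mul hx0]; push_cast; ring_nf
  have e2 : Real.exp (-(x * S)) ^ 2 = Real.exp (-(2 * (x * S))) := by
    rw [← Real.exp_nat_mul]; push_cast; ring_nf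
  have h1 : x * S * Real.exp (-(2 * (x * S))) ≤ 1 / 2 := by
    rw [Real.exp_neg, ← div_eq_mul_inv, div_le_iff₀ (Real.exp_pos _)]
    linarith [Real.add_one_le_exp (2 * (x * S))]
  have h2 : Real.exp (-(2 * (x * S))) ≤ 1 := Real.exp_le_one_iff.2 (by
    have := mul_nonneg hx0 hS
    linarith)
  have h3 : x * (1 + S) * Real.exp (-(2 * (x * S))) ≤ (1 + 2 * b) / 2 := by
    have : x * Real.exp (-(2 * (x * S))) ≤ b := by
      calc _ ≤ b * 1 := by gcongr; linarith
        _ = b := mul_one b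
    nlinarith
  have h4 : Real.exp (-(2 * (x * S))) ≤ Real.exp (-(2 * (x * S))) ^ s := by
    conv_lhs => rw [← Real.rpow_one (Real.exp _)]
    exact Real.rpow_le_rpow_of_exponent_ge (Real.exp_pos _) h2 hs1
  rw [mul_pow, e1, e2, le_div_iff₀ (by positivity)]
  calc _ ≤ x ^ s * Real.exp (-(2 * (x * S))) ^ s * (1 + S) ^ s := by gcongr
    _ = (x * (1 + S) * Real.exp (-(2 * (x * S)))) ^ s := by
      rw [Real.mul_rpow (by positivity) (Real.exp_pos _).le, Real.mul_rpow hx0 (by positivity)]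
      ring
    _ ≤ _ := by gcongr

/-- The inequality `y ≤ e^y` at `y = x S / s`, raised to the power `s`. -/
theorem rpow_mul_exp_le {x S s : ℝ} (hx0 : 0 ≤ x) (hS : 0 < S) (hs : 0 < s) :
    x ^ s * Real.exp (-(x * S)) ≤ s ^ s * S ^ (-s) := by
  have h1 : x * S / s ≤ Real.exp (x * S / s) := by
    linarith [Real.add_one_le_exp (x * S / s)]
  have h2 : (x * S / s) ^ s ≤ Real.exp (x * S) := by
    calc _ ≤ Real.exp (x * S / s) ^ s := by gcongr
      _ = _ := by
        rw [← Real.exp_mul]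
        congr 1
        field_simp
  rw [Real.div_rpow (by positivity) hs.le, Real.mul_rpow hx0 hS.le,
    div_le_iff₀ (by positivity)] at h2
  rw [Real.exp_neg, Real.rpow_neg hS.le, ← div_eq_mul_inv, ← div_eq_mul_inv,
    div_le_div_iff₀ (Real.exp_pos _) (by positivity)]
  linarith

/-! ### Measurability of the iterates -/

section Measurability

variable {𝕜 X Y : Type*} [RCLike 𝕜] [TopologicalSpace X]
  [NormedAddCommGroup Y] [InnerProductSpace 𝕜 Y] [CompleteSpace Y]
  {K : Matrix X X (Y →L[𝕜] Y)} [Fact K.PosSemidef] {κ : ℝ}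

theorem IsBoundedMercer.norm_kerFun_le (hK : IsBoundedMercer K κ) (x : X) (y : Y) :
    ‖RKHS.kerFun (RKHS.OfKernel K) x y‖ ≤ |κ| * ‖y‖ := by
  refine ContinuousLinearMap.le_of_opNorm_le _ ?_ y
  rw [RKHS.norm_kerFun_eq_sqrt_norm_kernel, RKHS.OfKernel.kernel_ofKernel,
    ← Real.sqrt_sq_eq_abs]
  exact Real.sqrt_le_sqrt (hK.bound x)

/-- The functions `K(·, x) y`, with `x` and `y` in countable dense sets, span a dense subspace: a
function orthogonal to all of them vanishes on a dense set, hence everywhere by continuity. -/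
theorem IsBoundedMercer.secondCountableTopology [TopologicalSpace.SeparableSpace X]
    [SecondCountableTopology Y] (hK : IsBoundedMercer K κ) :
    SecondCountableTopology (RKHS.OfKernel K) := by
  obtain ⟨s, hs, hsd⟩ := TopologicalSpace.exists_countable_dense X
  obtain ⟨t, ht, htd⟩ := TopologicalSpace.exists_countable_dense Y
  set S : Set (RKHS.OfKernel K) :=
    (fun p : X × Y => RKHS.kerFun (RKHS.OfKernel K) p.1 p.2) '' (s ×ˢ t) with hS
  have hSc : S.Countable := (hs.prod ht).image _
  have htop : (Submodule.span 𝕜 S).topologicalClosure = ⊤ := by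
    rw [Submodule.topologicalClosure_eq_top_iff, Submodule.eq_bot_iff]
    intro h hh
    rw [Submodule.mem_orthogonal] at hh
    have h1 : ∀ x ∈ s, ∀ y ∈ t, ⟪y, h x⟫_𝕜 = 0 := fun x hx y hy => by
      rw [← RKHS.kerFun_inner]
      exact hh _ (Submodule.subset_span ⟨(x, y), ⟨hx, hy⟩, rfl⟩)
    have h2 : ∀ x ∈ s, h x = 0 := fun x hx => by
      have hd : Dense (t : Set Y) := htd
      refine ext_inner_left 𝕜 fun y => ?_
      have hcl : IsClosed {y : Y | ⟪y, h x⟫_𝕜 = ⟪y, (0 : Y)⟫_𝕜} :=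
        isClosed_eq (by fun_prop) (by fun_prop)
      exact hcl.closure_subset_iff.2 (fun y hy => by simpa using h1 x hx y hy) (hd y)
    have h3 : (h : X → Y) = fun _ => 0 :=
      (hK.continuous h).ext_on hsd continuous_const fun x hx => h2 x hx
    exact RKHS.ext fun x => by rw [h3, RKHS.coe_zero]; rfl
  have hsep : TopologicalSpace.IsSeparable (univ : Set (RKHS.OfKernel K)) := by
    have h1 := (hSc.isSeparable.span (R := 𝕜)).closure
    have h2 : closure ((Submodule.span 𝕜 S : Submodule 𝕜 (RKHS.OfKernel K)) :
        Set (RKHS.OfKernel K)) = univ := by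
      rw [← Submodule.topologicalClosure_coe, htop, Submodule.top_coe]
    rwa [h2] at h1
  have := TopologicalSpace.isSeparable_univ_iff.1 hsep
  exact UniformSpace.secondCountable_of_separable _

/-- Evaluation is continuous in the point and Lipschitz in the function with constant `|κ|`,
uniformly over points; this gives joint continuity. -/
theorem IsBoundedMercer.continuous_eval (hK : IsBoundedMercer K κ) :
    Continuous fun p : X × RKHS.OfKernel K => p.2 p.1 := by
  refine continuous_prod_of_continuous_lipschitzWith' _ ⟨|κ|, abs_nonneg κ⟩ (fun x => ?_)
    fun h => hK.continuous h
  refine LipschitzWith.of_dist_le_mul fun h h' => ?_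
  rw [dist_eq_norm, dist_eq_norm]
  have := hK.norm_apply_le (h - h') x
  rwa [RKHS.coe_sub] at this

/-- The map `x ↦ K(·, x)` need not be continuous in norm, so measurability is checked weakly:
pairing with `w` gives `⟪w x, ·⟫`, which is jointly continuous. -/
theorem measurable_gradientStep {H : Type*} [NormedAddCommGroup H] [InnerProductSpace 𝕜 H]
    [CompleteSpace H] [RKHS 𝕜 H X Y] [SecondCountableTopology H]
    [MeasurableSpace H] [BorelSpace H] [MeasurableSpace X] [BorelSpace X]
    [SecondCountableTopology X] [SecondCountableTopology Y] [MeasurableSpace Y] [BorelSpace Y]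
    (hH : Continuous fun p : X × H => p.2 p.1) (c : 𝕜) :
    Measurable fun p : H × (X × Y) => p.1 - c • RKHS.kerFun H p.2.1 (p.1 p.2.1 - p.2.2) := by
  have h1 : Measurable fun p : H × (X × Y) => RKHS.kerFun H p.2.1 (p.1 p.2.1 - p.2.2) := by
    refine measurable_of_inner (𝕜 := 𝕜) fun w => Continuous.measurable ?_
    simp_rw [RKHS.inner_kerFun]
    have h1 : Continuous fun p : H × (X × Y) => p.1 p.2.1 :=
      hH.comp (by fun_prop : Continuous fun p : H × (X × Y) => (p.2.1, p.1))
    have h2 : Continuous fun x : X => w x :=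
      hH.comp (by fun_prop : Continuous fun x : X => (x, w))
    fun_prop
  exact measurable_fst.sub (h1.const_smul c)

theorem IsBoundedMercer.measurable_sgd [MeasurableSpace X] [BorelSpace X]
    [SecondCountableTopology X] [SecondCountableTopology Y] [MeasurableSpace Y] [BorelSpace Y]
    [MeasurableSpace (RKHS.OfKernel K)] [BorelSpace (RKHS.OfKernel K)]
    (hK : IsBoundedMercer K κ) (η : ℕ → ℝ) (T : ℕ) : Measurable (sgd K η T) := by
  have := hK.secondCountableTopology
  induction T with
  | zero => exact measurable_const
  | succ T ih =>
    have h1 : Measurable fun z : Fin (T + 1) → X × Y => sgd K η T (Fin.init z) :=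
      ih.comp (measurable_pi_lambda _ fun i => measurable_pi_apply _)
    exact (measurable_gradientStep hK.continuous_eval ((η (T + 1) : ℝ) : 𝕜)).comp
      (h1.prodMk (measurable_pi_apply (Fin.last T)))

end Measurability

/-- Isolates the last observation. Only the upper half of Tonelli's theorem is used; it holds
without measurability of `F`. -/
theorem lintegral_pi_succ_le {α : Type*} [MeasurableSpace α] (ρ : Measure α)
    [IsProbabilityMeasure ρ] (T : ℕ) (F : (Fin T → α) → α → ℝ≥0∞) :
    ∫⁻ z : Fin (T + 1) → α, F (Fin.init z) (z (Fin.last T)) ∂(Measure.pi fun _ => ρ) ≤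
      ∫⁻ z : Fin T → α, ∫⁻ a, F z a ∂ρ ∂(Measure.pi fun _ => ρ) := by
  have h1 := measurePreserving_piFinSuccAbove (fun _ : Fin (T + 1) => ρ) (Fin.last T)
  have h2 := (Measure.measurePreserving_swap (μ := ρ)
    (ν := Measure.pi fun _ : Fin T => ρ)).comp h1
  have h3 := h2.lintegral_comp_emb
    (MeasurableEquiv.prodComm.measurableEmbedding.comp
      (MeasurableEquiv.piFinSuccAbove _ _).measurableEmbedding) (fun p => F p.1 p.2)
  refine le_trans (le_of_eq ?_) (lintegral_prod_le fun p : (Fin T → α) × α => F p.1 p.2)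
  rw [← h3]
  refine lintegral_congr fun z => ?_
  have h4 : Fin.init z = fun j => z ((Fin.last T).succAbove j) := by
    funext j
    rw [Fin.succAbove_last]
    rfl
  rw [h4]
  rfl

/-! ### The noise -/

theorem measurePreserving_fst {X Y : Type*} [MeasurableSpace X] [MeasurableSpace Y]
    {ρ : Measure (X × Y)} : MeasurePreserving (Prod.fst : X × Y → X) ρ ρ.fst :=
  ⟨measurable_fst, rfl⟩

section Noise

variable {𝕜 X Y : Type*} [RCLike 𝕜] [MeasurableSpace X]
  [NormedAddCommGroup Y] [InnerProductSpace 𝕜 Y] [CompleteSpace Y] [SecondCountableTopology Y]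
  [MeasurableSpace Y] [BorelSpace Y] {ρ : Measure (X × Y)} [IsProbabilityMeasure ρ] {σ : ℝ}

theorem memLp_noise (hreg : MemLp (regression 𝕜 ρ) 2 ρ.fst)
    (hnoise : ∫⁻ z, ‖z.2 - regression 𝕜 ρ z.1‖ₑ ^ 2 ∂ρ ≤ ENNReal.ofReal (σ ^ 2)) :
    MemLp (fun z : X × Y => z.2 - regression 𝕜 ρ z.1) 2 ρ := by
  refine ⟨measurable_snd.aestronglyMeasurable.sub
    (hreg.1.comp_measurePreserving measurePreserving_fst), ?_⟩
  rw [eLpNorm_lt_top_iff_lintegral_rpow_enorm_lt_top two_ne_zero ENNReal.ofNat_ne_top]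
  simp only [ENNReal.toReal_ofNat, ENNReal.rpow_ofNat]
  exact hnoise.trans_lt ENNReal.ofReal_lt_top

theorem integral_noise_sq_le (hreg : MemLp (regression 𝕜 ρ) 2 ρ.fst)
    (hnoise : ∫⁻ z, ‖z.2 - regression 𝕜 ρ z.1‖ₑ ^ 2 ∂ρ ≤ ENNReal.ofReal (σ ^ 2)) :
    ∫ z, ‖z.2 - regression 𝕜 ρ z.1‖ ^ 2 ∂ρ ≤ σ ^ 2 := by
  have h1 : Integrable (fun z : X × Y => ‖z.2 - regression 𝕜 ρ z.1‖ ^ 2) ρ :=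
    (memLp_noise hreg hnoise).integrable_norm_pow two_ne_zero
  rw [← ENNReal.ofReal_le_ofReal_iff (sq_nonneg σ), ofReal_integral_eq_lintegral_ofReal h1
    (Filter.Eventually.of_forall fun z => sq_nonneg _)]
  refine le_trans (le_of_eq (lintegral_congr fun z => ?_)) hnoise
  rw [ENNReal.ofReal_pow (norm_nonneg _), ofReal_norm]

theorem integrable_inner_noise (hreg : MemLp (regression 𝕜 ρ) 2 ρ.fst)
    (hnoise : ∫⁻ z, ‖z.2 - regression 𝕜 ρ z.1‖ₑ ^ 2 ∂ρ ≤ ENNReal.ofReal (σ ^ 2))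
    {v : X → Y} (hv : AEStronglyMeasurable v ρ.fst) {C : ℝ} (hC : ∀ x, ‖v x‖ ≤ C) :
    Integrable (fun z : X × Y => RCLike.re ⟪v z.1, z.2 - regression 𝕜 ρ z.1⟫_𝕜) ρ := by
  have hn := memLp_noise hreg hnoise
  refine Integrable.re ?_
  refine Integrable.mono' ((hn.integrable one_le_two).norm.const_mul C)
    ((hv.comp_measurePreserving measurePreserving_fst).inner hn.1)
    (Filter.Eventually.of_forall fun z => (norm_inner_le_norm _ _).trans ?_)
  gcongr
  exact hC _

/-- The noise `y - h†(x)` is orthogonal to the functions of `x`. -/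
theorem integral_inner_noise (hreg : MemLp (regression 𝕜 ρ) 2 ρ.fst)
    (hnoise : ∫⁻ z, ‖z.2 - regression 𝕜 ρ z.1‖ₑ ^ 2 ∂ρ ≤ ENNReal.ofReal (σ ^ 2))
    {v : X → Y} (hv : AEStronglyMeasurable v ρ.fst) {C : ℝ} (hC : ∀ x, ‖v x‖ ≤ C) :
    ∫ z, RCLike.re ⟪v z.1, z.2 - regression 𝕜 ρ z.1⟫_𝕜 ∂ρ = 0 := by
  let : NormedSpace ℝ Y := NormedSpace.restrictScalars ℝ 𝕜 Y
  have hint := integrable_inner_noise hreg hnoise hv hC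
  have hn := (memLp_noise hreg hnoise).integrable one_le_two
  -- Disintegrating over `x`, the vector `v x` is constant in the inner integral, and the noise has
  -- conditional mean zero by the definition of `regression`.
  rw [← Measure.integral_condKernel hint]
  refine integral_eq_zero_of_ae ?_
  filter_upwards [hn.condKernel_ae] with x hx
  have hy : Integrable (fun y : Y => y) (ρ.condKernel x) :=
    (hx.add (integrable_const (regression 𝕜 ρ x))).congr
      (Filter.Eventually.of_forall fun y => sub_add_cancel _ _)
  rw [integral_re (hx.const_inner _), integral_inner hx, integral_sub hy (integrable_const _),
    integral_const]
  simp [regression]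

end Noise

/-! ### One step of the scheme -/

/-- A centred perturbation adds its second moment, and that of `m - ξ` is at most that of `ξ`. Only
weak means are assumed: the square is dominated pointwise by an integrable function plus a linear
functional of `m - ξ`, whose integral vanishes. -/
theorem lintegral_norm_sq_add_le {𝕜 Z H E : Type*} [RCLike 𝕜] [MeasurableSpace Z]
    [NormedAddCommGroup H] [InnerProductSpace 𝕜 H] [CompleteSpace H]
    [NormedAddCommGroup E] [InnerProductSpace 𝕜 E] [CompleteSpace E]
    {ρ : Measure Z} [IsProbabilityMeasure ρ] {ξ : Z → H} {m : H} {g : Z → ℝ}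
    (hg : Integrable g ρ) (hξg : ∀ z, ‖ξ z‖ ^ 2 ≤ g z)
    (hint : ∀ v : H, Integrable (fun z => RCLike.re ⟪v, ξ z⟫_𝕜) ρ)
    (hmean : ∀ v : H, ∫ z, RCLike.re ⟪v, ξ z⟫_𝕜 ∂ρ = RCLike.re ⟪v, m⟫_𝕜)
    (R : H →L[𝕜] E) (a : E) (η : ℝ) :
    ∫⁻ z, ‖a + (η : 𝕜) • R (m - ξ z)‖ₑ ^ 2 ∂ρ ≤
      ENNReal.ofReal (‖a‖ ^ 2 + η ^ 2 * (‖R‖ ^ 2 * ∫ z, g z ∂ρ)) := by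
  set v := R.adjoint a with hv
  -- The first summand of `w` reproduces the cross term with `a`; the second is the linear term left
  -- when `‖m - ξ‖²` is replaced by `‖ξ‖²` and `-‖m‖²` is dropped.
  set w : H := ((2 * η : ℝ) : 𝕜) • v + ((2 * (η ^ 2 * ‖R‖ ^ 2) : ℝ) : 𝕜) • m with hw
  have hpt : ∀ z, ‖a + (η : 𝕜) • R (m - ξ z)‖ ^ 2 ≤
      ‖a‖ ^ 2 + η ^ 2 * ‖R‖ ^ 2 * g z + (RCLike.re ⟪w, m⟫_𝕜 - RCLike.re ⟪w, ξ z⟫_𝕜) := by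
    intro z
    set b := m - ξ z with hb
    have h1 : RCLike.re ⟪w, m⟫_𝕜 - RCLike.re ⟪w, ξ z⟫_𝕜 = RCLike.re ⟪w, b⟫_𝕜 := by
      rw [hb, inner_sub_right, map_sub]
    have h2 : RCLike.re ⟪w, b⟫_𝕜 =
        2 * η * RCLike.re ⟪a, R b⟫_𝕜 + 2 * (η ^ 2 * ‖R‖ ^ 2) * RCLike.re ⟪m, b⟫_𝕜 := by
      rw [hw, inner_add_left, inner_smul_left, inner_smul_left, map_add, RCLike.conj_ofReal,
        RCLike.conj_ofReal, RCLike.re_ofReal_mul, RCLike.re_ofReal_mul, hv,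
        ContinuousLinearMap.adjoint_inner_left]
    have h3 : ‖ξ z‖ ^ 2 = ‖m‖ ^ 2 - 2 * RCLike.re ⟪m, b⟫_𝕜 + ‖b‖ ^ 2 := by
      rw [show ξ z = m - b by rw [hb, sub_sub_cancel], @norm_sub_sq 𝕜]
    have h4 : ‖a + (η : 𝕜) • R b‖ ^ 2 =
        ‖a‖ ^ 2 + 2 * η * RCLike.re ⟪a, R b⟫_𝕜 + η ^ 2 * ‖R b‖ ^ 2 := by
      rw [@norm_add_sq 𝕜, inner_smul_right, RCLike.re_ofReal_mul, norm_smul, RCLike.norm_ofReal,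
        mul_pow, sq_abs]
      ring
    have h5 : ‖R b‖ ^ 2 ≤ ‖R‖ ^ 2 * ‖b‖ ^ 2 := by
      rw [← mul_pow]
      exact pow_le_pow_left₀ (norm_nonneg _) (R.le_opNorm b) 2
    have h6 : ‖b‖ ^ 2 ≤ g z + 2 * RCLike.re ⟪m, b⟫_𝕜 := by
      nlinarith [hξg z, sq_nonneg ‖m‖]
    rw [h1, h2, h4]
    have h7 : η ^ 2 * ‖R b‖ ^ 2 ≤ η ^ 2 * (‖R‖ ^ 2 * (g z + 2 * RCLike.re ⟪m, b⟫_𝕜)) := by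
      gcongr
      exact h5.trans (by gcongr)
    linarith
  have hI1 : Integrable (fun z => ‖a‖ ^ 2 + η ^ 2 * ‖R‖ ^ 2 * g z) ρ :=
    (integrable_const _).add (hg.const_mul _)
  have hI2 : Integrable (fun z => RCLike.re ⟪w, m⟫_𝕜 - RCLike.re ⟪w, ξ z⟫_𝕜) ρ :=
    (integrable_const _).sub (hint w)
  calc _ ≤ ∫⁻ z, ENNReal.ofReal (‖a‖ ^ 2 + η ^ 2 * ‖R‖ ^ 2 * g z +
          (RCLike.re ⟪w, m⟫_𝕜 - RCLike.re ⟪w, ξ z⟫_𝕜)) ∂ρ := by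
        refine lintegral_mono fun z => ?_
        rw [← ofReal_norm, ← ENNReal.ofReal_pow (norm_nonneg _)]
        exact ENNReal.ofReal_le_ofReal (hpt z)
    _ = ENNReal.ofReal (∫ z, (‖a‖ ^ 2 + η ^ 2 * ‖R‖ ^ 2 * g z +
          (RCLike.re ⟪w, m⟫_𝕜 - RCLike.re ⟪w, ξ z⟫_𝕜)) ∂ρ) :=
        (ofReal_integral_eq_lintegral_ofReal (hI1.add hI2)
          (Filter.Eventually.of_forall fun z => (sq_nonneg _).trans (hpt z))).symm
    _ = _ := by
        rw [integral_add hI1 hI2, integral_add (integrable_const _) (hg.const_mul _),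
          integral_sub (integrable_const _) (hint w), hmean, integral_const_mul]
        simp [mul_assoc]

/-- Splitting `h(x) - y` at the regression value separates the current `L²` error from the noise. -/
theorem norm_gradient_sq_le {𝕜 X Y : Type*} [RCLike 𝕜] [TopologicalSpace X] [MeasurableSpace X]
    [NormedAddCommGroup Y] [InnerProductSpace 𝕜 Y] [CompleteSpace Y] [SecondCountableTopology Y]
    [MeasurableSpace Y] [BorelSpace Y] {K : Matrix X X (Y →L[𝕜] Y)} [Fact K.PosSemidef] {κ : ℝ}
    {ρ : Measure (X × Y)} [IsProbabilityMeasure ρ] (hK : IsBoundedMercer K κ)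
    (h : RKHS.OfKernel K) (z : X × Y) :
    ‖RKHS.kerFun (RKHS.OfKernel K) z.1 (h z.1 - z.2)‖ ^ 2 ≤
      2 * κ ^ 2 * (‖h z.1 - regression 𝕜 ρ z.1‖ ^ 2 + ‖z.2 - regression 𝕜 ρ z.1‖ ^ 2) := by
  have h1 := hK.norm_kerFun_le z.1 (h z.1 - z.2)
  have h2 : ‖h z.1 - z.2‖ ≤ ‖h z.1 - regression 𝕜 ρ z.1‖ + ‖z.2 - regression 𝕜 ρ z.1‖ := by
    rw [← sub_sub_sub_cancel_right (h z.1) z.2 (regression 𝕜 ρ z.1)]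
    exact norm_sub_le _ _
  set p := ‖h z.1 - regression 𝕜 ρ z.1‖
  set q := ‖z.2 - regression 𝕜 ρ z.1‖
  calc _ ≤ (|κ| * (p + q)) ^ 2 := by gcongr; exact h1.trans (by gcongr)
    _ = κ ^ 2 * (p + q) ^ 2 := by rw [mul_pow, sq_abs]
    _ ≤ κ ^ 2 * (2 * (p ^ 2 + q ^ 2)) := by
      gcongr
      nlinarith [sq_nonneg (p - q)]
    _ = _ := by ring

section Scheme

variable {𝕜 X Y : Type*} [RCLike 𝕜]
  [TopologicalSpace X] [MeasurableSpace X] [BorelSpace X]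
  [NormedAddCommGroup Y] [InnerProductSpace 𝕜 Y] [CompleteSpace Y] [SecondCountableTopology Y]
  [MeasurableSpace Y] [BorelSpace Y]
  {K : Matrix X X (Y →L[𝕜] Y)} [Fact K.PosSemidef] {κ : ℝ}
  {ρ : Measure (X × Y)} [IsProbabilityMeasure ρ] {σ : ℝ}

/-- The bias `ι h - h†` of `h` as an element of `L²`. -/
noncomputable def residual (hK : IsBoundedMercer K κ) (hreg : MemLp (regression 𝕜 ρ) 2 ρ.fst)
    (h : RKHS.OfKernel K) : Lp Y 2 ρ.fst :=
  embed hK ρ.fst h - hreg.toLp (regression 𝕜 ρ)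

theorem residual_ae_eq (hK : IsBoundedMercer K κ) (hreg : MemLp (regression 𝕜 ρ) 2 ρ.fst)
    (h : RKHS.OfKernel K) :
    residual hK hreg h =ᵐ[ρ.fst] fun x => h x - regression 𝕜 ρ x := by
  filter_upwards [embed_ae_eq hK ρ.fst h, hreg.coeFn_toLp, Lp.coeFn_sub (embed hK ρ.fst h)
    (hreg.toLp (regression 𝕜 ρ))] with x h1 h2 h3
  rw [residual, h3, Pi.sub_apply, h1, h2]

theorem memLp_residual (hK : IsBoundedMercer K κ) (hreg : MemLp (regression 𝕜 ρ) 2 ρ.fst)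
    (h : RKHS.OfKernel K) :
    MemLp (fun x => h x - regression 𝕜 ρ x) 2 ρ.fst :=
  (hK.memLp ρ.fst h).sub hreg

theorem integral_residual_sq (hK : IsBoundedMercer K κ) (hreg : MemLp (regression 𝕜 ρ) 2 ρ.fst)
    (h : RKHS.OfKernel K) :
    ∫ z, ‖h z.1 - regression 𝕜 ρ z.1‖ ^ 2 ∂ρ = ‖residual hK hreg h‖ ^ 2 := by
  have h1 : ∫ z, ‖h z.1 - regression 𝕜 ρ z.1‖ ^ 2 ∂ρ =
      ∫ x, ‖h x - regression 𝕜 ρ x‖ ^ 2 ∂ρ.fst := by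
    rw [Measure.fst, integral_map measurable_fst.aemeasurable]
    exact ((memLp_residual hK hreg h).1.norm.pow 2)
  have h2 : ⟪residual hK hreg h, residual hK hreg h⟫_𝕜 =
      ∫ x, ((‖h x - regression 𝕜 ρ x‖ ^ 2 : ℝ) : 𝕜) ∂ρ.fst := by
    rw [L2.inner_def]
    refine integral_congr_ae ?_
    filter_upwards [residual_ae_eq hK hreg h] with x hx
    rw [hx, inner_self_eq_norm_sq_to_K]
    push_cast
    rfl
  rw [h1, ← inner_self_eq_norm_sq (𝕜 := 𝕜), h2, integral_ofReal, RCLike.ofReal_re]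

/-- By the reproducing property, pairing the gradient with `v` gives `⟪v x, h x - y⟫`. Its noise
part integrates to zero, and the remainder is the pairing of `ι v` with the residual in `L²`. -/
theorem integrable_inner_gradient (hK : IsBoundedMercer K κ) (hreg : MemLp (regression 𝕜 ρ) 2 ρ.fst)
    (hnoise : ∫⁻ z, ‖z.2 - regression 𝕜 ρ z.1‖ₑ ^ 2 ∂ρ ≤ ENNReal.ofReal (σ ^ 2))
    (h v : RKHS.OfKernel K) :
    Integrable (fun z : X × Y => RCLike.re
      ⟪v, RKHS.kerFun (RKHS.OfKernel K) z.1 (h z.1 - z.2)⟫_𝕜) ρ ∧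
    ∫ z, RCLike.re ⟪v, RKHS.kerFun (RKHS.OfKernel K) z.1 (h z.1 - z.2)⟫_𝕜 ∂ρ =
      RCLike.re ⟪v, (embed hK ρ.fst).adjoint (residual hK hreg h)⟫_𝕜 := by
  have hv := (hK.continuous v).aestronglyMeasurable (μ := ρ.fst)
  have hC := hK.norm_apply_le v
  have hn := integrable_inner_noise hreg hnoise hv hC
  have hn0 := integral_inner_noise hreg hnoise hv hC
  have hd := memLp_residual hK hreg h
  have hdi : Integrable (fun x => ⟪v x, h x - regression 𝕜 ρ x⟫_𝕜) ρ.fst := by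
    refine Integrable.mono' ((hd.integrable one_le_two).norm.const_mul (|κ| * ‖v‖))
      (hv.inner hd.1) (Filter.Eventually.of_forall fun x => (norm_inner_le_norm _ _).trans ?_)
    gcongr
    exact hC x
  have hdi' : Integrable (fun z : X × Y => RCLike.re ⟪v z.1, h z.1 - regression 𝕜 ρ z.1⟫_𝕜) ρ :=
    (measurePreserving_fst.integrable_comp_of_integrable hdi).re
  have heq : ∀ z : X × Y, RCLike.re ⟪v, RKHS.kerFun (RKHS.OfKernel K) z.1 (h z.1 - z.2)⟫_𝕜 =
      RCLike.re ⟪v z.1, h z.1 - regression 𝕜 ρ z.1⟫_𝕜 -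
        RCLike.re ⟪v z.1, z.2 - regression 𝕜 ρ z.1⟫_𝕜 := fun z => by
    rw [RKHS.inner_kerFun, ← map_sub, ← inner_sub_right, sub_sub_sub_cancel_right]
  simp_rw [heq]
  refine ⟨hdi'.sub hn, ?_⟩
  rw [integral_sub hdi' hn, hn0, sub_zero, ContinuousLinearMap.adjoint_inner_right, L2.inner_def]
  have h1 : ∫ z, RCLike.re ⟪v z.1, h z.1 - regression 𝕜 ρ z.1⟫_𝕜 ∂ρ =
      ∫ x, RCLike.re ⟪v x, h x - regression 𝕜 ρ x⟫_𝕜 ∂ρ.fst := by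
    rw [Measure.fst, integral_map measurable_fst.aemeasurable]
    exact hdi.re.1
  rw [h1, integral_re hdi]
  congr 1
  refine integral_congr_ae ?_
  filter_upwards [embed_ae_eq hK ρ.fst v, residual_ae_eq hK hreg h] with x h1 h2
  rw [h1, h2]

/-- One step of the scheme, for the quantity `S (D h - q)` with `D ι^* (ι h - h†) = A (D h - q)`. -/
theorem lintegral_step_le (hK : IsBoundedMercer K κ) (hreg : MemLp (regression 𝕜 ρ) 2 ρ.fst)
    (hnoise : ∫⁻ z, ‖z.2 - regression 𝕜 ρ z.1‖ₑ ^ 2 ∂ρ ≤ ENNReal.ofReal (σ ^ 2))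
    {E : Type*} [NormedAddCommGroup E] [InnerProductSpace 𝕜 E]
    [CompleteSpace E] (D : RKHS.OfKernel K →L[𝕜] E) (q : E) (A S : E →L[𝕜] E)
    (hD : ∀ h, D ((embed hK ρ.fst).adjoint (residual hK hreg h)) = A (D h - q))
    (h : RKHS.OfKernel K) (η : ℝ) :
    ∫⁻ z : X × Y, ‖S (D (h - (η : 𝕜) • RKHS.kerFun (RKHS.OfKernel K) z.1 (h z.1 - z.2)) - q)‖ₑ ^ 2
        ∂ρ ≤
      ENNReal.ofReal (‖S (D h - q - (η : 𝕜) • A (D h - q))‖ ^ 2 +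
        η ^ 2 * ‖S ∘L D‖ ^ 2 * (2 * κ ^ 2 * (‖residual hK hreg h‖ ^ 2 + σ ^ 2))) := by
  set m := (embed hK ρ.fst).adjoint (residual hK hreg h) with hm
  set g : X × Y → ℝ := fun z =>
    2 * κ ^ 2 * (‖h z.1 - regression 𝕜 ρ z.1‖ ^ 2 + ‖z.2 - regression 𝕜 ρ z.1‖ ^ 2) with hg
  have hI1 : Integrable (fun z : X × Y => ‖h z.1 - regression 𝕜 ρ z.1‖ ^ 2) ρ :=
    measurePreserving_fst.integrable_comp_of_integrable
      ((memLp_residual hK hreg h).integrable_norm_pow two_ne_zero)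
  have hI2 : Integrable (fun z : X × Y => ‖z.2 - regression 𝕜 ρ z.1‖ ^ 2) ρ :=
    (memLp_noise hreg hnoise).integrable_norm_pow two_ne_zero
  have hgI : Integrable g ρ := (hI1.add hI2).const_mul _
  have hgle : ∫ z, g z ∂ρ ≤ 2 * κ ^ 2 * (‖residual hK hreg h‖ ^ 2 + σ ^ 2) := by
    rw [hg, integral_const_mul, integral_add hI1 hI2, integral_residual_sq hK hreg h]
    gcongr
    exact integral_noise_sq_le hreg hnoise
  have key := lintegral_norm_sq_add_le hgI (norm_gradient_sq_le hK h)
    (fun v => (integrable_inner_gradient hK hreg hnoise h v).1)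
    (fun v => (integrable_inner_gradient hK hreg hnoise h v).2) (S ∘L D)
    (S (D h - q - (η : 𝕜) • A (D h - q))) η
  refine (le_of_eq (lintegral_congr fun z => ?_)).trans (key.trans (ENNReal.ofReal_le_ofReal ?_))
  · have hlin : ∀ m x : RKHS.OfKernel K, S (D (h - (η : 𝕜) • x) - q) =
        S (D h - q - (η : 𝕜) • D m) + (η : 𝕜) • S (D (m - x)) := fun m x => by
      simp only [map_sub, map_smul, smul_sub]
      abel
    congr 2
    rw [← hD, ContinuousLinearMap.comp_apply]
    exact hlin _ _
  · rw [mul_assoc]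
    gcongr

theorem polyAt_decayPoly_succ {E : Type*} [NormedAddCommGroup E] [InnerProductSpace 𝕜 E]
    (A : E →L[𝕜] E) (p : Polynomial ℝ) (c : ℝ) (u : E) :
    polyAt A (p * (1 - Polynomial.C c * Polynomial.X)) u = polyAt A p (u - (c : 𝕜) • A u) := by
  rw [polyAt_mul, polyAt_sub, polyAt_one, polyAt_mul, polyAt_C, polyAt_X]
  simp

theorem decayPoly_self (η : ℕ → ℝ) (T : ℕ) : decayPoly η T T = 1 := by
  rw [decayPoly, Finset.Icc_eq_empty (by omega), Finset.prod_empty]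

theorem decayPoly_succ (η : ℕ → ℝ) {t T : ℕ} (ht : t ≤ T) :
    decayPoly η t (T + 1) =
      decayPoly η t T * (1 - Polynomial.C (η (T + 1)) * Polynomial.X) := by
  rw [decayPoly, decayPoly, Finset.prod_Icc_succ_top (by omega)]

/-- The bias-variance decomposition of the iterates. -/
theorem lintegral_sgd_le [SecondCountableTopology X]
    (hK : IsBoundedMercer K κ) (hreg : MemLp (regression 𝕜 ρ) 2 ρ.fst)
    (hnoise : ∫⁻ z, ‖z.2 - regression 𝕜 ρ z.1‖ₑ ^ 2 ∂ρ ≤ ENNReal.ofReal (σ ^ 2))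
    {E : Type*} [NormedAddCommGroup E]
    [InnerProductSpace 𝕜 E]
    [CompleteSpace E] (D : RKHS.OfKernel K →L[𝕜] E) (q : E) (A : E →L[𝕜] E)
    (hD : ∀ h, D ((embed hK ρ.fst).adjoint (residual hK hreg h)) = A (D h - q))
    (η : ℕ → ℝ) {M : ℝ} (hM0 : 0 ≤ M) (T : ℕ)
    (hM : ∀ t < T, ∫⁻ z : Fin t → X × Y, ‖residual hK hreg (sgd K η t z)‖ₑ ^ 2
      ∂(Measure.pi fun _ => ρ) ≤ ENNReal.ofReal M) (p : Polynomial ℝ) :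
    ∫⁻ z : Fin T → X × Y, ‖polyAt A p (D (sgd K η T z) - q)‖ₑ ^ 2 ∂(Measure.pi fun _ => ρ) ≤
      ENNReal.ofReal (‖polyAt A (p * decayPoly η 0 T) q‖ ^ 2 + 2 * κ ^ 2 * (M + σ ^ 2) *
        ∑ t ∈ Finset.Icc 1 T, η t ^ 2 * ‖polyAt A (p * decayPoly η t T) ∘L D‖ ^ 2) := by
  -- Integrating out the last observation replaces `p` by `p (1 - η_{T+1} X)` applied to the
  -- previous iterate, so the induction hypothesis must hold for all polynomials.
  induction T generalizing p with
  | zero =>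
    simp only [sgd, map_zero, zero_sub, map_neg, enorm_neg, decayPoly_self, mul_one, lintegral_const,
      measure_univ, Finset.Icc_eq_empty (show ¬ 1 ≤ 0 by omega), Finset.sum_empty, mul_zero,
      add_zero]
    rw [ENNReal.ofReal_pow (norm_nonneg _), ofReal_norm]
  | succ T ih =>
    borelize (RKHS.OfKernel K)
    set c := η (T + 1) with hc
    set p' := p * (1 - Polynomial.C c * Polynomial.X) with hp'
    set b := c ^ 2 * ‖polyAt A p ∘L D‖ ^ 2 * (2 * κ ^ 2) with hb
    have hb0 : 0 ≤ b := by positivity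
    have hsgd := hK.measurable_sgd η T
    have h1 : ∀ h, ∫⁻ a : X × Y, ‖polyAt A p
        (D (h - (c : 𝕜) • RKHS.kerFun (RKHS.OfKernel K) a.1 (h a.1 - a.2)) - q)‖ₑ ^ 2 ∂ρ ≤
        ‖polyAt A p' (D h - q)‖ₑ ^ 2 +
          ENNReal.ofReal b * (‖residual hK hreg h‖ₑ ^ 2 + ENNReal.ofReal (σ ^ 2)) := fun h => by
      refine (lintegral_step_le hK hreg hnoise D q A (polyAt A p) hD h c).trans (le_of_eq ?_)
      rw [← polyAt_decayPoly_succ, ENNReal.ofReal_add (by positivity) (by positivity), ← mul_assoc,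
        ENNReal.ofReal_mul hb0, ENNReal.ofReal_add (by positivity) (by positivity),
        ENNReal.ofReal_pow (norm_nonneg _), ENNReal.ofReal_pow (norm_nonneg _), ofReal_norm,
        ofReal_norm]
    have hmeas : Measurable fun z : Fin T → X × Y =>
        ‖polyAt A p' (D (sgd K η T z) - q)‖ₑ ^ 2 := by
      have : Continuous fun h : RKHS.OfKernel K => ‖polyAt A p' (D h - q)‖ₑ := by fun_prop
      exact (this.measurable.comp hsgd).pow_const 2
    have h2 := ih (fun t ht => hM t (by omega)) p'
    have h3 := hM T (by omega)
    calc _ ≤ ∫⁻ z : Fin T → X × Y, ∫⁻ a, ‖polyAt A p (D (sgd K η T z - (c : 𝕜) •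
            RKHS.kerFun (RKHS.OfKernel K) a.1 (sgd K η T z a.1 - a.2)) - q)‖ₑ ^ 2 ∂ρ
              ∂(Measure.pi fun _ => ρ) := lintegral_pi_succ_le ρ T fun z a =>
            ‖polyAt A p (D (sgd K η T z - (c : 𝕜) •
            RKHS.kerFun (RKHS.OfKernel K) a.1 (sgd K η T z a.1 - a.2)) - q)‖ₑ ^ 2
      _ ≤ ∫⁻ z : Fin T → X × Y, (‖polyAt A p' (D (sgd K η T z) - q)‖ₑ ^ 2 +
            ENNReal.ofReal b * (‖residual hK hreg (sgd K η T z)‖ₑ ^ 2 + ENNReal.ofReal (σ ^ 2)))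
              ∂(Measure.pi fun _ => ρ) := lintegral_mono fun z => h1 _
      _ = ∫⁻ z : Fin T → X × Y, ‖polyAt A p' (D (sgd K η T z) - q)‖ₑ ^ 2
              ∂(Measure.pi fun _ => ρ) +
            ENNReal.ofReal b * (∫⁻ z : Fin T → X × Y, ‖residual hK hreg (sgd K η T z)‖ₑ ^ 2
              ∂(Measure.pi fun _ => ρ) + ENNReal.ofReal (σ ^ 2)) := by
          -- Additivity needs only the first summand measurable; the one with the residual is
          -- handled by a finite constant factor and a constant summand.
          rw [lintegral_add_left hmeas, lintegral_const_mul' _ _ ENNReal.ofReal_ne_top,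
            lintegral_add_right _ measurable_const, lintegral_const, measure_univ, mul_one]
      _ ≤ ENNReal.ofReal (‖polyAt A (p' * decayPoly η 0 T) q‖ ^ 2 + 2 * κ ^ 2 * (M + σ ^ 2) *
            ∑ t ∈ Finset.Icc 1 T, η t ^ 2 * ‖polyAt A (p' * decayPoly η t T) ∘L D‖ ^ 2) +
            ENNReal.ofReal b * (ENNReal.ofReal M + ENNReal.ofReal (σ ^ 2)) := by gcongr
      _ = _ := by
          rw [← ENNReal.ofReal_add hM0 (sq_nonneg σ), ← ENNReal.ofReal_mul hb0,
            ← ENNReal.ofReal_add (by positivity) (by positivity),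
            Finset.sum_Icc_succ_top (by omega), decayPoly_self, mul_one]
          have h4 : ∀ t ≤ T, p' * decayPoly η t T = p * decayPoly η t (T + 1) := fun t ht => by
            rw [decayPoly_succ η ht, hp']
            ring
          rw [h4 0 (by omega), Finset.sum_congr rfl fun t ht => by
            rw [h4 t (Finset.mem_Icc.1 ht).2]]
          congr 1
          rw [hb]
          ring

end Scheme

/-! ### Operator bounds for the products `∏ (1 - η_j A)` -/

section OperatorBounds

variable {𝕜 E : Type*} [RCLike 𝕜] [NormedAddCommGroup E] [InnerProductSpace 𝕜 E]

theorem abs_decayPoly_eval_le_exp {A : E →L[𝕜] E} {η : ℕ → ℝ} {T : ℕ}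
    (hη : ∀ j ∈ Finset.Icc 1 T, 0 ≤ η j ∧ η j * ‖A‖ ≤ 1) (t : ℕ) {x : ℝ}
    (hx : x ∈ Icc (0 : ℝ) ‖A‖) :
    |(decayPoly η t T).eval x| ≤ Real.exp (-(x * ∑ j ∈ Finset.Icc (t + 1) T, η j)) :=
  abs_decayPoly_eval_le fun j hj => by
    have hj' := Finset.mem_Icc.1 hj
    have := hη j (Finset.mem_Icc.2 ⟨by omega, hj'.2⟩)
    exact (mul_le_mul_of_nonneg_left hx.2 this.1).trans this.2

variable [CompleteSpace E]

theorem tail_nonneg {η : ℕ → ℝ} {T : ℕ} (hη : ∀ j ∈ Finset.Icc 1 T, 0 ≤ η j) (t : ℕ) :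
    0 ≤ ∑ j ∈ Finset.Icc (t + 1) T, η j :=
  Finset.sum_nonneg fun j hj => hη j (Finset.mem_Icc.2
    ⟨by have := Finset.mem_Icc.1 hj; omega, (Finset.mem_Icc.1 hj).2⟩)

theorem norm_polyAt_decayPoly_le_one {A : E →L[𝕜] E} (hA : A.IsPositive) {η : ℕ → ℝ} {T : ℕ}
    (hη : ∀ j ∈ Finset.Icc 1 T, 0 ≤ η j ∧ η j * ‖A‖ ≤ 1) (t : ℕ) :
    ‖polyAt A (decayPoly η t T)‖ ≤ 1 := by
  refine norm_aeval_le hA _ fun x hx => (abs_decayPoly_eval_le_exp hη t hx).trans ?_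
  rw [Real.exp_le_one_iff, neg_nonpos]
  exact mul_nonneg hx.1 (tail_nonneg (fun j hj => (hη j hj).1) t)

theorem norm_polyAt_mul_opRPow_le {A : E →L[𝕜] E} (hA : A.IsPositive) (p : Polynomial ℝ) {s c : ℝ}
    (hs : 0 ≤ s) (hc : ∀ x ∈ Icc (0 : ℝ) ‖A‖, |p.eval x * x ^ s| ≤ c) :
    ‖polyAt A p * opRPow A s‖ ≤ c := by
  have h1 := continuousOn_rpow_Icc (b := ‖A‖) hs
  have h2 : ContinuousOn (fun x => p.eval x) (Icc 0 ‖A‖) := p.continuous.continuousOn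
  rw [← fc_eval hA, opRPow_eq_fc, ← fc_mul hA h2 h1]
  exact norm_fc_le hA (h2.mul h1) hc

theorem norm_decay_mul_opRPow_sq_le {A : E →L[𝕜] E} (hA : A.IsPositive) {b : ℝ} (hb : ‖A‖ ≤ b)
    {η : ℕ → ℝ} {T : ℕ} (hη : ∀ j ∈ Finset.Icc 1 T, 0 ≤ η j ∧ η j * ‖A‖ ≤ 1) (t : ℕ) {s : ℝ}
    (hs0 : 0 ≤ s) (hs1 : s ≤ 1) :
    ‖polyAt A (decayPoly η t T) * opRPow A (s / 2)‖ ^ 2 ≤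
      ((1 + 2 * b) / 2) ^ s / (1 + ∑ j ∈ Finset.Icc (t + 1) T, η j) ^ s := by
  have hb0 : 0 ≤ b := (norm_nonneg _).trans hb
  have hS := tail_nonneg (fun j hj => (hη j hj).1) t
  refine (Real.le_sqrt (norm_nonneg _) (by positivity)).1 ?_
  refine norm_polyAt_mul_opRPow_le hA _ (by positivity) fun x hx => Real.abs_le_sqrt ?_
  refine le_trans ?_ (rpow_mul_exp_sq_le hx.1 (hx.2.trans hb) hS hs0 hs1)
  rw [← sq_abs, abs_mul, abs_of_nonneg (Real.rpow_nonneg hx.1 _), mul_comm]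
  have := abs_decayPoly_eval_le_exp hη t hx
  have := Real.rpow_nonneg hx.1 (s / 2)
  gcongr

theorem norm_decay_mul_opRPow_le {A : E →L[𝕜] E} (hA : A.IsPositive)
    {η : ℕ → ℝ} {T : ℕ} (hη : ∀ j ∈ Finset.Icc 1 T, 0 ≤ η j ∧ η j * ‖A‖ ≤ 1) {s : ℝ} (hs : 0 < s)
    (hS : 0 < ∑ j ∈ Finset.Icc 1 T, η j) :
    ‖polyAt A (decayPoly η 0 T) * opRPow A s‖ ≤ s ^ s * (∑ j ∈ Finset.Icc 1 T, η j) ^ (-s) := by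
  refine norm_polyAt_mul_opRPow_le hA _ hs.le fun x hx => ?_
  refine le_trans ?_ (rpow_mul_exp_le hx.1 hS hs)
  have h1 := abs_decayPoly_eval_le_exp hη 0 hx
  have := Real.rpow_nonneg hx.1 s
  rw [abs_mul, abs_of_nonneg this, mul_comm]
  gcongr

theorem opRPow_apply_opRPow {A : E →L[𝕜] E} (hA : A.IsPositive) {a b c : ℝ} (ha : 0 ≤ a)
    (hb : 0 ≤ b) (hc : a + b = c) (x : E) : opRPow A a (opRPow A b x) = opRPow A c x := by
  rw [opRPow_eq_fc, opRPow_eq_fc, opRPow_eq_fc]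
  refine fc_comp_apply hA (continuousOn_rpow_Icc ha) (continuousOn_rpow_Icc hb) (fun y hy => ?_) x
  rw [← hc, Real.rpow_add_of_nonneg hy.1 ha hb]

theorem opRPow_one {A : E →L[𝕜] E} (hA : A.IsPositive) : opRPow A 1 = A := by
  have h := fc_eval hA Polynomial.X
  rw [polyAt_X] at h
  conv_rhs => rw [← h]
  exact fc_congr fun x _ => by simp

end OperatorBounds

/-! ### Uniform boundedness of the mean square error and reduction to scalar sums -/

section Scheme

variable {𝕜 X Y : Type*} [RCLike 𝕜]
  [TopologicalSpace X] [MeasurableSpace X] [BorelSpace X]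
  [NormedAddCommGroup Y] [InnerProductSpace 𝕜 Y] [CompleteSpace Y] [SecondCountableTopology Y]
  {K : Matrix X X (Y →L[𝕜] Y)} [Fact K.PosSemidef] {κ : ℝ}

theorem norm_integralOp_le (hK : IsBoundedMercer K κ) (μ : Measure X) [IsProbabilityMeasure μ] :
    ‖integralOp hK μ‖ ≤ κ ^ 2 := by
  have h1 : ‖embed hK μ‖ ≤ |κ| := LinearMap.mkContinuous_norm_le _ (abs_nonneg κ) _
  refine (ContinuousLinearMap.opNorm_comp_le _ _).trans ?_
  rw [LinearIsometryEquiv.norm_map, ← sq_abs, sq]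
  gcongr

variable [MeasurableSpace Y] [BorelSpace Y]
  {ρ : Measure (X × Y)} [IsProbabilityMeasure ρ] {σ : ℝ}

/-- The mean square error of the iterates in `L²` stays bounded. -/
theorem lintegral_residual_sq_le [SecondCountableTopology X] (hκ : 0 < κ)
    (hK : IsBoundedMercer K κ) (hreg : MemLp (regression 𝕜 ρ) 2 ρ.fst)
    (hnoise : ∫⁻ z, ‖z.2 - regression 𝕜 ρ z.1‖ₑ ^ 2 ∂ρ ≤ ENNReal.ofReal (σ ^ 2))
    {η : ℕ → ℝ} {T : ℕ}
    (hη : ∀ j ∈ Finset.Icc 1 T, 0 ≤ η j ∧ η j * ‖integralOp hK ρ.fst‖ ≤ 1)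
    (hstab : ∀ n ≤ T, ∑ t ∈ Finset.Icc 1 n, η t ^ 2 / (1 + ∑ j ∈ Finset.Icc (t + 1) n, η j) ≤
      1 / (4 * κ ^ 2 * (1 + 2 * κ ^ 2))) (n : ℕ) (hn : n ≤ T) :
    ∫⁻ z : Fin n → X × Y, ‖residual hK hreg (sgd K η n z)‖ₑ ^ 2 ∂(Measure.pi fun _ => ρ) ≤
      ENNReal.ofReal (2 * (‖hreg.toLp (regression 𝕜 ρ)‖ ^ 2 + σ ^ 2)) := by
  set A := integralOp hK ρ.fst with hAdef
  have hA : A.IsPositive := isPositive_integralOp hK ρ.fst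
  have hAn : ‖A‖ ≤ κ ^ 2 := norm_integralOp_le hK ρ.fst
  obtain ⟨U, hU1, hU2, -⟩ := exists_polar (embed hK ρ.fst)
  set f := hreg.toLp (regression 𝕜 ρ) with hf
  set M := 2 * (‖f‖ ^ 2 + σ ^ 2) with hM
  induction n using Nat.strong_induction_on with
  | _ n ih =>
  have hηn : ∀ j ∈ Finset.Icc 1 n, 0 ≤ η j ∧ η j * ‖A‖ ≤ 1 := fun j hj =>
    hη j (Finset.mem_Icc.2 ⟨(Finset.mem_Icc.1 hj).1, (Finset.mem_Icc.1 hj).2.trans hn⟩)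
  -- With `D = ι` and `q = h†`, the required intertwining relation is the definition `A = ι ι^*`.
  have key := lintegral_sgd_le hK hreg hnoise (embed hK ρ.fst) f A (fun h => rfl) η
    (M := M) (by positivity) n (fun t ht => ih t ht (by omega)) 1
  simp only [one_mul, polyAt_one] at key
  refine key.trans (ENNReal.ofReal_le_ofReal ?_)
  have h1 : ‖polyAt A (decayPoly η 0 n) f‖ ^ 2 ≤ ‖f‖ ^ 2 := by
    have := ContinuousLinearMap.le_of_opNorm_le _ (norm_polyAt_decayPoly_le_one hA hηn 0) f
    rw [one_mul] at this
    gcongr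
  have h2 : ∀ t ∈ Finset.Icc 1 n, η t ^ 2 * ‖polyAt A (decayPoly η t n) ∘L embed hK ρ.fst‖ ^ 2 ≤
      (1 + 2 * κ ^ 2) / 2 * (η t ^ 2 / (1 + ∑ j ∈ Finset.Icc (t + 1) n, η j)) := by
    intro t _
    have h3 := norm_decay_mul_opRPow_sq_le hA hAn hηn t zero_le_one le_rfl
    rw [Real.rpow_one, Real.rpow_one] at h3
    have h4 : ‖polyAt A (decayPoly η t n) ∘L embed hK ρ.fst‖ ≤
        ‖polyAt A (decayPoly η t n) * opRPow A (1 / 2)‖ := by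
      conv_lhs => rw [← hU2]
      calc _ = ‖(polyAt A (decayPoly η t n) * opRPow A (1 / 2)) ∘L U‖ := rfl
        _ ≤ ‖polyAt A (decayPoly η t n) * opRPow A (1 / 2)‖ * ‖U‖ :=
          ContinuousLinearMap.opNorm_comp_le _ _
        _ ≤ _ := mul_le_of_le_one_right (norm_nonneg _) hU1
    calc _ ≤ η t ^ 2 * ((1 + 2 * κ ^ 2) / 2 / (1 + ∑ j ∈ Finset.Icc (t + 1) n, η j)) := by
          gcongr
          exact (pow_le_pow_left₀ (norm_nonneg _) h4 2).trans h3
      _ = _ := by ring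
  have h5 := Finset.sum_le_sum h2
  rw [← Finset.mul_sum] at h5
  have h6 : 2 * κ ^ 2 * (M + σ ^ 2) *
      ∑ t ∈ Finset.Icc 1 n, η t ^ 2 * ‖polyAt A (decayPoly η t n) ∘L embed hK ρ.fst‖ ^ 2 ≤
      (M + σ ^ 2) / 4 := by
    calc _ ≤ 2 * κ ^ 2 * (M + σ ^ 2) *
          ((1 + 2 * κ ^ 2) / 2 * (1 / (4 * κ ^ 2 * (1 + 2 * κ ^ 2)))) := by
          gcongr
          exact h5.trans (mul_le_mul_of_nonneg_left (hstab n hn) (by positivity))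
      _ = _ := by field_simp
  -- The induction closes since `‖f‖² + (M + σ²)/4 ≤ M` for `M = 2 (‖f‖² + σ²)`.
  nlinarith [sq_nonneg ‖f‖, sq_nonneg σ]

/-- The misspecification error is bounded by the bias and variance sums of the step sizes. -/
theorem exists_misspecError_le [SecondCountableTopology X] (hκ : 0 < κ)
    (hK : IsBoundedMercer K κ) (hreg : MemLp (regression 𝕜 ρ) 2 ρ.fst)
    (hnoise : ∫⁻ z, ‖z.2 - regression 𝕜 ρ z.1‖ₑ ^ 2 ∂ρ ≤ ENNReal.ofReal (σ ^ 2))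
    {β r : ℝ} (hβ0 : 0 < β) (hβ1 : β < 1) (hr : β / 2 < r) (g : Lp Y 2 ρ.fst)
    (hsource : hreg.toLp (regression 𝕜 ρ) = opRPow (integralOp hK ρ.fst) r g) :
    ∃ C : ℝ, 0 < C ∧ ∀ (η : ℕ → ℝ) (T : ℕ),
      (∀ j ∈ Finset.Icc 1 T, 0 ≤ η j ∧ η j * ‖integralOp hK ρ.fst‖ ≤ 1) →
      (∀ n ≤ T, ∑ t ∈ Finset.Icc 1 n, η t ^ 2 / (1 + ∑ j ∈ Finset.Icc (t + 1) n, η j) ≤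
        1 / (4 * κ ^ 2 * (1 + 2 * κ ^ 2))) →
      0 < ∑ j ∈ Finset.Icc 1 T, η j →
      misspecError hK ρ (hreg.toLp (regression 𝕜 ρ)) β η T ≤
        ENNReal.ofReal (C * ((∑ j ∈ Finset.Icc 1 T, η j) ^ (-(2 * r - β)) +
          ∑ t ∈ Finset.Icc 1 T, η t ^ 2 / (1 + ∑ j ∈ Finset.Icc (t + 1) T, η j) ^ (1 - β))) := by
  set A := integralOp hK ρ.fst with hAdef
  have hA : A.IsPositive := isPositive_integralOp hK ρ.fst
  have hAn : ‖A‖ ≤ κ ^ 2 := norm_integralOp_le hK ρ.fst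
  obtain ⟨U, hU1, hU2, hU3⟩ := exists_polar (embed hK ρ.fst)
  set f := hreg.toLp (regression 𝕜 ρ) with hf
  set M := 2 * (‖f‖ ^ 2 + σ ^ 2) with hM
  set s := r - β / 2 with hs
  have hs0 : 0 < s := by linarith
  -- The half power in `ι = A^{1/2} U` is divided: `A^{β/2}` goes to the interpolation norm, and
  -- `A^{(1-β)/2}` stays in `D` to damp the variance.
  set D : RKHS.OfKernel K →L[𝕜] Lp Y 2 ρ.fst := opRPow A ((1 - β) / 2) ∘L U with hDdef
  set q := opRPow A s g with hq
  set B := 1 / (1 - β) + 1 / β with hB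
  have hβ1' : 0 < 1 - β := by linarith
  have hB0 : 0 < B := by positivity
  have hres : ∀ h, residual hK hreg h = opRPow A (β / 2) (D h - q) := fun h => by
    rw [map_sub, hDdef, ContinuousLinearMap.comp_apply,
      opRPow_apply_opRPow hA (c := 1 / 2) (by positivity) (by positivity) (by ring), hq,
      opRPow_apply_opRPow hA (c := r) (by positivity) hs0.le (by rw [hs]; ring), ← hsource]
    have : opRPow A (1 / 2) (U h) = embed hK ρ.fst h :=
      congrArg (fun F : RKHS.OfKernel K →L[𝕜] Lp Y 2 ρ.fst => F h) hU2
    rw [this]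
    rfl
  have hD : ∀ h, D ((embed hK ρ.fst).adjoint (residual hK hreg h)) = A (D h - q) := fun h => by
    have h1 : ∀ w, U ((embed hK ρ.fst).adjoint w) = opRPow A (1 / 2) w := fun w =>
      congrArg (fun F : Lp Y 2 ρ.fst →L[𝕜] Lp Y 2 ρ.fst => F w) hU3
    rw [hDdef, ContinuousLinearMap.comp_apply, h1, hres,
      opRPow_apply_opRPow hA (c := 1 - β / 2) (by positivity) (by positivity) (by ring),
      opRPow_apply_opRPow hA (c := 1) (by linarith) (by positivity) (by ring), opRPow_one hA]
  -- The sum of the bias and variance constants; the `1` keeps it positive when both vanish.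
  refine ⟨B * ((s ^ s) ^ 2 * ‖g‖ ^ 2) +
    B * (2 * κ ^ 2 * (M + σ ^ 2) * ((1 + 2 * κ ^ 2) / 2) ^ (1 - β)) + 1, by positivity,
    fun η T hη hstab hS => ?_⟩
  set S := ∑ j ∈ Finset.Icc 1 T, η j with hSdef
  set V := ∑ t ∈ Finset.Icc 1 T, η t ^ 2 / (1 + ∑ j ∈ Finset.Icc (t + 1) T, η j) ^ (1 - β) with hV
  have hM' : ∀ t < T, ∫⁻ z : Fin t → X × Y, ‖residual hK hreg (sgd K η t z)‖ₑ ^ 2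
      ∂(Measure.pi fun _ => ρ) ≤ ENNReal.ofReal M := fun t ht =>
    lintegral_residual_sq_le hκ hK hreg hnoise hη hstab t ht.le
  have key := lintegral_sgd_le hK hreg hnoise D q A hD η (M := M) (by positivity) T hM' 1
  simp only [one_mul, polyAt_one, one_apply_eq_self] at key
  have hV0 : 0 ≤ V := Finset.sum_nonneg fun t _ => div_nonneg (sq_nonneg _)
    (Real.rpow_nonneg (add_nonneg zero_le_one (tail_nonneg (fun j hj => (hη j hj).1) t)) _)
  have hbias : ‖polyAt A (decayPoly η 0 T) q‖ ^ 2 ≤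
      (s ^ s) ^ 2 * ‖g‖ ^ 2 * S ^ (-(2 * r - β)) := by
    have h1 := ContinuousLinearMap.le_of_opNorm_le _ (norm_decay_mul_opRPow_le hA hη hs0 hS) g
    have h2 : (S ^ (-s)) ^ 2 = S ^ (-(2 * r - β)) := by
      rw [← Real.rpow_natCast, ← Real.rpow_mul hS.le, hs]
      congr 1
      push_cast
      ring
    calc _ ≤ (s ^ s * S ^ (-s) * ‖g‖) ^ 2 := pow_le_pow_left₀ (norm_nonneg _) h1 2
      _ = _ := by rw [mul_pow, mul_pow, h2]; ring
  have hvar : ∑ t ∈ Finset.Icc 1 T, η t ^ 2 * ‖polyAt A (decayPoly η t T) ∘L D‖ ^ 2 ≤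
      ((1 + 2 * κ ^ 2) / 2) ^ (1 - β) * V := by
    rw [hV, Finset.mul_sum]
    refine Finset.sum_le_sum fun t _ => ?_
    have h3 := norm_decay_mul_opRPow_sq_le hA hAn hη t hβ1'.le (by linarith)
    have h4 : ‖polyAt A (decayPoly η t T) ∘L D‖ ≤
        ‖polyAt A (decayPoly η t T) * opRPow A ((1 - β) / 2)‖ := by
      calc _ = ‖(polyAt A (decayPoly η t T) * opRPow A ((1 - β) / 2)) ∘L U‖ := rfl
        _ ≤ ‖polyAt A (decayPoly η t T) * opRPow A ((1 - β) / 2)‖ * ‖U‖ :=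
          ContinuousLinearMap.opNorm_comp_le _ _
        _ ≤ _ := mul_le_of_le_one_right (norm_nonneg _) hU1
    calc _ ≤ η t ^ 2 * (((1 + 2 * κ ^ 2) / 2) ^ (1 - β) /
            (1 + ∑ j ∈ Finset.Icc (t + 1) T, η j) ^ (1 - β)) := by
          gcongr
          exact (pow_le_pow_left₀ (norm_nonneg _) h4 2).trans h3
      _ = _ := by ring
  calc misspecError hK ρ f β η T ≤ ∫⁻ z : Fin T → X × Y,
        ENNReal.ofReal B * ‖D (sgd K η T z) - q‖ₑ ^ 2 ∂(Measure.pi fun _ => ρ) := by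
        refine lintegral_mono fun z => ?_
        have h1 := interpNorm_opRPow_sq_le hA hβ0 hβ1 (D (sgd K η T z) - q)
        rw [← hres] at h1
        exact h1
    _ = ENNReal.ofReal B * ∫⁻ z : Fin T → X × Y, ‖D (sgd K η T z) - q‖ₑ ^ 2
          ∂(Measure.pi fun _ => ρ) := lintegral_const_mul' _ _ ENNReal.ofReal_ne_top
    _ ≤ ENNReal.ofReal B * ENNReal.ofReal (‖polyAt A (decayPoly η 0 T) q‖ ^ 2 +
          2 * κ ^ 2 * (M + σ ^ 2) *
            ∑ t ∈ Finset.Icc 1 T, η t ^ 2 * ‖polyAt A (decayPoly η t T) ∘L D‖ ^ 2) := by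
        gcongr
    _ ≤ _ := by
        rw [← ENNReal.ofReal_mul hB0.le]
        refine ENNReal.ofReal_le_ofReal ?_
        have hSp : 0 ≤ S ^ (-(2 * r - β)) := by positivity
        set P := S ^ (-(2 * r - β))
        set a := (s ^ s) ^ 2 * ‖g‖ ^ 2
        set b := 2 * κ ^ 2 * (M + σ ^ 2) * ((1 + 2 * κ ^ 2) / 2) ^ (1 - β) with hb
        have ha0 : 0 ≤ a := by positivity
        have hb0 : 0 ≤ b := by positivity
        calc _ ≤ B * (a * P + 2 * κ ^ 2 * (M + σ ^ 2) *
              (((1 + 2 * κ ^ 2) / 2) ^ (1 - β) * V)) := by gcongr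
          _ = B * a * P + B * b * V := by rw [hb]; ring
          _ ≤ _ := by
            have : 0 ≤ B * a * V + B * b * P + P + V := by positivity
            linarith

end Scheme

/-! ### Rates -/

theorem sum_mul_rpow_neg_lower {θ a e : ℝ} (hθ0 : 0 ≤ θ) (ha : 0 < a) (he : 0 ≤ e) {T : ℕ}
    (hT : 1 ≤ T) :
    (∑ j ∈ Finset.Icc 1 T, a * (j : ℝ) ^ (-θ)) ^ (-e) ≤ a ^ (-e) * (T : ℝ) ^ (-(e * (1 - θ))) := by
  have hT0 : (0 : ℝ) < T := by exact_mod_cast hT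
  have h1 := mul_rpow_le_sum_rpow_neg hθ0 (Nat.zero_le T)
  rw [Nat.cast_zero, sub_zero, zero_add] at h1
  rw [← Finset.mul_sum]
  have h2 : (T : ℝ) * (T : ℝ) ^ (-θ) = (T : ℝ) ^ (1 - θ) := by
    rw [sub_eq_add_neg, Real.rpow_add hT0, Real.rpow_one]
  calc _ ≤ (a * (T : ℝ) ^ (1 - θ)) ^ (-e) :=
        Real.rpow_le_rpow_of_nonpos (by positivity) (by rw [← h2]; gcongr) (by linarith)
    _ = _ := by
        rw [Real.mul_rpow ha.le (by positivity), ← Real.rpow_mul hT0.le]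
        ring_nf

/-- The rate of the variance term for decaying step sizes. -/
noncomputable def varianceRate (β θ x : ℝ) : ℝ :=
  if θ ≤ 1 / 2 then (x + 1) ^ (β - θ * (1 + β)) * (if θ = 1 / 2 then Real.log (x + 1) else 1)
  else (x + 1) ^ (-((1 - β) * (1 - θ)))

theorem div_one_add_mono {m n : ℝ} (hm : 0 ≤ m) (hmn : m ≤ n) : m / (1 + m) ≤ n / (1 + n) := by
  rw [div_le_div_iff₀ (by linarith) (by linarith)]
  nlinarith

/-- The bias exponent `-(2r-β)(1-θ)` and the variance exponent `β-θ(1+β)` meet at `θ = 2r/(1+2r)`,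
while the threshold is the smaller of this value and `1/2`. The factor `2` compensates for the
logarithm possibly being as small as `1/2`. -/
theorem decay_rates_of_le {β r θ x : ℝ} (hr : 0 < r) (hx : 1 ≤ x)
    (hθ : θ ≤ min (2 * r) 1 / (1 + min (2 * r) 1)) :
    (x + 1) ^ (-((2 * r - β) * (1 - θ))) ≤
        2 * ((x + 1) ^ (β - θ * (1 + β)) * (if θ = 1 / 2 then Real.log (x + 1) else 1)) ∧
      varianceRate β θ x =
        (x + 1) ^ (β - θ * (1 + β)) * (if θ = 1 / 2 then Real.log (x + 1) else 1) := by
  have hm : 0 < min (2 * r) 1 := lt_min (by linarith) one_pos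
  have h1 : θ ≤ 1 / 2 := by
    refine hθ.trans ((div_one_add_mono hm.le (min_le_right _ _)).trans ?_)
    norm_num
  have h2 : θ * (1 + 2 * r) ≤ 2 * r := by
    rw [← le_div_iff₀ (by linarith)]
    exact hθ.trans (div_one_add_mono hm.le (min_le_left _ _))
  refine ⟨?_, if_pos h1⟩
  have h3 : (x + 1) ^ (-((2 * r - β) * (1 - θ))) ≤ (x + 1) ^ (β - θ * (1 + β)) :=
    Real.rpow_le_rpow_of_exponent_le (by linarith) (by nlinarith)
  have h4 : 1 / 2 ≤ (if θ = 1 / 2 then Real.log (x + 1) else 1) := by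
    split_ifs
    · exact half_le_log_add_one hx
    · norm_num
  have h5 : 0 < (x + 1) ^ (β - θ * (1 + β)) := Real.rpow_pos_of_pos (by linarith) _
  nlinarith

/-- Beyond the threshold either `θ > 1/2`, where the variance has exponent `-(1-β)(1-θ)`, or the
variance power lies below the bias power by the gap `θ(1+2r) - 2r > 0`, which also absorbs the
logarithm at `θ = 1/2`. -/
theorem decay_rates_of_lt {β r θ x : ℝ} (hr : 0 < r) (hx : 1 ≤ x) (hθ1 : θ < 1)
    (hθ : min (2 * r) 1 / (1 + min (2 * r) 1) < θ) :
    (x + 1) ^ (-((2 * r - β) * (1 - θ))) ≤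
        (x + 1) ^ (-(min (2 * r - β) (1 - β) * (1 - θ))) ∧
      varianceRate β θ x ≤ (1 + 1 / |θ * (1 + 2 * r) - 2 * r|) *
        (x + 1) ^ (-(min (2 * r - β) (1 - β) * (1 - θ))) := by
  have hx1 : 1 ≤ x + 1 := by linarith
  have hx0 : 0 < x + 1 := by linarith
  have hq : 0 ≤ 1 - θ := by linarith
  refine ⟨Real.rpow_le_rpow_of_exponent_le hx1
    (neg_le_neg (mul_le_mul_of_nonneg_right (min_le_left _ _) hq)), ?_⟩
  rw [varianceRate]
  split_ifs with h1 h2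
  -- This treats the branches with `θ ≤ 1/2`: there the threshold being exceeded forces `2r < 1`,
  -- and the variance power factors through the bias power.
  all_goals try
    rcases le_total 1 (2 * r) with hle | hle
    · rw [min_eq_right hle] at hθ
      norm_num at hθ
      linarith
    rw [min_eq_left hle, div_lt_iff₀ (by linarith)] at hθ
    have hd : 0 < θ * (1 + 2 * r) - 2 * r := by linarith
    rw [min_eq_left (by linarith), abs_of_pos hd,
      show β - θ * (1 + β) = -((2 * r - β) * (1 - θ)) + -(θ * (1 + 2 * r) - 2 * r) by ring,
      Real.rpow_add hx0, mul_assoc, mul_comm]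
    refine mul_le_mul_of_nonneg_right ?_ (by positivity)
  · exact (rpow_neg_mul_log_le hx0 hd).trans (by linarith)
  · rw [mul_one]
    have h3 := Real.rpow_le_one_of_one_le_of_nonpos hx1 (neg_nonpos.2 hd.le)
    have : 0 < 1 / (θ * (1 + 2 * r) - 2 * r) := by positivity
    linarith
  · refine (Real.rpow_le_rpow_of_exponent_le hx1
      (neg_le_neg (mul_le_mul_of_nonneg_right (min_le_right (2 * r - β) _) hq))).trans ?_
    refine le_mul_of_one_le_left (by positivity) ?_
    have : 0 ≤ 1 / |θ * (1 + 2 * r) - 2 * r| := by positivity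
    linarith

end OVK

/-! ### Assembly of the convergence rates -/

theorem theorem2 {𝕜 X Y : Type*} [RCLike 𝕜]
    [TopologicalSpace X] [PolishSpace X] [MeasurableSpace X] [BorelSpace X]
    [NormedAddCommGroup Y] [InnerProductSpace 𝕜 Y] [CompleteSpace Y] [SecondCountableTopology Y]
    [MeasurableSpace Y] [BorelSpace Y]
    -- the kernel
    (K : Matrix X X (Y →L[𝕜] Y)) [Fact K.PosSemidef] (κ : ℝ) (hκ : 0 < κ)
    (hK : OVK.IsBoundedMercer K κ)
    -- the distribution of the data, whose marginal on `X` has full support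
    (ρ : Measure (X × Y)) [IsProbabilityMeasure ρ] (hsupp : ρ.fst.IsOpenPosMeasure)
    (β : ℝ) (hβ0 : 0 < β) (hβ1 : β < 1)
    -- bounded noise variance
    (σ : ℝ) (hσ : 0 < σ)
    (hnoise : ∫⁻ z, ‖z.2 - OVK.regression 𝕜 ρ z.1‖ₑ ^ 2 ∂ρ ≤ ENNReal.ofReal (σ ^ 2))
    -- the source condition `h† = L_K ^ r g†`
    (r : ℝ) (hr : β / 2 < r) (hreg : MemLp (OVK.regression 𝕜 ρ) 2 ρ.fst) (g : Lp Y 2 ρ.fst)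
    (hsource : hreg.toLp (OVK.regression 𝕜 ρ) = OVK.opRPow (OVK.integralOp hK ρ.fst) r g) :
    -- decaying step sizes `η_t = η₁ t ^ (-θ)`
    (∀ θ : ℝ, 0 < θ → θ < 1 → ∃ c : ℝ, 0 < c ∧
      ∀ η₁ : ℝ, 0 < η₁ → η₁ * ‖OVK.integralOp hK ρ.fst‖ < 1 → η₁ < 1 - θ →
        η₁ < OVK.gammaDecay κ θ → ∀ T : ℕ, 1 ≤ T →
        (β / (1 + β) < θ → θ ≤ min (2 * r) 1 / (1 + min (2 * r) 1) →
          OVK.misspecError hK ρ (hreg.toLp (OVK.regression 𝕜 ρ)) β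
              (fun t => η₁ * (t : ℝ) ^ (-θ)) T ≤
            ENNReal.ofReal (c * η₁ ^ (-(2 * r - β)) * ((T : ℝ) + 1) ^ (β - θ * (1 + β)) *
              (if θ = 1 / 2 then Real.log ((T : ℝ) + 1) else 1))) ∧
        (min (2 * r) 1 / (1 + min (2 * r) 1) < θ →
          OVK.misspecError hK ρ (hreg.toLp (OVK.regression 𝕜 ρ)) β
              (fun t => η₁ * (t : ℝ) ^ (-θ)) T ≤
            ENNReal.ofReal (c * η₁ ^ (-(2 * r - β)) *
              ((T : ℝ) + 1) ^ (-(min (2 * r - β) (1 - β) * (1 - θ)))))) ∧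
    -- constant step sizes `η_t = η T ^ (-θ')`, `t = 1, …, T`
    (∀ θ' : ℝ, 0 < θ' → θ' < 1 → ∃ c' : ℝ, 0 < c' ∧
      ∀ η : ℝ, 0 < η → η * ‖OVK.integralOp hK ρ.fst‖ < 1 → η < 1 →
        η < OVK.gammaConst κ θ' → ∀ T : ℕ, 1 ≤ T →
        (β / (1 + β) < θ' → θ' ≤ 2 * r / (2 * r + 1) →
          OVK.misspecError hK ρ (hreg.toLp (OVK.regression 𝕜 ρ)) β
              (fun _ => η * (T : ℝ) ^ (-θ')) T ≤
            ENNReal.ofReal (c' * η ^ (-(2 * r - β)) * (T : ℝ) ^ (β - θ' * (1 + β)))) ∧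
        (2 * r / (2 * r + 1) < θ' →
          OVK.misspecError hK ρ (hreg.toLp (OVK.regression 𝕜 ρ)) β
              (fun _ => η * (T : ℝ) ^ (-θ')) T ≤
            ENNReal.ofReal (c' * η ^ (-(2 * r - β)) * (T : ℝ) ^ (-((2 * r - β) * (1 - θ')))))) := by
  have hr0 : 0 < r := by linarith
  have he : 0 < 2 * r - β := by linarith
  obtain ⟨C, hC0, hC⟩ :=
    OVK.exists_misspecError_le hκ hK hreg hnoise hβ0 hβ1 hr g hsource
  refine ⟨fun θ hθ0 hθ1 => ?_, fun θ hθ0 hθ1 => ?_⟩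
  · obtain ⟨V, hV0, hV⟩ := OVK.exists_sum_decay_rpow_le hβ0 hβ1 hθ0 hθ1
    -- `P` pays for passing from `T` to `T + 1` in the bias, and `1 + D` for comparing the variance
    -- with the final rate. At the crossover `θ = 2r/(1+2r)` division by zero makes `D = 0`; there
    -- the bound with gap in the denominator is not applied.
    set P : ℝ := 2 ^ |-((2 * r - β) * (1 - θ))| with hP
    have hP0 : 0 < P := by positivity
    set D : ℝ := 1 / |θ * (1 + 2 * r) - 2 * r| with hD
    have hD0 : 0 ≤ D := by positivity
    refine ⟨C * (2 * P + V * (1 + D)), by positivity, fun a ha0 haA ha1 haγ T hT => ?_⟩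
    have hT1 : (1 : ℝ) ≤ T := by exact_mod_cast hT
    have ha1' : a ≤ 1 := by linarith
    -- The variance bound carries no power of `a`; as `a ≤ 1`, it may be multiplied by `a^{-(2r-β)}`
    -- to match the bias.
    have hae : 1 ≤ a ^ (-(2 * r - β)) :=
      Real.one_le_rpow_of_pos_of_le_one_of_nonpos ha0 ha1' (by linarith)
    have hS0 : 0 < ∑ j ∈ Finset.Icc 1 T, a * (j : ℝ) ^ (-θ) := by
      refine Finset.sum_pos (fun j hj => ?_) ⟨1, Finset.mem_Icc.2 ⟨le_rfl, hT⟩⟩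
      have : (0 : ℝ) < j := by exact_mod_cast (Finset.mem_Icc.1 hj).1
      positivity
    have hmain := hC (fun t => a * (t : ℝ) ^ (-θ)) T (fun j hj => by
      have hj1 : (1 : ℝ) ≤ j := by exact_mod_cast (Finset.mem_Icc.1 hj).1
      have h1 := Real.rpow_le_one_of_one_le_of_nonpos hj1 (neg_nonpos.2 hθ0.le)
      have h2 : 0 ≤ (j : ℝ) ^ (-θ) := by positivity
      have h3 := norm_nonneg (OVK.integralOp hK ρ.fst)
      refine ⟨by positivity, ?_⟩
      calc a * (j : ℝ) ^ (-θ) * ‖OVK.integralOp hK ρ.fst‖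
          = (j : ℝ) ^ (-θ) * (a * ‖OVK.integralOp hK ρ.fst‖) := by ring
        _ ≤ 1 := mul_le_one₀ h1 (by positivity) haA.le)
      (fun n _ => OVK.sum_decay_le_of_lt_gammaDecay hκ hθ0 hθ1 ha0 ha1 haγ n) hS0
    have hb := (OVK.sum_mul_rpow_neg_lower hθ0.le ha0 he.le hT).trans
      (mul_le_mul_of_nonneg_left (OVK.rpow_le_two_rpow_abs_mul hT1 _) (by positivity))
    have hv : _ ≤ V * OVK.varianceRate β θ T := hV a ha0 ha1' T hT
    have key : ∀ R : ℝ, 0 ≤ R →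
        ((T : ℝ) + 1) ^ (-((2 * r - β) * (1 - θ))) ≤ 2 * R →
        OVK.varianceRate β θ T ≤ (1 + D) * R →
        OVK.misspecError hK ρ (hreg.toLp (OVK.regression 𝕜 ρ)) β
          (fun t => a * (t : ℝ) ^ (-θ)) T ≤
          ENNReal.ofReal (C * (2 * P + V * (1 + D)) * a ^ (-(2 * r - β)) * R) := by
      intro R hR h1 h2
      refine hmain.trans (ENNReal.ofReal_le_ofReal ?_)
      rw [mul_assoc, mul_assoc]
      refine mul_le_mul_of_nonneg_left ?_ hC0.le
      calc _ ≤ a ^ (-(2 * r - β)) * (P * (2 * R)) + V * ((1 + D) * R) :=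
            add_le_add (hb.trans (by gcongr)) (hv.trans (by gcongr))
        _ ≤ a ^ (-(2 * r - β)) * (P * (2 * R)) + a ^ (-(2 * r - β)) * (V * ((1 + D) * R)) := by
            exact add_le_add le_rfl (le_mul_of_one_le_left (by positivity) hae)
        _ = _ := by ring
    refine ⟨fun _ hθ => ?_, fun hθ => ?_⟩
    · obtain ⟨h1, h2⟩ := OVK.decay_rates_of_le (β := β) hr0 hT1 hθ
      have hlog := OVK.half_le_log_add_one hT1
      have hR : 0 ≤ ((T : ℝ) + 1) ^ (β - θ * (1 + β)) *
          (if θ = 1 / 2 then Real.log ((T : ℝ) + 1) else 1) := by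
        split_ifs <;> positivity
      rw [mul_assoc]
      exact key _ hR h1 (h2.le.trans (le_mul_of_one_le_left hR (by linarith)))
    · obtain ⟨h1, h2⟩ := OVK.decay_rates_of_lt hr0 hT1 hθ1 hθ
      exact key _ (by positivity) (h1.trans (le_mul_of_one_le_left (by positivity) one_le_two)) h2
  · refine ⟨C * (2 + 1 / β), by positivity, fun a ha0 haA ha1 haγ T hT => ?_⟩
    have hT1 : (1 : ℝ) ≤ T := by exact_mod_cast hT
    have hT0 : (0 : ℝ) < T := by linarith
    have hae : 1 ≤ a ^ (-(2 * r - β)) :=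
      Real.one_le_rpow_of_pos_of_le_one_of_nonpos ha0 ha1.le (by linarith)
    have hS : ∑ _j ∈ Finset.Icc 1 T, a * (T : ℝ) ^ (-θ) = a * (T : ℝ) ^ (1 - θ) := by
      rw [Finset.sum_const, Nat.card_Icc, Nat.add_sub_cancel, nsmul_eq_mul, sub_eq_add_neg,
        Real.rpow_add hT0, Real.rpow_one]
      ring
    have hmain := hC (fun _ => a * (T : ℝ) ^ (-θ)) T (fun j hj => by
      have h1 := Real.rpow_le_one_of_one_le_of_nonpos hT1 (neg_nonpos.2 hθ0.le)
      have h3 := norm_nonneg (OVK.integralOp hK ρ.fst)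
      refine ⟨by positivity, ?_⟩
      calc a * (T : ℝ) ^ (-θ) * ‖OVK.integralOp hK ρ.fst‖
          = (T : ℝ) ^ (-θ) * (a * ‖OVK.integralOp hK ρ.fst‖) := by ring
        _ ≤ 1 := mul_le_one₀ h1 (by positivity) haA.le)
      (fun n hn => OVK.sum_const_le_of_lt_gammaConst hκ hθ0 ha0 ha1 haγ hT hn)
      (by rw [hS]; positivity)
    have hb : (∑ _j ∈ Finset.Icc 1 T, a * (T : ℝ) ^ (-θ)) ^ (-(2 * r - β)) =
        a ^ (-(2 * r - β)) * (T : ℝ) ^ (-((2 * r - β) * (1 - θ))) := by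
      rw [hS, Real.mul_rpow ha0.le (by positivity), ← Real.rpow_mul hT0.le]
      ring_nf
    have hv := OVK.sum_const_rpow_le hβ0 hβ1 hθ0 ha0 ha1.le hT
    -- It suffices that the exponent `p` exceeds both the bias and the variance exponent; which of
    -- them is larger changes at `θ = 2r/(2r+1)`.
    have key : ∀ p : ℝ, -((2 * r - β) * (1 - θ)) ≤ p → β - θ * (1 + β) ≤ p →
        OVK.misspecError hK ρ (hreg.toLp (OVK.regression 𝕜 ρ)) β
          (fun _ => a * (T : ℝ) ^ (-θ)) T ≤
          ENNReal.ofReal (C * (2 + 1 / β) * a ^ (-(2 * r - β)) * (T : ℝ) ^ p) := by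
      intro p h1 h2
      refine hmain.trans (ENNReal.ofReal_le_ofReal ?_)
      rw [mul_assoc, mul_assoc]
      refine mul_le_mul_of_nonneg_left ?_ hC0.le
      calc _ ≤ a ^ (-(2 * r - β)) * (T : ℝ) ^ p + (1 + 1 / β) * (T : ℝ) ^ p := by
            refine add_le_add (hb.le.trans ?_) (hv.trans ?_) <;> gcongr
        _ ≤ a ^ (-(2 * r - β)) * (T : ℝ) ^ p +
            a ^ (-(2 * r - β)) * ((1 + 1 / β) * (T : ℝ) ^ p) := by
            exact add_le_add le_rfl (le_mul_of_one_le_left (by positivity) hae)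
        _ = _ := by ring
    refine ⟨fun _ hθ => ?_, fun hθ => ?_⟩
    · rw [le_div_iff₀ (by linarith)] at hθ
      exact key _ (by nlinarith) le_rfl
    · rw [div_lt_iff₀ (by linarith)] at hθ
      exact key _ le_rfl (by nlinarith)
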